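/- Theorem (bifurcation from the linear ground state). Let $d\ge 1$, $\sigma\ge 1$, and let $V:\mathbb{R}^d\to\mathbb{R}$ be smooth and rapidly decreasing at infinity, i.e. $\sup_x |x|^N|V(x)|<\infty$ for every $N\ge 0$. Assume that $H=-\Delta+V$, as an operator on $L^2(\mathbb{R}^d;\mathbb{C})$, has at least one discrete eigenvalue (an eigenvalue of finite multiplicity that is an isolated point of the spectrum). Put $$E_{0\star}=\inf\Big\{\int_{\mathbb{R}^d}|\nabla f|^2+V|f|^2\,dx \;:\; f\in H^1(\mathbb{R}^d),\ \int|f|^2=1\Big\}.$$ Then $E_{0\star}<0$, and there is a ground state: a continuous, everywhere positive function $\psi_{0\star}\in H^1(\mathbb{R}^d)$ with $\int\psi_{0\star}^2=1$ which attains this infimum and satisfies $H\psi_{0\star}=E_{0\star}\psi_{0\star}$ weakly. For every such $\psi_{0\star}$ the integral $\int\psi_{0\star}^{2\sigma+2}$ is finite, and with $$\rho(E)=|E_{0\star}-E|^{\frac1{2\sigma}}\Big(\int\psi_{0\star}^{2\sigma+2}\Big)^{-\frac1{2\sigma}}$$ there are constants $\delta_0>0$ and $C$ such that for every $E\in[E_{0\star}-\delta_0,E_{0\star})$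 (in particular $E<0$) the equation $$(-\Delta+V-|\psi_E|^{2\sigma})\psi_E=E\psi_E$$ has a continuous, everywhere positive weak solution $\psi_E\in H^1(\mathbb{R}^d)$ of the form $$\psi_E(x)=\rho(E)\big(\psi_{0\star}(x)+R_E(x)\big),\qquad \|R_E\|_{H^1}\le C\rho(E)^{2\sigma},\quad \sup_x|R_E(x)|\le C\rho(E)^{2\sigma}.$$ -/

import Mathlib

open MeasureTheory Filter Topology
open scoped ContDiff NNReal ENNReal InnerProductSpace

noncomputable section

namespace NLSBif

/-- Euclidean space `ℝ^d`. -/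
abbrev Space (d : ℕ) := EuclideanSpace ℝ (Fin d)

section Sobolev

variable {d : ℕ} {F : Type*} [NormedAddCommGroup F] [NormedSpace ℝ F]

/-- `g` is the weak partial derivative `∂_i u` on `ℝ^d`. -/
def HasWeakPartial (i : Fin d) (u g : Space d → F) : Prop :=
  LocallyIntegrable u volume ∧ LocallyIntegrable g volume ∧
    ∀ φ : Space d → ℝ, ContDiff ℝ ∞ φ → HasCompactSupport φ →
      ∫ x, (fderiv ℝ φ x (EuclideanSpace.single i 1)) • u x = - ∫ x, φ x • g x

/-- `u` belongs to the Sobolev space `H^1(ℝ^d)`. -/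
def MemH1 (u : Space d → F) : Prop :=
  MemLp u 2 volume ∧ ∀ i : Fin d, ∃ g : Space d → F, MemLp g 2 volume ∧ HasWeakPartial i u g

open Classical in
/-- The weak partial derivative `∂_i u` (a representative of its a.e. class; weak derivatives
are unique almost everywhere), and `0` if there is none. -/
def weakPartial (i : Fin d) (u : Space d → F) : Space d → F :=
  if h : ∃ g : Space d → F, HasWeakPartial i u g then h.choose else 0

/-- The norm of `H^1(ℝ^d)`. -/
def h1Norm (u : Space d → F) : ℝ :=
  Real.sqrt ((∫ x, ‖u x‖ ^ 2) + ∑ i : Fin d, ∫ x, ‖weakPartial i u x‖ ^ 2)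

/-- The quadratic form `⟨Hu, u⟩ = ∫ |∇u|² + V |u|²` of `H = -Δ + V`, for `u ∈ H^1`. -/
def energy (V : Space d → ℝ) (u : Space d → F) : ℝ :=
  ∫ x, ((∑ i : Fin d, ‖weakPartial i u x‖ ^ 2) + V x * ‖u x‖ ^ 2)

/-- `-Δu + V u = f` on `ℝ^d` in the sense of distributions. -/
def SchrodingerEq (V : Space d → ℝ) (u f : Space d → F) : Prop :=
  LocallyIntegrable u volume ∧ LocallyIntegrable f volume ∧
    ∀ φ : Space d → ℝ, ContDiff ℝ ∞ φ → HasCompactSupport φ →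
      ∫ x, (- (Laplacian.laplacian φ : Space d → ℝ) x + V x * φ x) • u x = ∫ x, φ x • f x

end Sobolev

variable {d : ℕ}

/-- `V` is smooth and decays faster than every power of `|x|` at infinity. -/
def SmoothRapidlyDecreasing (V : Space d → ℝ) : Prop :=
  ContDiff ℝ ∞ V ∧ ∀ N : ℕ, ∃ C : ℝ, ∀ x, ‖x‖ ^ N * |V x| ≤ C

/-- The eigenfunctions of `-Δ + V` in `L²(ℝ^d; ℂ)` for `z`, together with `0`. -/
def eigenfunctions (V : Space d → ℝ) (z : ℂ) : Set (Lp ℂ 2 (volume : Measure (Space d))) :=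
  {u | MemH1 (u : Space d → ℂ) ∧ SchrodingerEq V (u : Space d → ℂ) (fun x => z * u x)}

/-- The resolvent set of the operator `H = -Δ + V` in `L²(ℝ^d; ℂ)`: the `z` for which `H - z`
is injective and has an everywhere defined bounded inverse. The domain of `H` consists of the
`u ∈ H^1` for which the distribution `-Δu + V u` is in `L²`. -/
def resolventSet (V : Space d → ℝ) : Set ℂ :=
  {z | (∀ u : Space d → ℂ, MemH1 u → SchrodingerEq V u (fun x => z * u x) → u =ᵐ[volume] 0) ∧
    ∃ C : ℝ≥0, ∀ f : Space d → ℂ, MemLp f 2 volume →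
      ∃ u : Space d → ℂ, MemH1 u ∧ SchrodingerEq V u (fun x => z * u x + f x) ∧
        eLpNorm u 2 volume ≤ C * eLpNorm f 2 volume}

/-- `lam` is a discrete eigenvalue of `-Δ + V`: an eigenvalue of finite multiplicity that is an
isolated point of the spectrum. -/
def IsDiscreteEigenvalue (V : Space d → ℝ) (lam : ℝ) : Prop :=
  (∃ u ∈ eigenfunctions V (lam : ℂ), u ≠ 0) ∧
    FiniteDimensional ℂ (Submodule.span ℂ (eigenfunctions V (lam : ℂ))) ∧
    ∀ᶠ z in 𝓝[≠] (lam : ℂ), z ∈ resolventSet V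

/-- `E₀ = inf { ⟨Hf, f⟩ : f ∈ H^1(ℝ^d), ∫ |f|² = 1 }`. -/
def groundStateEnergy (V : Space d → ℝ) : ℝ :=
  sInf {e : ℝ | ∃ f : Space d → ℂ, MemH1 f ∧ ∫ x, ‖f x‖ ^ 2 = 1 ∧ energy V f = e}

/-- `ψ₀` is a positive, `L²`-normalized ground state of `-Δ + V`: it attains the infimum that
defines the ground state energy, and is an eigenfunction for it. -/
structure IsGroundState (V : Space d → ℝ) (ψ₀ : Space d → ℝ) : Prop where
  continuous : Continuous ψ₀
  pos : ∀ x, 0 < ψ₀ x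
  memH1 : MemH1 ψ₀
  normalized : ∫ x, ψ₀ x ^ 2 = 1
  attained : energy V ψ₀ = groundStateEnergy V
  eigen : SchrodingerEq V ψ₀ (fun x => groundStateEnergy V * ψ₀ x)

/-- `ψ` is a positive solution in `H^1` of `(-Δ + V - |ψ|^{2σ}) ψ = E ψ` with `E < 0`. -/
structure IsPositiveBoundState (V : Space d → ℝ) (σ E : ℝ) (ψ : Space d → ℝ) : Prop where
  energy_neg : E < 0
  continuous : Continuous ψ
  pos : ∀ x, 0 < ψ x
  memH1 : MemH1 ψ
  eqn : SchrodingerEq V ψ (fun x => |ψ x| ^ (2 * σ) * ψ x + E * ψ x)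

/-- The amplitude `ρ(E) = |E₀ - E|^{1/(2σ)} (∫ ψ₀^{2σ+2})^{-1/(2σ)}`. -/
def rho (V : Space d → ℝ) (σ : ℝ) (ψ₀ : Space d → ℝ) (E : ℝ) : ℝ :=
  |groundStateEnergy V - E| ^ (1 / (2 * σ)) *
    (∫ x, ψ₀ x ^ (2 * σ + 2)) ^ (-(1 / (2 * σ)))

end NLSBif

end

/-!
The potential `V` is bounded and decays, so everything can be phrased in real `L²(ℝ^d)` through
the kernel of the resolvent `(-Δ + m)⁻¹`, which is convolution with the Yukawa kernel `G_m > 0`,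
an integrable function of mass `1 / m` (`conv_yukawa_sub_laplacian`, `exists_gradient_yukL`). The
space `H¹` is represented by the closed subspace `sobolevGraph` of pairs `(u, ∇u)`, and
`IsWeakSol` is the equation tested against `H¹`.

*The linear problem.* A modulated, translated and dilated bump is an approximate eigenfunction for
each `z > 0`, so no `z > 0` lies in the resolvent set (`notMem_resolventSet`). A discrete
eigenvalue is isolated, hence negative, and therefore `E₀ < 0`. The operator `V (-Δ - E₀)⁻¹` is
compact (`isCompactOperator_mul_yukL`). By the Fredholm alternative, if `H - E₀ + ⟨h, ·⟩ h` is
injective, then it has a bounded inverse (`exists_inverse`), and by Cauchy–Schwarz its form is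
coercive (`norm_sq_le_of_inverse`). For `h = 0` coercivity contradicts the definition of `E₀`, so
`E₀` is an eigenvalue. If `u` is an eigenfunction and `M` is large, the function
`q = (-Δ + M)⁻¹ ((M + E₀ - V) |u|)` satisfies `q ≥ |u|`, which makes it a minimizer of the form
(`isWeakSol_yukL_abs`); it is continuous and positive because `G_M` is. The same comparison shows
that eigenfunctions have one sign, so `E₀` is simple (`eigenfunction_eq_zero`). Boundedness comes
from splitting `G_M` into an `L²` part and a part of small mass (`exists_ae_bound`).

*The nonlinear problem.* Put `μ = E₀ - E`, `c = ∫ ψ₀^{2σ+2}` and `f(s) = |s|^{2σ} s`. Since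
`ρ^{2σ} = μ / c`, the function `ρ (ψ₀ + R)` solves the equation when `(H - E₀) R = μ N(R)` with
`N(R) = f(ψ₀ + R) / c - (ψ₀ + R)`, and `⟨ψ₀, N(0)⟩ = 0`. With `T = (H - E₀ + ⟨ψ₀, ·⟩ ψ₀)⁻¹`, one
looks for `R = μ T N(R) + a ψ₀`, where `a` is determined by solving the linearization of
`⟨ψ₀, N(R)⟩ = 0`, which is possible because `⟨ψ₀, N'(0) ψ₀⟩ = 2σ ≠ 0`. The resulting map is a
contraction on the functions that are `O(μ)` in `L²` and uniformly (`exists_fixedPoint_of_small`);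
at the fixed point `⟨ψ₀, N(R)⟩ = 2σμ ⟨ψ₀, N(R)⟩`, so this number vanishes and `R` solves the
equation (`inner_rhs_eq_zero`).

*Positivity.* Let `n` be the negative part of `u = ψ₀ + R`, and let `W` be the potential of the
linear equation solved by `u`. Then `q = (-Δ + M)⁻¹ (W n) ≥ n` almost minimizes the form, and it
is almost orthogonal to `ψ₀`, since `n` lives where `ψ₀ ≤ A μ`. The spectral gap forces `q = 0`
(`IsGround.eq_zero_of_le`), and `u > 0` follows from `u = (-Δ + M)⁻¹ (W u)`.
-/

noncomputable section

namespace NLSBif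

open scoped BoundedContinuousFunction

variable {d : ℕ}

/-! ### Convolution operators on `L²` -/

/-- Real-valued square integrable functions on `ℝ^d`. -/
abbrev L2 (d : ℕ) := Lp ℝ 2 (volume : Measure (Space d))

/-- The convolution `k ⋆ f`, i.e. `x ↦ ∫ k y * f (x - y) dy`. -/
def conv (k f : Space d → ℝ) : Space d → ℝ :=
  convolution k f (ContinuousLinearMap.lsmul ℝ ℝ) volume

lemma conv_apply (k f : Space d → ℝ) (x : Space d) : conv k f x = ∫ y, k y * f (x - y) := rfl

lemma conv_apply' (k f : Space d → ℝ) (x : Space d) : conv k f x = ∫ y, k (x - y) * f y := by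
  rw [conv, convolution_lsmul_swap]; rfl

lemma conv_congr {k f g : Space d → ℝ} (h : f =ᵐ[volume] g) : conv k f = conv k g :=
  convolution_congr _ EventuallyEq.rfl h

lemma sq_integral_mul_le {k u : Space d → ℝ} (hk : Integrable k)
    (hu : AEStronglyMeasurable u volume) (h : Integrable (fun y => |k y| * u y ^ 2)) :
    Integrable (fun y => k y * u y) ∧
      (∫ y, k y * u y) ^ 2 ≤ (∫ y, |k y|) * ∫ y, |k y| * u y ^ 2 := by
  have hI : Integrable (fun y => k y * u y) := by
    refine (hk.abs.add h).mono' (hk.aestronglyMeasurable.mul hu) (ae_of_all _ fun y => ?_)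
    simp only [Pi.add_apply, norm_mul, Real.norm_eq_abs]
    nlinarith [abs_nonneg (k y), sq_abs (u y), sq_nonneg (|u y| - 1), abs_nonneg (u y),
      mul_nonneg (abs_nonneg (k y)) (sq_nonneg (|u y| - 1)),
      mul_nonneg (abs_nonneg (k y)) (abs_nonneg (u y))]
  refine ⟨hI, ?_⟩
  have key : ∀ t : ℝ, 0 ≤ (∫ y, |k y|) * (t * t) + (2 * ∫ y, k y * u y) * t +
      ∫ y, |k y| * u y ^ 2 := by
    intro t
    have : (∫ y, |k y|) * (t * t) + (2 * ∫ y, k y * u y) * t + ∫ y, |k y| * u y ^ 2 =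
        ∫ y, (|k y| * (t * t) + 2 * (k y * u y) * t + |k y| * u y ^ 2) := by
      rw [integral_add _ h, integral_add, integral_mul_const, integral_mul_const,
        integral_const_mul]
      · exact hk.abs.mul_const _
      · exact (hI.const_mul 2).mul_const _
      · exact (hk.abs.mul_const _).add ((hI.const_mul 2).mul_const _)
    rw [this]
    refine integral_nonneg fun y => ?_
    dsimp only [Pi.zero_apply]
    rcases abs_cases (k y) with ⟨h1, h2⟩ | ⟨h1, h2⟩ <;> rw [h1]
    · nlinarith [mul_nonneg h2 (sq_nonneg (t + u y))]
    · nlinarith [mul_nonneg (neg_nonneg.2 h2.le) (sq_nonneg (t - u y))]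
  have := discrim_le_zero key
  rw [discrim] at this
  nlinarith

lemma conv_sq_le {k f : Space d → ℝ} (hk : Integrable k) (hf : MemLp f 2 volume) :
    ∀ᵐ x, Integrable (fun y => k y * f (x - y)) ∧
      conv k f x ^ 2 ≤ (∫ y, |k y|) * conv (fun y => |k y|) (fun y => f y ^ 2) x := by
  have hf2 : Integrable (fun y => f y ^ 2) := hf.integrable_sq
  have := Integrable.ae_convolution_exists (L := ContinuousLinearMap.lsmul ℝ ℝ) hk.abs hf2
  filter_upwards [this] with x hx
  have hm : AEStronglyMeasurable (fun y => f (x - y)) volume :=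
    hf.1.comp_quasiMeasurePreserving (quasiMeasurePreserving_sub_left_of_right_invariant _ x)
  exact sq_integral_mul_le hk hm hx

lemma aestronglyMeasurable_conv {k f : Space d → ℝ} (hk : AEStronglyMeasurable k volume)
    (hf : AEStronglyMeasurable f volume) : AEStronglyMeasurable (conv k f) volume :=
  (AEStronglyMeasurable.convolution_integrand (ContinuousLinearMap.lsmul ℝ ℝ)
    hk hf).integral_prod_right'

lemma memLp_conv {k f : Space d → ℝ} (hk : Integrable k) (hf : MemLp f 2 volume) :
    MemLp (conv k f) 2 volume := by
  rw [memLp_two_iff_integrable_sq (aestronglyMeasurable_conv hk.1 hf.1)]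
  have hI : Integrable (conv (fun y => |k y|) (fun y => f y ^ 2)) :=
    Integrable.integrable_convolution _ hk.abs hf.integrable_sq
  refine (hI.const_mul (∫ y, |k y|)).mono' ((aestronglyMeasurable_conv hk.1 hf.1).pow 2) ?_
  filter_upwards [conv_sq_le hk hf] with x hx
  simpa using hx.2

/-- Young's inequality `‖k ⋆ f‖₂ ≤ ‖k‖₁ ‖f‖₂`, in squared form. -/
lemma integral_conv_sq_le {k f : Space d → ℝ} (hk : Integrable k) (hf : MemLp f 2 volume) :
    ∫ x, conv k f x ^ 2 ≤ (∫ y, |k y|) ^ 2 * ∫ y, f y ^ 2 := by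
  have hI : Integrable (conv (fun y => |k y|) (fun y => f y ^ 2)) :=
    Integrable.integrable_convolution _ hk.abs hf.integrable_sq
  calc ∫ x, conv k f x ^ 2 ≤ ∫ x, (∫ y, |k y|) * conv (fun y => |k y|) (fun y => f y ^ 2) x := by
        refine integral_mono_ae (memLp_conv hk hf).integrable_sq (hI.const_mul _) ?_
        filter_upwards [conv_sq_le hk hf] with x hx using hx.2
    _ = (∫ y, |k y|) ^ 2 * ∫ y, f y ^ 2 := by
        rw [integral_const_mul, conv,
          integral_convolution _ hk.abs hf.integrable_sq]
        simp only [ContinuousLinearMap.lsmul_apply, smul_eq_mul]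
        ring

lemma L2.norm_sq_eq (f : L2 d) : ‖f‖ ^ 2 = ∫ x, f x ^ 2 := by
  rw [← real_inner_self_eq_norm_sq, L2.inner_def]
  simp [pow_two]

lemma L2.inner_eq (f g : L2 d) : ⟪f, g⟫_ℝ = ∫ x, f x * g x := by
  rw [L2.inner_def]; simp [mul_comm]

/-- The bounded operator on `L²` induced by an operation `T` on functions which is linear and
bounded by `C` on square integrable functions. -/
def L2.mkOp (T : (Space d → ℝ) → Space d → ℝ) (hT : ∀ f, MemLp f 2 volume → MemLp (T f) 2 volume)
    (hcongr : ∀ f g, f =ᵐ[volume] g → T f =ᵐ[volume] T g)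
    (hadd : ∀ f g, MemLp f 2 volume → MemLp g 2 volume → T (f + g) =ᵐ[volume] T f + T g)
    (hsmul : ∀ (c : ℝ) f, MemLp f 2 volume → T (c • f) =ᵐ[volume] c • T f) (C : ℝ) (hC : 0 ≤ C)
    (hle : ∀ f, MemLp f 2 volume → ∫ x, T f x ^ 2 ≤ C ^ 2 * ∫ x, f x ^ 2) : L2 d →L[ℝ] L2 d :=
  LinearMap.mkContinuous
    { toFun := fun f => MemLp.toLp (T f) (hT f (Lp.memLp f))
      map_add' := fun f g => by
        refine Lp.ext ?_
        refine (MemLp.coeFn_toLp _).trans ((hcongr _ _ (Lp.coeFn_add f g)).trans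
          ((hadd f g (Lp.memLp f) (Lp.memLp g)).trans (EventuallyEq.trans ?_
            (Lp.coeFn_add _ _).symm)))
        exact ((MemLp.coeFn_toLp _).add (MemLp.coeFn_toLp _)).symm
      map_smul' := fun c f => by
        refine Lp.ext ?_
        refine (MemLp.coeFn_toLp _).trans ((hcongr _ _ (Lp.coeFn_smul c f)).trans
          ((hsmul c f (Lp.memLp f)).trans (EventuallyEq.trans ?_ (Lp.coeFn_smul _ _).symm)))
        exact ((MemLp.coeFn_toLp _).const_smul c).symm }
    C (fun f => by
      refine le_of_sq_le_sq ?_ (by positivity)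
      rw [mul_pow, L2.norm_sq_eq, L2.norm_sq_eq]
      refine le_trans (le_of_eq (integral_congr_ae ?_)) (hle f (Lp.memLp f))
      filter_upwards [MemLp.coeFn_toLp (hT f (Lp.memLp f))] with x hx
      exact congrArg (· ^ 2) hx)

lemma L2.mkOp_coeFn (T : (Space d → ℝ) → Space d → ℝ) (hT hcongr hadd hsmul C hC hle) (f : L2 d) :
    L2.mkOp T hT hcongr hadd hsmul C hC hle f =ᵐ[volume] T f :=
  MemLp.coeFn_toLp (hT f (Lp.memLp f))

lemma L2.norm_mkOp_le (T : (Space d → ℝ) → Space d → ℝ) (hT hcongr hadd hsmul C hC hle) :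
    ‖L2.mkOp T hT hcongr hadd hsmul C hC hle‖ ≤ C :=
  LinearMap.mkContinuous_norm_le _ hC _

/-- Convolution with an integrable kernel as a bounded operator on `L²`. -/
def convL (k : Space d → ℝ) (hk : Integrable k) : L2 d →L[ℝ] L2 d :=
  L2.mkOp (conv k) (fun _ hf => memLp_conv hk hf) (fun f g h => by rw [conv_congr h])
    (fun f g hf hg => by
      filter_upwards [conv_sq_le hk hf, conv_sq_le hk hg] with x hf hg
      simp only [conv_apply, Pi.add_apply, mul_add]
      exact integral_add hf.1 hg.1)
    (fun c f _ => by rw [conv, convolution_smul]; rfl)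
    (∫ y, |k y|) (integral_nonneg fun _ => abs_nonneg _) (fun _ hf => integral_conv_sq_le hk hf)

lemma convL_coeFn (k : Space d → ℝ) (hk : Integrable k) (f : L2 d) :
    convL k hk f =ᵐ[volume] conv k f :=
  L2.mkOp_coeFn ..

lemma norm_convL_le (k : Space d → ℝ) (hk : Integrable k) : ‖convL k hk‖ ≤ ∫ y, |k y| :=
  L2.norm_mkOp_le ..

lemma convL_toLp (k : Space d → ℝ) (hk : Integrable k) {f : Space d → ℝ} (hf : MemLp f 2 volume) :
    convL k hk hf.toLp = (memLp_conv hk hf).toLp := by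
  refine Lp.ext ((convL_coeFn k hk _).trans ?_)
  rw [conv_congr hf.coeFn_toLp]
  exact (MemLp.coeFn_toLp _).symm

/-- Convolution with an even kernel is a symmetric operator. -/
lemma inner_convL_comm (k : Space d → ℝ) (hk : Integrable k) (hev : ∀ x, k (-x) = k x)
    (f g : L2 d) : ⟪convL k hk f, g⟫_ℝ = ⟪f, convL k hk g⟫_ℝ := by
  have key : ∀ f g : L2 d, ⟪convL k hk f, g⟫_ℝ = ∫ y, k y * ∫ x, f (x - y) * g x := by
    intro f g
    have hmp : ∀ y : Space d, MemLp (fun x => f (x - y)) 2 volume := fun y =>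
      (Lp.memLp f).comp_measurePreserving (measurePreserving_sub_right volume y)
    have hnorm : ∀ y : Space d, ∫ x, f (x - y) ^ 2 = ‖f‖ ^ 2 := fun y => by
      rw [L2.norm_sq_eq]
      exact integral_sub_right_eq_self (fun x => f x ^ 2) y
    have hmeas : AEStronglyMeasurable (fun p : Space d × Space d => k p.2 * f (p.1 - p.2) * g p.1)
        (volume.prod volume) :=
      (AEStronglyMeasurable.convolution_integrand (ContinuousLinearMap.lsmul ℝ ℝ)
        hk.1 (Lp.aestronglyMeasurable f)).mul (Lp.aestronglyMeasurable g).comp_fst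
    have hfg : ∀ y, Integrable (fun x => f (x - y) * g x) := fun y =>
      (hmp y).integrable_mul (Lp.memLp g)
    have hbd : ∀ y, ∫ x, |f (x - y) * g x| ≤ (‖f‖ ^ 2 + ‖g‖ ^ 2) / 2 := by
      intro y
      rw [← hnorm y, L2.norm_sq_eq g, ← integral_add (hmp y).integrable_sq
        (Lp.memLp g).integrable_sq, ← integral_div]
      refine integral_mono (hfg y).abs
        (((hmp y).integrable_sq.add (Lp.memLp g).integrable_sq).div_const 2) fun x => ?_
      dsimp only [Pi.add_apply]
      rw [abs_mul]
      nlinarith [sq_nonneg (|f (x - y)| - |g x|), sq_abs (f (x - y)), sq_abs (g x)]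
    have hint : Integrable (fun p : Space d × Space d => k p.2 * f (p.1 - p.2) * g p.1)
        (volume.prod volume) := by
      rw [integrable_prod_iff' hmeas]
      refine ⟨ae_of_all _ fun y => ?_, ?_⟩
      · simpa only [mul_assoc] using (hfg y).const_mul (k y)
      · refine (hk.abs.mul_const ((‖f‖ ^ 2 + ‖g‖ ^ 2) / 2)).mono'
          hmeas.norm.prod_swap.integral_prod_right' (ae_of_all _ fun y => ?_)
        have : ∫ x, ‖k y * f (x - y) * g x‖ = |k y| * ∫ x, |f (x - y) * g x| := by
          rw [← integral_const_mul]
          exact integral_congr_ae (ae_of_all _ fun x => by simp [abs_mul, mul_assoc])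
        rw [Real.norm_of_nonneg (integral_nonneg fun _ => norm_nonneg _)]
        exact this.trans_le (mul_le_mul_of_nonneg_left (hbd y) (abs_nonneg _))
    rw [L2.inner_eq]
    calc ∫ x, convL k hk f x * g x = ∫ x, ∫ y, k y * f (x - y) * g x := by
          refine integral_congr_ae ?_
          filter_upwards [convL_coeFn k hk f] with x hx
          rw [hx, conv_apply, integral_mul_const]
      _ = ∫ y, ∫ x, k y * f (x - y) * g x := integral_integral_swap hint
      _ = _ := by simp only [mul_assoc, integral_const_mul]
  rw [real_inner_comm (convL k hk g), key, key]
  rw [← integral_neg_eq_self (fun y => k y * ∫ x, f (x - y) * g x)]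
  refine integral_congr_ae (ae_of_all _ fun y => ?_)
  dsimp only
  rw [hev, ← integral_sub_right_eq_self (fun x => f (x - -y) * g x) y]
  simp [mul_comm]

lemma integrable_conv_of_bounded {k f : Space d → ℝ} (hk : Integrable k)
    (hf : AEStronglyMeasurable f volume) {B : ℝ} (hB : ∀ᵐ x, |f x| ≤ B) (x : Space d) :
    Integrable (fun y => k (x - y) * f y) := by
  refine ((hk.comp_sub_left x).abs.mul_const B).mono'
    ((hk.comp_sub_left x).1.mul hf) ?_
  filter_upwards [hB] with y hy
  rw [norm_mul, Real.norm_eq_abs, Real.norm_eq_abs]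
  exact mul_le_mul_of_nonneg_left hy (abs_nonneg _)

lemma abs_conv_le_of_bounded {k f : Space d → ℝ} (hk : Integrable k)
    {B : ℝ} (hB : ∀ᵐ x, |f x| ≤ B) (x : Space d) :
    |conv k f x| ≤ (∫ y, |k y|) * B := by
  rw [conv_apply', ← integral_sub_left_eq_self (fun y => |k y|) volume x, ← integral_mul_const,
    ← Real.norm_eq_abs]
  refine norm_integral_le_of_norm_le ((hk.comp_sub_left x).abs.mul_const B) ?_
  filter_upwards [hB] with y hy
  rw [norm_mul, Real.norm_eq_abs, Real.norm_eq_abs]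
  exact mul_le_mul_of_nonneg_left hy (abs_nonneg _)

lemma abs_conv_le_of_memLp {k : Space d → ℝ} (hk : MemLp k 2 volume)
    (f : L2 d) (x : Space d) : |conv k f x| ≤ ‖hk.toLp‖ * ‖f‖ := by
  have hk' : MemLp (fun y => k (x - y)) 2 volume :=
    hk.comp_measurePreserving (Measure.measurePreserving_sub_left volume x)
  have h1 : conv k f x = ⟪hk'.toLp, f⟫_ℝ := by
    rw [L2.inner_eq, conv_apply']
    refine integral_congr_ae ?_
    filter_upwards [hk'.coeFn_toLp] with y hy
    rw [hy]
  have h2 : ‖hk'.toLp‖ = ‖hk.toLp‖ := by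
    rw [← sq_eq_sq₀ (norm_nonneg _) (norm_nonneg _), L2.norm_sq_eq, L2.norm_sq_eq]
    have e1 : ∫ y, (MemLp.toLp _ hk' : L2 d) y ^ 2 = ∫ y, k (x - y) ^ 2 :=
      integral_congr_ae (hk'.coeFn_toLp.mono fun y hy => congrArg (· ^ 2) hy)
    have e2 : ∫ y, (MemLp.toLp _ hk : L2 d) y ^ 2 = ∫ y, k y ^ 2 :=
      integral_congr_ae (hk.coeFn_toLp.mono fun y hy => congrArg (· ^ 2) hy)
    rw [e1, e2]
    exact integral_sub_left_eq_self (fun y => k y ^ 2) volume x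
  rw [h1, ← h2]
  exact abs_real_inner_le_norm _ _

/-- The convolution of an integrable kernel with a bounded function is continuous. -/
lemma continuous_conv_of_bounded {k f : Space d → ℝ} (hk : Integrable k)
    (hf : LocallyIntegrable f volume) {B : ℝ} (hB : ∀ᵐ x, |f x| ≤ B) : Continuous (conv k f) := by
  have hB0 : 0 ≤ B := by
    obtain ⟨x, hx⟩ := hB.exists
    exact (abs_nonneg _).trans hx
  -- the convolution is a uniform limit of convolutions with compactly supported kernels
  refine continuous_of_uniform_approx_of_continuous fun u hu => ?_
  obtain ⟨ε, hε, hεu⟩ := Metric.mem_uniformity_dist.1 hu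
  obtain ⟨k', hk'c, hk'le, hk'cont, hk'int⟩ :=
    hk.exists_hasCompactSupport_integral_sub_le (ε := ε / (2 * (B + 1))) (by positivity)
  refine ⟨conv k' f, hk'c.continuous_convolution_left _ hk'cont hf, fun x => hεu ?_⟩
  have hsub : conv k f x - conv k' f x = conv (fun y => k y - k' y) f x := by
    rw [conv_apply', conv_apply', conv_apply', ← integral_sub
      (integrable_conv_of_bounded hk hf.aestronglyMeasurable hB x)
      (integrable_conv_of_bounded hk'int hf.aestronglyMeasurable hB x)]
    simp only [sub_mul]
  rw [Real.dist_eq, hsub]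
  calc |conv (fun y => k y - k' y) f x| ≤ (∫ y, |k y - k' y|) * B :=
        abs_conv_le_of_bounded (hk.sub hk'int) hB x
    _ ≤ ε / (2 * (B + 1)) * B := mul_le_mul_of_nonneg_right hk'le hB0
    _ < ε := by
        rw [div_mul_eq_mul_div, div_lt_iff₀ (by positivity)]
        nlinarith

lemma conv_nonneg {k f : Space d → ℝ} (hk : ∀ x, 0 ≤ k x) (hf : ∀ᵐ x, 0 ≤ f x) (x : Space d) :
    0 ≤ conv k f x := by
  rw [conv_apply']
  exact integral_nonneg_of_ae (hf.mono fun y hy => mul_nonneg (hk _) hy)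

/-- Convolution with an almost everywhere positive kernel improves positivity. -/
lemma conv_pos {k f : Space d → ℝ} (hk : Integrable k) (hpos : ∀ᵐ x, 0 < k x)
    (hf : AEStronglyMeasurable f volume) {B : ℝ} (hB : ∀ᵐ x, |f x| ≤ B)
    (hf0 : ∀ᵐ x, 0 ≤ f x) (hne : ¬ f =ᵐ[volume] 0) (x : Space d) : 0 < conv k f x := by
  rw [conv_apply']
  have hpos' : ∀ᵐ y, 0 < k (x - y) :=
    (quasiMeasurePreserving_sub_left_of_right_invariant volume x).ae hpos
  have h0 : 0 ≤ᵐ[volume] fun y => k (x - y) * f y := by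
    filter_upwards [hpos', hf0] with y h1 h2 using mul_nonneg h1.le h2
  refine lt_of_le_of_ne (integral_nonneg_of_ae h0) fun h => hne ?_
  have := (integral_eq_zero_iff_of_nonneg_ae h0
    (integrable_conv_of_bounded hk hf hB x)).1 h.symm
  filter_upwards [this, hpos'] with y hy hy'
  exact (mul_eq_zero.1 hy).resolve_left hy'.ne'

/-- Monotonicity of convolution on `L²`. -/
lemma convL_mono {k : Space d → ℝ} (hk : Integrable k) (hk0 : ∀ x, 0 ≤ k x) {f g : L2 d}
    (h : f ≤ g) : convL k hk f ≤ convL k hk g := by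
  rw [← sub_nonneg, ← map_sub, ← Lp.coeFn_nonneg]
  have h2 : 0 ≤ᵐ[volume] (g - f : L2 d) := (Lp.coeFn_nonneg _).2 (sub_nonneg.2 h)
  filter_upwards [convL_coeFn k hk (g - f)] with x hx
  rw [hx]
  exact conv_nonneg hk0 h2 x

open scoped BoundedContinuousFunction in
/-- Multiplication by a bounded continuous function as an operator on `L²`. -/
def mulL (W : Space d →ᵇ ℝ) : L2 d →L[ℝ] L2 d :=
  L2.mkOp (fun f x => W x * f x)
    (fun f hf => by
      refine MemLp.of_le_mul (c := ‖W‖) hf (W.continuous.aestronglyMeasurable.mul hf.1)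
        (ae_of_all _ fun x => ?_)
      rw [norm_mul]
      exact mul_le_mul_of_nonneg_right (W.norm_coe_le_norm x) (norm_nonneg _))
    (fun f g h => h.mono fun x hx => by dsimp only; rw [hx])
    (fun f g _ _ => ae_of_all _ fun x => mul_add _ _ _)
    (fun c f _ => ae_of_all _ fun x => by simp; ring)
    ‖W‖ (norm_nonneg _)
    (fun f hf => by
      rw [← integral_const_mul]
      refine integral_mono_of_nonneg (ae_of_all _ fun x => sq_nonneg _)
        (hf.integrable_sq.const_mul _) (ae_of_all _ fun x => ?_)
      dsimp only
      rw [mul_pow, ← sq_abs (W x)]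
      gcongr
      exact W.norm_coe_le_norm x)


lemma mulL_coeFn (W : Space d →ᵇ ℝ) (f : L2 d) : mulL W f =ᵐ[volume] fun x => W x * f x :=
  L2.mkOp_coeFn ..

lemma norm_mulL_le (W : Space d →ᵇ ℝ) : ‖mulL W‖ ≤ ‖W‖ :=
  L2.norm_mkOp_le ..

lemma inner_mulL_comm (W : Space d →ᵇ ℝ) (f g : L2 d) : ⟪mulL W f, g⟫_ℝ = ⟪f, mulL W g⟫_ℝ := by
  rw [L2.inner_eq, L2.inner_eq]
  refine integral_congr_ae ?_
  filter_upwards [mulL_coeFn W f, mulL_coeFn W g] with x h1 h2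
  rw [h1, h2]; ring

lemma mulL_sub (W₁ W₂ : Space d →ᵇ ℝ) (f : L2 d) : mulL (W₁ - W₂) f = mulL W₁ f - mulL W₂ f := by
  refine Lp.ext ?_
  filter_upwards [mulL_coeFn W₁ f, mulL_coeFn W₂ f, mulL_coeFn (W₁ - W₂) f,
    Lp.coeFn_sub (mulL W₁ f) (mulL W₂ f)] with x h1 h2 h3 h4
  rw [h3, h4, Pi.sub_apply, h1, h2, BoundedContinuousFunction.sub_apply, sub_mul]

lemma mulL_const (c : ℝ) (f : L2 d) : mulL (BoundedContinuousFunction.const _ c) f = c • f := by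
  refine Lp.ext ?_
  filter_upwards [mulL_coeFn (BoundedContinuousFunction.const _ c) f,
    Lp.coeFn_smul c f] with x h1 h2
  rw [h1, h2]; rfl

lemma L2.inner_toLp {f : Space d → ℝ} (hf : MemLp f 2 volume) (g : L2 d) :
    ⟪hf.toLp, g⟫_ℝ = ∫ x, f x * g x := by
  rw [L2.inner_eq]
  refine integral_congr_ae ?_
  filter_upwards [hf.coeFn_toLp] with x hx
  rw [hx]

lemma L2.norm_toLp_sq {f : Space d → ℝ} (hf : MemLp f 2 volume) :
    ‖hf.toLp‖ ^ 2 = ∫ x, f x ^ 2 := by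
  rw [L2.norm_sq_eq]
  refine integral_congr_ae ?_
  filter_upwards [hf.coeFn_toLp] with x hx
  rw [hx]

/-- Dominated convergence in `L²`. -/
lemma L2.tendsto_toLp_of_dominated {F : ℕ → Space d → ℝ} {f b : Space d → ℝ}
    (hF : ∀ n, MemLp (F n) 2 volume) (hf : MemLp f 2 volume) (hb : MemLp b 2 volume)
    (hle : ∀ n, ∀ᵐ x, |F n x| ≤ b x) (hlim : ∀ᵐ x, Tendsto (fun n => F n x) atTop (𝓝 (f x))) :
    Tendsto (fun n => (hF n).toLp) atTop (𝓝 hf.toLp) := by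
  rw [tendsto_iff_norm_sub_tendsto_zero]
  have h : Tendsto (fun n => ‖(hF n).toLp - hf.toLp‖ ^ 2) atTop (𝓝 0) := by
    have e : ∀ n, ‖(hF n).toLp - hf.toLp‖ ^ 2 = ∫ x, (F n x - f x) ^ 2 := fun n => by
      rw [← MemLp.toLp_sub, L2.norm_toLp_sq]; rfl
    simp only [e]
    have hlef : ∀ᵐ x, |f x| ≤ b x := by
      filter_upwards [hlim, ae_all_iff.2 hle] with x hx hx'
      exact le_of_tendsto hx.abs (Eventually.of_forall hx')
    have := tendsto_integral_of_dominated_convergence (μ := volume)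
      (F := fun n x => (F n x - f x) ^ 2) (f := fun _ => (0 : ℝ)) (fun x => 4 * b x ^ 2)
      (fun n => ((hF n).1.sub hf.1).pow 2) (hb.integrable_sq.const_mul 4)
      (fun n => by
        filter_upwards [hle n, hlef] with x h1 h2
        rw [Real.norm_of_nonneg (sq_nonneg _)]
        have h3 : |F n x - f x| ≤ 2 * b x := (abs_sub _ _).trans (by linarith)
        have := pow_le_pow_left₀ (abs_nonneg _) h3 2
        rw [sq_abs] at this
        linarith)
      (by
        filter_upwards [hlim] with x hx
        simpa using (hx.sub_const (f x)).pow 2)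
    simpa using this
  have h2 := h.sqrt
  simpa [Real.sqrt_sq] using h2

/-! ### The Yukawa kernel -/

/-- The classical partial derivative `∂_i φ`. -/
def pd (i : Fin d) (φ : Space d → ℝ) : Space d → ℝ :=
  fun x => fderiv ℝ φ x (EuclideanSpace.single i 1)

lemma contDiff_pd {φ : Space d → ℝ} (h : ContDiff ℝ ∞ φ) (i : Fin d) : ContDiff ℝ ∞ (pd i φ) :=
  (h.fderiv_right (m := ∞) (by simp)).clm_apply contDiff_const

lemma hasCompactSupport_pd {φ : Space d → ℝ} (h : HasCompactSupport φ) (i : Fin d) :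
    HasCompactSupport (pd i φ) :=
  h.fderiv_apply ℝ _

lemma laplacian_eq_sum_pd {φ : Space d → ℝ} (h : ContDiff ℝ ∞ φ) (x : Space d) :
    Laplacian.laplacian φ x = ∑ i, pd i (pd i φ) x := by
  rw [InnerProductSpace.laplacian_eq_iteratedFDeriv_orthonormalBasis φ
    (EuclideanSpace.basisFun (Fin d) ℝ)]
  refine Finset.sum_congr rfl fun i _ => ?_
  rw [iteratedFDeriv_two_apply]
  have h1 : DifferentiableAt ℝ (fderiv ℝ φ) x :=
    (h.fderiv_right (m := ∞) (by simp)).differentiable (by simp) x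
  simp only [EuclideanSpace.basisFun_apply, Matrix.cons_val_zero, Matrix.cons_val_one]
  change _ = fderiv ℝ (fun y => fderiv ℝ φ y (EuclideanSpace.single i 1)) x _
  rw [fderiv_clm_apply h1 (differentiableAt_const _)]
  simp

lemma pd_comp_add (i : Fin d) (φ : Space d → ℝ) (x : Space d) :
    pd i (fun y => φ (x + y)) = fun y => pd i φ (x + y) := by
  funext y
  simp only [pd]
  rw [fderiv_comp_add_left]

lemma laplacian_comp_add {φ : Space d → ℝ} (h : ContDiff ℝ ∞ φ) (x y : Space d) :
    Laplacian.laplacian (fun y => φ (x + y)) y = Laplacian.laplacian φ (x + y) := by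
  have h' : ContDiff ℝ ∞ fun y => φ (x + y) := h.comp (contDiff_const.add contDiff_id)
  rw [laplacian_eq_sum_pd h, laplacian_eq_sum_pd h']
  simp only [pd_comp_add]

lemma hasCompactSupport_laplacian {φ : Space d → ℝ} (hφ : ContDiff ℝ ∞ φ)
    (h : HasCompactSupport φ) : HasCompactSupport (Laplacian.laplacian φ) := by
  refine HasCompactSupport.intro h fun x hx => ?_
  rw [laplacian_eq_sum_pd hφ]
  refine Finset.sum_eq_zero fun i _ => ?_
  have := fun f : Space d → ℝ => tsupport_fderiv_apply_subset (𝕜 := ℝ) (f := f) (EuclideanSpace.single i (1 : ℝ) : Space d)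
  exact image_eq_zero_of_notMem_tsupport fun h' => hx (this φ (this (pd i φ) h'))

lemma continuous_laplacian {φ : Space d → ℝ} (hφ : ContDiff ℝ ∞ φ) :
    Continuous (Laplacian.laplacian φ) := by
  have : Laplacian.laplacian φ = fun x => ∑ i, pd i (pd i φ) x :=
    funext fun x => laplacian_eq_sum_pd hφ x
  rw [this]
  exact continuous_finsetSum _ fun i _ => (contDiff_pd (contDiff_pd hφ i) i).continuous

/-- The heat kernel damped by `exp (-m t)`. -/
def dampedHeat (m t : ℝ) (x : Space d) : ℝ :=
  Real.exp (-m * t) * ((4 * Real.pi * t) ^ (-(d : ℝ) / 2) * Real.exp (-(1 / (4 * t)) * ‖x‖ ^ 2))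

/-- The fundamental solution `∫₀^∞ exp (-m t) p_t dt` of `-Δ + m`, where `p_t` is the heat kernel.
Where the integral diverges (for `d ≥ 2` this is the origin) the value is `0`. -/
def yukawa (m : ℝ) (x : Space d) : ℝ := ∫ t in Set.Ioi (0 : ℝ), dampedHeat m t x

lemma dampedHeat_pos {m t : ℝ} (ht : 0 < t) (x : Space d) : 0 < dampedHeat m t x := by
  unfold dampedHeat; positivity

lemma integrable_dampedHeat_right {m t : ℝ} (ht : 0 < t) :
    Integrable (fun x : Space d => dampedHeat m t x) := by
  unfold dampedHeat
  refine (Integrable.const_mul ?_ _).const_mul _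
  have h := (GaussianFourier.integrable_cexp_neg_mul_sq_norm_add (V := Space d)
    (b := ((1 / (4 * t) : ℝ) : ℂ)) (by rw [Complex.ofReal_re]; positivity) 0 0).norm
  simpa [Complex.norm_exp, ← Complex.ofReal_pow] using h

lemma integral_dampedHeat_right {m t : ℝ} (ht : 0 < t) :
    ∫ x : Space d, dampedHeat m t x = Real.exp (-m * t) := by
  unfold dampedHeat
  rw [integral_const_mul, integral_const_mul,
    GaussianFourier.integral_rexp_neg_mul_sq_norm (by positivity)]
  have : Real.pi / (1 / (4 * t)) = 4 * Real.pi * t := by field_simp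
  rw [this, finrank_euclideanSpace_fin, ← Real.rpow_add (by positivity)]
  simp [neg_div]

lemma measurable_dampedHeat (m : ℝ) :
    Measurable (fun p : ℝ × Space d => dampedHeat m p.1 p.2) := by
  unfold dampedHeat
  fun_prop

lemma integrable_dampedHeat {m : ℝ} (hm : 0 < m) :
    Integrable (fun p : ℝ × Space d => dampedHeat m p.1 p.2)
      ((volume.restrict (Set.Ioi (0 : ℝ))).prod volume) := by
  rw [integrable_prod_iff (measurable_dampedHeat m).aestronglyMeasurable]
  refine ⟨(ae_restrict_mem measurableSet_Ioi).mono fun t ht =>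
    integrable_dampedHeat_right ht, ?_⟩
  refine (exp_neg_integrableOn_Ioi 0 hm).congr ?_
  refine (ae_restrict_mem measurableSet_Ioi).mono fun t ht => ?_
  dsimp only
  rw [← integral_dampedHeat_right (d := d) ht]
  exact integral_congr_ae (ae_of_all _ fun x => (Real.norm_of_nonneg (dampedHeat_pos ht x).le).symm)

lemma integrable_yukawa {m : ℝ} (hm : 0 < m) : Integrable (yukawa m : Space d → ℝ) :=
  (integrable_dampedHeat hm).integral_prod_right

lemma yukawa_nonneg (m : ℝ) (x : Space d) : 0 ≤ yukawa m x :=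
  setIntegral_nonneg measurableSet_Ioi fun _ ht => (dampedHeat_pos ht x).le

lemma ae_yukawa_pos {m : ℝ} (hm : 0 < m) : ∀ᵐ x : Space d, 0 < yukawa m x := by
  filter_upwards [(integrable_dampedHeat (d := d) hm).prod_left_ae] with x hx
  rw [yukawa, setIntegral_pos_iff_support_of_nonneg_ae
    ((ae_restrict_mem measurableSet_Ioi).mono fun t ht => (dampedHeat_pos ht x).le) hx]
  refine lt_of_lt_of_le (b := volume (Set.Ioi (0 : ℝ))) (by simp) (measure_mono fun t ht =>
    ⟨(dampedHeat_pos ht x).ne', ht⟩)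

lemma yukawa_neg (m : ℝ) (x : Space d) : yukawa m (-x) = yukawa m x := by
  simp [yukawa, dampedHeat]

lemma integral_exp_neg_mul {a : ℝ} (ha : 0 < a) : ∫ t in Set.Ioi (0 : ℝ), Real.exp (-a * t) = 1 / a := by
  have := integral_exp_mul_Ioi (a := -a) (by linarith) 0
  simpa using this

lemma integral_yukawa {m : ℝ} (hm : 0 < m) : ∫ x : Space d, yukawa m x = 1 / m := by
  unfold yukawa
  rw [← integral_integral_swap (integrable_dampedHeat hm),
    setIntegral_congr_fun measurableSet_Ioi (fun t ht => integral_dampedHeat_right ht)]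
  exact integral_exp_neg_mul hm

lemma integral_abs_yukawa {m : ℝ} (hm : 0 < m) : ∫ x : Space d, |yukawa m x| = 1 / m := by
  rw [← integral_yukawa (d := d) hm]
  exact integral_congr_ae (ae_of_all _ fun x => abs_of_nonneg (yukawa_nonneg m x))

open FourierTransform in
lemma integral_dampedHeat_mul {m t : ℝ} (ht : 0 < t) (ψ : SchwartzMap (Space d) ℂ) :
    ∫ x, (dampedHeat m t x : ℂ) * ψ x =
      ∫ ξ, (Real.exp (-(m + 4 * Real.pi ^ 2 * ‖ξ‖ ^ 2) * t) : ℂ) * 𝓕 (ψ : Space d → ℂ) ξ := by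
  have hb : 0 < (((4 * Real.pi ^ 2 * t : ℝ)) : ℂ).re := by
    rw [Complex.ofReal_re]; positivity
  set g : Space d → ℂ := fun v => Complex.exp (-((4 * Real.pi ^ 2 * t : ℝ) : ℂ) * ‖v‖ ^ 2) with hg
  have hgi : Integrable g := by
    have := GaussianFourier.integrable_cexp_neg_mul_sq_norm_add (V := Space d) hb 0 0
    simpa [hg] using this
  have hF : ∀ w, (dampedHeat m t w : ℂ) = Real.exp (-m * t) * 𝓕 g w := by
    intro w
    rw [hg, fourier_gaussian_innerProductSpace hb, dampedHeat]
    have e1 : (Real.pi : ℂ) / ((4 * Real.pi ^ 2 * t : ℝ) : ℂ) = (((4 * Real.pi * t)⁻¹ : ℝ) : ℂ) := by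
      push_cast
      have : (Real.pi : ℂ) ≠ 0 := by exact_mod_cast Real.pi_ne_zero
      have : (t : ℂ) ≠ 0 := by exact_mod_cast ht.ne'
      field_simp
    have e2 : ((Module.finrank ℝ (Space d) : ℂ) / 2) = (((d : ℝ) / 2 : ℝ) : ℂ) := by
      rw [finrank_euclideanSpace_fin]; push_cast; rfl
    have e3 : -(Real.pi : ℂ) ^ 2 * (‖w‖ : ℂ) ^ 2 / ((4 * Real.pi ^ 2 * t : ℝ) : ℂ) =
        ((-(1 / (4 * t)) * ‖w‖ ^ 2 : ℝ) : ℂ) := by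
      push_cast
      have : (Real.pi : ℂ) ≠ 0 := by exact_mod_cast Real.pi_ne_zero
      have : (t : ℂ) ≠ 0 := by exact_mod_cast ht.ne'
      field_simp
    rw [e1, e2, e3, ← Complex.ofReal_cpow (by positivity), ← Complex.ofReal_exp]
    rw [Real.inv_rpow (by positivity), ← Real.rpow_neg (by positivity), neg_div]
    push_cast
    ring
  have hflip := VectorFourier.integral_fourierIntegral_smul_eq_flip (L := innerₗ (Space d))
    (μ := volume) (ν := volume) (e := Real.fourierChar)
    Real.continuous_fourierChar continuous_inner hgi ψ.integrable
  simp only [hF, mul_assoc, integral_const_mul]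
  have h2 : ∫ x, 𝓕 g x * ψ x = ∫ x, g x * 𝓕 (ψ : Space d → ℂ) x := by
    simpa [flip_innerₗ] using! hflip
  rw [h2, ← integral_const_mul]
  refine integral_congr_ae (ae_of_all _ fun ξ => ?_)
  dsimp only
  rw [hg, ← mul_assoc]
  congr 1
  rw [Complex.ofReal_exp, Complex.ofReal_exp, ← Complex.exp_add]
  congr 1
  push_cast
  ring

open FourierTransform in
lemma fourier_sub_laplacian (m : ℝ) (Φ : SchwartzMap (Space d) ℂ) (ξ : Space d) :
    𝓕 (((m : ℂ) • Φ - Laplacian.laplacian Φ : SchwartzMap (Space d) ℂ) : Space d → ℂ) ξ =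
      ((m + 4 * Real.pi ^ 2 * ‖ξ‖ ^ 2 : ℝ) : ℂ) * 𝓕 (Φ : Space d → ℂ) ξ := by
  have hg : (fun x : Space d => ‖x‖ ^ 2).HasTemperateGrowth := by fun_prop
  have h1 : 𝓕 ((m : ℂ) • Φ - Laplacian.laplacian Φ) =
      (m : ℂ) • 𝓕 Φ + (2 * Real.pi) ^ 2 • SchwartzMap.smulLeftCLM ℂ (fun x : Space d => ‖x‖ ^ 2) (𝓕 Φ) := by
    rw [SchwartzMap.laplacian_eq_fourierMultiplierCLM, SchwartzMap.fourierMultiplierCLM_apply,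
      neg_smul, sub_neg_eq_add, FourierTransform.fourier_add, FourierTransform.fourier_smul,
      FourierTransform.fourier_smul, FourierTransform.fourier_fourierInv_eq]
  have h2 := congrArg (fun S : SchwartzMap (Space d) ℂ => S ξ) h1
  rw [← SchwartzMap.fourier_coe, ← SchwartzMap.fourier_coe]
  refine h2.trans ?_
  simp only [_root_.add_apply, _root_.smul_apply, SchwartzMap.smulLeftCLM_apply_apply hg]
  simp only [smul_eq_mul, Complex.real_smul]
  push_cast
  ring

open FourierTransform in
/-- `G (m φ - Δ φ) = φ(0)` for the fundamental solution `G` of `-Δ + m`. -/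
lemma integral_yukawa_mul_schwartz {m : ℝ} (hm : 0 < m) (Φ : SchwartzMap (Space d) ℂ) :
    ∫ x, (yukawa m x : ℂ) * ((m : ℂ) • Φ - Laplacian.laplacian Φ : SchwartzMap (Space d) ℂ) x =
      Φ 0 := by
  set ψ : SchwartzMap (Space d) ℂ := (m : ℂ) • Φ - Laplacian.laplacian Φ with hψ
  obtain ⟨C, hC⟩ : ∃ C, ∀ x, ‖ψ x‖ ≤ C := by
    obtain ⟨C, hC⟩ := ψ.decay 0 0
    exact ⟨C, fun x => by simpa using hC.2 x⟩
  have hI1 : Integrable (fun p : ℝ × Space d => (dampedHeat m p.1 p.2 : ℂ) * ψ p.2)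
      ((volume.restrict (Set.Ioi (0 : ℝ))).prod volume) := by
    refine Integrable.mul_bdd (c := C) (integrable_dampedHeat hm).ofReal
      (ψ.continuous.comp continuous_snd).aestronglyMeasurable (ae_of_all _ fun p => hC _)
  have hFint : Integrable (𝓕 (ψ : Space d → ℂ)) := by
    rw [← SchwartzMap.fourier_coe]; exact (𝓕 ψ).integrable
  have hI2 : Integrable (fun p : ℝ × Space d =>
      (Real.exp (-(m + 4 * Real.pi ^ 2 * ‖p.2‖ ^ 2) * p.1) : ℂ) * 𝓕 (ψ : Space d → ℂ) p.2)
      ((volume.restrict (Set.Ioi (0 : ℝ))).prod volume) := by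
    have h := Integrable.mul_prod (μ := volume.restrict (Set.Ioi (0 : ℝ)))
      (exp_neg_integrableOn_Ioi 0 hm) hFint.norm
    refine h.mono' ?_ ?_
    · refine AEStronglyMeasurable.mul ?_ hFint.1.comp_snd
      exact (Complex.continuous_ofReal.comp (by fun_prop)).aestronglyMeasurable
    · have hae : ∀ᵐ p : ℝ × Space d ∂((volume.restrict (Set.Ioi (0 : ℝ))).prod volume),
          p.1 ∈ Set.Ioi (0 : ℝ) :=
        Measure.quasiMeasurePreserving_fst.ae (ae_restrict_mem measurableSet_Ioi)
      filter_upwards [hae] with p hp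
      rw [norm_mul, Complex.norm_real, Real.norm_of_nonneg (Real.exp_pos _).le]
      refine mul_le_mul_of_nonneg_right (Real.exp_le_exp.2 ?_) (norm_nonneg _)
      have : 0 ≤ 4 * Real.pi ^ 2 * ‖p.2‖ ^ 2 * p.1 := by
        have : (0 : ℝ) < p.1 := hp
        positivity
      nlinarith
  calc ∫ x, (yukawa m x : ℂ) * ψ x
      = ∫ x, ∫ t in Set.Ioi (0 : ℝ), (dampedHeat m t x : ℂ) * ψ x := by
        refine integral_congr_ae (ae_of_all _ fun x => ?_)
        dsimp only
        rw [integral_mul_const, yukawa, integral_complex_ofReal]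
    _ = ∫ t in Set.Ioi (0 : ℝ), ∫ x, (dampedHeat m t x : ℂ) * ψ x :=
        (integral_integral_swap hI1).symm
    _ = ∫ t in Set.Ioi (0 : ℝ), ∫ ξ, (Real.exp (-(m + 4 * Real.pi ^ 2 * ‖ξ‖ ^ 2) * t) : ℂ) *
          𝓕 (ψ : Space d → ℂ) ξ :=
        setIntegral_congr_fun measurableSet_Ioi fun t ht => integral_dampedHeat_mul ht ψ
    _ = ∫ ξ, ∫ t in Set.Ioi (0 : ℝ), (Real.exp (-(m + 4 * Real.pi ^ 2 * ‖ξ‖ ^ 2) * t) : ℂ) *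
          𝓕 (ψ : Space d → ℂ) ξ := integral_integral_swap hI2
    _ = ∫ ξ, 𝓕 (Φ : Space d → ℂ) ξ := by
        refine integral_congr_ae (ae_of_all _ fun ξ => ?_)
        have hpos : 0 < m + 4 * Real.pi ^ 2 * ‖ξ‖ ^ 2 := by positivity
        dsimp only
        rw [integral_mul_const, integral_complex_ofReal, integral_exp_neg_mul hpos, hψ,
          fourier_sub_laplacian, ← mul_assoc, ← Complex.ofReal_mul, one_div_mul_cancel hpos.ne',
          Complex.ofReal_one, one_mul]
    _ = Φ 0 := by
        have h := congrFun (Φ.continuous.fourierInv_fourier_eq Φ.integrable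
          (𝓕 Φ : SchwartzMap (Space d) ℂ).integrable) 0
        rw [Real.fourierInv_eq] at h
        simpa using h

/-- `G ⋆ (m φ - Δ φ) = φ` for the fundamental solution `G` of `-Δ + m` and test functions `φ`. -/
lemma conv_yukawa_sub_laplacian {m : ℝ} (hm : 0 < m) {φ : Space d → ℝ} (hφ : ContDiff ℝ ∞ φ)
    (hc : HasCompactSupport φ) (x : Space d) :
    conv (yukawa m) (fun y => m * φ y - Laplacian.laplacian φ y) x = φ x := by
  have hφ' : ContDiff ℝ ∞ fun y => φ (x + y) := hφ.comp (contDiff_const.add contDiff_id)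
  have hc' : HasCompactSupport fun y => φ (x + y) :=
    hc.comp_homeomorph (Homeomorph.addLeft x)
  have hφ'' : ContDiff ℝ ∞ fun y => (φ (x + y) : ℂ) := Complex.ofRealCLM.contDiff.comp hφ'
  have hc'' : HasCompactSupport fun y => (φ (x + y) : ℂ) := hc'.comp_left Complex.ofReal_zero
  set Φ : SchwartzMap (Space d) ℂ := hc''.toSchwartzMap hφ'' with hΦ
  have hΦx : ∀ y, Φ y = φ (x + y) := fun y => by simp [hΦ]
  have hΔ : ∀ y, (Laplacian.laplacian Φ : SchwartzMap (Space d) ℂ) y =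
      (Laplacian.laplacian φ (x + y) : ℝ) := by
    intro y
    rw [SchwartzMap.laplacian_apply]
    have : (Φ : Space d → ℂ) = Complex.ofRealCLM ∘ fun y => φ (x + y) := funext hΦx
    rw [this, ContDiffAt.laplacian_CLM_comp_left (hφ'.contDiffAt.of_le (by norm_cast)),
      ← laplacian_comp_add hφ]
    rfl
  have key := integral_yukawa_mul_schwartz hm Φ
  simp only [_root_.sub_apply, _root_.smul_apply, hΔ, hΦx, smul_eq_mul] at key
  norm_cast at key
  rw [conv_apply, ← integral_neg_eq_self]
  simpa [yukawa_neg] using key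

/-! ### The Sobolev space `H¹` and the resolvent of the Laplacian -/

lemma memLp_test {φ : Space d → ℝ} (h : ContDiff ℝ ∞ φ) (hc : HasCompactSupport φ) :
    MemLp φ 2 volume :=
  h.continuous.memLp_of_hasCompactSupport hc

lemma memLp_pd_test {φ : Space d → ℝ} (h : ContDiff ℝ ∞ φ) (hc : HasCompactSupport φ)
    (i : Fin d) : MemLp (pd i φ) 2 volume :=
  memLp_test (contDiff_pd h i) (hasCompactSupport_pd hc i)

lemma integrable_mul_test {φ u : Space d → ℝ} (h : ContDiff ℝ ∞ φ) (hc : HasCompactSupport φ)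
    (hu : MemLp u 2 volume) : Integrable (fun x => φ x * u x) :=
  (memLp_test h hc).integrable_mul hu

lemma locallyIntegrable_of_memLp {F : Type*} [NormedAddCommGroup F] {u : Space d → F}
    (hu : MemLp u 2 volume) : LocallyIntegrable u volume :=
  hu.locallyIntegrable (by norm_num)

/-- The pairs `(u, ∇u)` with `u ∈ H¹`, as a subspace of `L² × (L²)^d`. -/
def sobolevGraph (d : ℕ) : Submodule ℝ (L2 d × (Fin d → L2 d)) where
  carrier := {p | ∀ i : Fin d, ∀ φ : Space d → ℝ, ContDiff ℝ ∞ φ → HasCompactSupport φ →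
    ∫ x, pd i φ x * p.1 x = - ∫ x, φ x * p.2 i x}
  add_mem' := by
    intro p q hp hq i φ hφ hc
    have h := congrArg₂ (· + ·) (hp i φ hφ hc) (hq i φ hφ hc)
    simp only [← L2.inner_toLp (memLp_test hφ hc),
      ← L2.inner_toLp (memLp_pd_test hφ hc i)] at h ⊢
    rw [Prod.fst_add, Prod.snd_add, Pi.add_apply, inner_add_right, inner_add_right, h]
    ring
  zero_mem' := by
    intro i φ hφ hc
    simp only [← L2.inner_toLp (memLp_test hφ hc), ← L2.inner_toLp (memLp_pd_test hφ hc i)]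
    simp
  smul_mem' := by
    intro c p hp i φ hφ hc
    have h := congrArg (c * ·) (hp i φ hφ hc)
    simp only [← L2.inner_toLp (memLp_test hφ hc),
      ← L2.inner_toLp (memLp_pd_test hφ hc i)] at h ⊢
    rw [Prod.smul_fst, Prod.smul_snd, Pi.smul_apply, inner_smul_right, inner_smul_right, h]
    ring

lemma mem_sobolevGraph_iff {p : L2 d × (Fin d → L2 d)} :
    p ∈ sobolevGraph d ↔ ∀ i, HasWeakPartial i (p.1 : Space d → ℝ) (p.2 i) :=
  ⟨fun h i => ⟨locallyIntegrable_of_memLp (Lp.memLp _), locallyIntegrable_of_memLp (Lp.memLp _),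
    fun φ hφ hc => h i φ hφ hc⟩, fun h i φ hφ hc => (h i).2.2 φ hφ hc⟩

lemma isClosed_sobolevGraph : IsClosed (sobolevGraph d : Set (L2 d × (Fin d → L2 d))) := by
  have : (sobolevGraph d : Set (L2 d × (Fin d → L2 d))) = ⋂ (i : Fin d) (φ : Space d → ℝ)
      (hφ : ContDiff ℝ ∞ φ) (hc : HasCompactSupport φ),
      {p | ⟪(memLp_pd_test hφ hc i).toLp, p.1⟫_ℝ = - ⟪(memLp_test hφ hc).toLp, p.2 i⟫_ℝ} := by
    ext p
    simp only [Set.mem_iInter, Set.mem_ofPred_eq, L2.inner_toLp]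
    rfl
  rw [this]
  refine isClosed_iInter fun i => isClosed_iInter fun φ => isClosed_iInter fun hφ =>
    isClosed_iInter fun hc => isClosed_eq (by fun_prop) ?_
  exact (continuous_const.inner ((continuous_apply i).comp continuous_snd)).neg

lemma exists_cutoff (d : ℕ) : ∃ χ : ℕ → Space d → ℝ, (∀ n, ContDiff ℝ ∞ (χ n)) ∧
    (∀ n, HasCompactSupport (χ n)) ∧ (∀ n x, |χ n x| ≤ 1) ∧
    (∀ x, Tendsto (fun n => χ n x) atTop (𝓝 1)) ∧
    ∃ C : ℝ, 0 ≤ C ∧ ∀ n i x, |pd i (χ n) x| ≤ C * ((n : ℝ) + 1)⁻¹ := by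
  let b : ContDiffBump (0 : Space d) := ⟨1, 2, by norm_num, by norm_num⟩
  have hpos : ∀ n : ℕ, (0 : ℝ) < ((n : ℝ) + 1)⁻¹ := fun n => by positivity
  have hb : ContDiff ℝ ∞ b := b.contDiff
  refine ⟨fun n x => b (((n : ℝ) + 1)⁻¹ • x), fun n => b.contDiff.comp (contDiff_const_smul _),
    fun n => b.hasCompactSupport.comp_homeomorph (Homeomorph.smulOfNeZero _ (hpos n).ne'),
    fun n x => ?_, fun x => ?_, ?_⟩
  · rw [abs_of_nonneg b.nonneg]; exact b.le_one
  · have h1 : Tendsto (fun n : ℕ => ((n : ℝ) + 1)⁻¹ • x) atTop (𝓝 0) := by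
      have := (tendsto_one_div_add_atTop_nhds_zero_nat (𝕜 := ℝ)).smul_const x
      simpa using this
    refine tendsto_const_nhds.congr' ?_
    filter_upwards [h1.eventually (b.eventuallyEq_one)] with n hn
    exact hn.symm
  · obtain ⟨C, hC⟩ := (b.contDiff.continuous_fderiv (n := 1) (by simp) : Continuous (fderiv ℝ b)).norm
      |>.bddAbove_range_of_hasCompactSupport (b.hasCompactSupport.fderiv ℝ).norm
    have hC' : ∀ x, ‖fderiv ℝ b x‖ ≤ C := fun x => hC ⟨x, rfl⟩
    refine ⟨C, (norm_nonneg _).trans (hC' 0), fun n i x => ?_⟩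
    have : pd i (fun x => b (((n : ℝ) + 1)⁻¹ • x)) x = ((n : ℝ) + 1)⁻¹ *
        fderiv ℝ b (((n : ℝ) + 1)⁻¹ • x) (EuclideanSpace.single i 1) := by
      simp only [pd]
      rw [fderiv_comp_smul]; rfl
    rw [this, abs_mul, abs_of_pos (hpos n), mul_comm]
    refine mul_le_mul_of_nonneg_right ?_ (hpos n).le
    refine ((fderiv ℝ b _).le_opNorm _).trans ?_
    simpa using hC' _

lemma pd_mul {φ w : Space d → ℝ} (hφ : ContDiff ℝ ∞ φ) (hw : ContDiff ℝ ∞ w) (i : Fin d)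
    (x : Space d) : pd i (fun x => φ x * w x) x = pd i φ x * w x + φ x * pd i w x := by
  simp only [pd]
  rw [fderiv_fun_mul (hφ.differentiable (by simp) x) (hw.differentiable (by simp) x)]
  simp; ring

/-- Test functions are dense, in the `H¹` norm, in the smooth functions of class `H¹`. -/
lemma exists_test_tendsto {w : Space d → ℝ} (hw : ContDiff ℝ ∞ w) (hw2 : MemLp w 2 volume)
    (hwi : ∀ i, MemLp (pd i w) 2 volume) :
    ∃ φ : ℕ → Space d → ℝ, ∃ (hφ : ∀ n, ContDiff ℝ ∞ (φ n)) (hc : ∀ n, HasCompactSupport (φ n)),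
      Tendsto (fun n => (memLp_test (hφ n) (hc n)).toLp) atTop (𝓝 hw2.toLp) ∧
      ∀ i, Tendsto (fun n => (memLp_pd_test (hφ n) (hc n) i).toLp) atTop (𝓝 (hwi i).toLp) := by
  obtain ⟨χ, hχ, hχc, hχ1, hχt, C, hC0, hC⟩ := exists_cutoff d
  refine ⟨fun n x => χ n x * w x, fun n => (hχ n).mul hw, fun n => (hχc n).mul_right, ?_, fun i => ?_⟩
  · refine L2.tendsto_toLp_of_dominated _ _ hw2.norm (fun n => ae_of_all _ fun x => ?_)
      (ae_of_all _ fun x => ?_)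
    · rw [abs_mul, Real.norm_eq_abs]
      exact mul_le_of_le_one_left (abs_nonneg _) (hχ1 n x)
    · simpa using (hχt x).mul_const (w x)
  · refine L2.tendsto_toLp_of_dominated _ _ ((hw2.norm.const_mul C).add (hwi i).norm)
      (fun n => ae_of_all _ fun x => ?_) (ae_of_all _ fun x => ?_)
    · rw [pd_mul (hχ n) hw]
      refine (abs_add_le _ _).trans ?_
      rw [abs_mul, abs_mul]
      refine add_le_add (mul_le_mul_of_nonneg_right ((hC n i x).trans ?_) (abs_nonneg _))
        (mul_le_of_le_one_left (abs_nonneg _) (hχ1 n x))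
      refine mul_le_of_le_one_right hC0 (inv_le_one_of_one_le₀ ?_)
      have : (0 : ℝ) ≤ n := n.cast_nonneg
      linarith
    · simp only [pd_mul (hχ _) hw]
      have h0 : Tendsto (fun n => pd i (χ n) x) atTop (𝓝 0) := by
        refine squeeze_zero_norm (fun n => hC n i x) ?_
        have := (tendsto_one_div_add_atTop_nhds_zero_nat (𝕜 := ℝ)).const_mul C
        simpa using this
      simpa using (h0.mul_const (w x)).add ((hχt x).mul_const (pd i w x))

/-- The defining identity of weak derivatives holds for all smooth functions of class `H¹`. -/
lemma inner_pd_eq_neg {w : Space d → ℝ} (hw : ContDiff ℝ ∞ w) (hw2 : MemLp w 2 volume)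
    (hwi : ∀ i, MemLp (pd i w) 2 volume) {p : L2 d × (Fin d → L2 d)} (hp : p ∈ sobolevGraph d)
    (i : Fin d) : ⟪(hwi i).toLp, p.1⟫_ℝ = - ⟪hw2.toLp, p.2 i⟫_ℝ := by
  obtain ⟨φ, hφ, hc, h1, h2⟩ := exists_test_tendsto hw hw2 hwi
  refine tendsto_nhds_unique ((h2 i).inner tendsto_const_nhds)
    (((h1.inner tendsto_const_nhds).neg).congr fun n => ?_)
  rw [L2.inner_toLp, L2.inner_toLp]
  exact (hp i (φ n) (hφ n) (hc n)).symm

/-- The resolvent `(-Δ + m)⁻¹` on `L²`. -/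
def yukL (m : ℝ) (hm : 0 < m) : L2 d →L[ℝ] L2 d := convL (yukawa m) (integrable_yukawa hm)

lemma inner_yukL_comm {m : ℝ} (hm : 0 < m) (f g : L2 d) :
    ⟪yukL m hm f, g⟫_ℝ = ⟪f, yukL m hm g⟫_ℝ :=
  inner_convL_comm _ _ (yukawa_neg m) f g

lemma norm_yukL_le {m : ℝ} (hm : 0 < m) : ‖(yukL m hm : L2 d →L[ℝ] L2 d)‖ ≤ 1 / m :=
  (norm_convL_le _ _).trans_eq (integral_abs_yukawa hm)

section Test

variable {m : ℝ} {η : Space d → ℝ}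

lemma contDiff_conv_yukawa (hm : 0 < m) (hη : ContDiff ℝ ∞ η) (hc : HasCompactSupport η) :
    ContDiff ℝ ∞ (conv (yukawa m) η) :=
  hc.contDiff_convolution_right (n := (⊤ : ℕ∞)) _ (integrable_yukawa hm).locallyIntegrable hη

lemma pd_conv_yukawa (hm : 0 < m) (hη : ContDiff ℝ ∞ η) (hc : HasCompactSupport η) (i : Fin d) :
    pd i (conv (yukawa m) η) = conv (yukawa m) (pd i η) := by
  funext x
  have hη1 : ContDiff ℝ 1 η := hη.of_le (by norm_cast)
  have h := hc.hasFDerivAt_convolution_right (ContinuousLinearMap.lsmul ℝ ℝ)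
    (integrable_yukawa (d := d) hm).locallyIntegrable hη1 x
  unfold pd
  rw [conv, h.fderiv, convolution_precompR_apply _
    (integrable_yukawa (d := d) hm).locallyIntegrable (hc.fderiv ℝ)
    (hη1.continuous_fderiv one_ne_zero)]
  rfl

lemma sub_laplacian_conv_yukawa (hm : 0 < m) (hη : ContDiff ℝ ∞ η) (hc : HasCompactSupport η)
    (x : Space d) : m * conv (yukawa m) η x - ∑ i, conv (yukawa m) (pd i (pd i η)) x = η x := by
  rw [← conv_yukawa_sub_laplacian hm hη hc x]
  have hI : ∀ φ : Space d → ℝ, ContDiff ℝ ∞ φ → HasCompactSupport φ →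
      Integrable (fun y => yukawa m y * φ (x - y)) := fun φ hφ hφc =>
    hφc.convolutionExists_right (ContinuousLinearMap.lsmul ℝ ℝ)
      (integrable_yukawa (d := d) hm).locallyIntegrable hφ.continuous x
  have hI2 : ∀ i, Integrable (fun y => yukawa m y * pd i (pd i η) (x - y)) := fun i =>
    hI _ (contDiff_pd (contDiff_pd hη i) i) (hasCompactSupport_pd (hasCompactSupport_pd hc i) i)
  simp only [conv_apply, laplacian_eq_sum_pd hη]
  rw [← integral_const_mul, ← integral_finsetSum _ fun i _ => hI2 i, ← integral_sub
    ((hI η hη hc).const_mul m) (integrable_finsetSum _ fun i _ => hI2 i)]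
  refine integral_congr_ae (ae_of_all _ fun y => ?_)
  dsimp only
  rw [mul_sub, Finset.mul_sum]
  ring

lemma memLp_conv_test (hm : 0 < m) (hη : ContDiff ℝ ∞ η) (hc : HasCompactSupport η) :
    MemLp (conv (yukawa m) η) 2 volume :=
  memLp_conv (integrable_yukawa hm) (memLp_test hη hc)

lemma memLp_pd_conv_test (hm : 0 < m) (hη : ContDiff ℝ ∞ η) (hc : HasCompactSupport η)
    (i : Fin d) : MemLp (pd i (conv (yukawa m) η)) 2 volume := by
  rw [pd_conv_yukawa hm hη hc]
  exact memLp_conv_test hm (contDiff_pd hη i) (hasCompactSupport_pd hc i)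

lemma yukL_test (hm : 0 < m) (hη : ContDiff ℝ ∞ η) (hc : HasCompactSupport η) :
    yukL m hm (memLp_test hη hc).toLp = (memLp_conv_test hm hη hc).toLp :=
  convL_toLp _ _ _

/-- The form identity for the resolvent applied to a test function. -/
lemma form_conv_test (hm : 0 < m) (hη : ContDiff ℝ ∞ η) (hc : HasCompactSupport η)
    {p : L2 d × (Fin d → L2 d)} (hp : p ∈ sobolevGraph d) :
    ∑ i, ⟪(memLp_pd_conv_test hm hη hc i).toLp, p.2 i⟫_ℝ +
      m * ⟪(memLp_conv_test hm hη hc).toLp, p.1⟫_ℝ = ⟪(memLp_test hη hc).toLp, p.1⟫_ℝ := by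
  have h2 : ∀ i j, MemLp (pd j (pd i (conv (yukawa m) η))) 2 volume := fun i j => by
    rw [pd_conv_yukawa hm hη hc]
    exact memLp_pd_conv_test hm (contDiff_pd hη i) (hasCompactSupport_pd hc i) j
  have h3 : ∀ i, ⟪(memLp_pd_conv_test hm hη hc i).toLp, p.2 i⟫_ℝ = - ⟪(h2 i i).toLp, p.1⟫_ℝ :=
    fun i => by
      rw [inner_pd_eq_neg (contDiff_pd (contDiff_conv_yukawa hm hη hc) i)
        (memLp_pd_conv_test hm hη hc i) (h2 i) hp i, neg_neg]
  simp only [h3, L2.inner_toLp]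
  have hI : ∀ i ∈ Finset.univ, Integrable
      (fun x => pd i (pd i (conv (yukawa m) η)) x * p.1 x) := fun i _ =>
    (h2 i i).integrable_mul (Lp.memLp _)
  have hI' : Integrable (fun x => m * (conv (yukawa m) η x * p.1 x)) :=
    ((memLp_conv_test hm hη hc).integrable_mul (Lp.memLp p.1)).const_mul m
  rw [Finset.sum_neg_distrib, ← integral_finsetSum _ hI, ← integral_const_mul, neg_add_eq_sub, ← integral_sub
    hI' (integrable_finsetSum _ hI)]
  refine integral_congr_ae (ae_of_all _ fun x => ?_)
  have := sub_laplacian_conv_yukawa hm hη hc x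
  simp only [pd_conv_yukawa hm hη hc,
    pd_conv_yukawa hm (contDiff_pd hη _) (hasCompactSupport_pd hc _)]
  rw [← Finset.sum_mul, ← mul_assoc, ← sub_mul, this]

end Test

lemma dense_test (d : ℕ) : Dense {f : L2 d | ∃ (η : Space d → ℝ) (hη : ContDiff ℝ ∞ η)
    (hc : HasCompactSupport η), f = (memLp_test hη hc).toLp} := by
  refine (Lp.dense_hasCompactSupport_contDiff (E := Space d) (F := ℝ) (μ := volume)
    (p := 2) (by norm_num)).mono ?_
  rintro f ⟨η, hfη, hc, hη⟩
  exact ⟨η, hη, hc, Lp.ext (hfη.trans (MemLp.coeFn_toLp _).symm)⟩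

lemma conv_test_mem_sobolevGraph {m : ℝ} {η : Space d → ℝ} (hm : 0 < m) (hη : ContDiff ℝ ∞ η)
    (hc : HasCompactSupport η) : ((memLp_conv_test hm hη hc).toLp,
      fun i => (memLp_pd_conv_test hm hη hc i).toLp) ∈ sobolevGraph d := by
  intro i φ hφ hφc
  have e1 : ∫ x, pd i φ x * (MemLp.toLp _ (memLp_conv_test hm hη hc) : L2 d) x =
      ∫ x, pd i φ x * conv (yukawa m) η x :=
    integral_congr_ae ((memLp_conv_test hm hη hc).coeFn_toLp.mono fun x hx => by
      dsimp only; rw [hx])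
  have e2 : ∫ x, φ x * (MemLp.toLp _ (memLp_pd_conv_test hm hη hc i) : L2 d) x =
      ∫ x, φ x * pd i (conv (yukawa m) η) x :=
    integral_congr_ae ((memLp_pd_conv_test hm hη hc i).coeFn_toLp.mono fun x hx => by
      dsimp only; rw [hx])
  dsimp only
  rw [e1, e2, eq_comm, neg_eq_iff_eq_neg]
  have hw := contDiff_conv_yukawa hm hη hc
  exact integral_mul_fderiv_eq_neg_fderiv_mul_of_integrable
    (integrable_mul_test (contDiff_pd hφ i) (hasCompactSupport_pd hφc i) (memLp_conv_test hm hη hc))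
    (integrable_mul_test hφ hφc (memLp_pd_conv_test hm hη hc i))
    (integrable_mul_test hφ hφc (memLp_conv_test hm hη hc))
    (fun x _ => hφ.differentiable (by simp) x) (fun x _ => hw.differentiable (by simp) x)

/-- `(-Δ + m)⁻¹` maps `L²` into `H¹`, and `(-Δ + m)⁻¹ f` solves its equation in the weak sense,
tested against all of `H¹`. -/
theorem exists_gradient_yukL {m : ℝ} (hm : 0 < m) (f : L2 d) :
    ∃ g : Fin d → L2 d, (yukL m hm f, g) ∈ sobolevGraph d ∧ ∀ p ∈ sobolevGraph d,
      ∑ i, ⟪g i, p.2 i⟫_ℝ + m * ⟪yukL m hm f, p.1⟫_ℝ = ⟪f, p.1⟫_ℝ := by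
  obtain ⟨F, hF, hFt⟩ := mem_closure_iff_seq_limit.1 (dense_test d f)
  have hex : ∀ n, ∃ g : Fin d → L2 d, (yukL m hm (F n), g) ∈ sobolevGraph d ∧
      ∀ p ∈ sobolevGraph d,
        ∑ i, ⟪g i, p.2 i⟫_ℝ + m * ⟪yukL m hm (F n), p.1⟫_ℝ = ⟪F n, p.1⟫_ℝ := by
    intro n
    obtain ⟨η, hη, hc, h⟩ := hF n
    refine ⟨fun i => (memLp_pd_conv_test hm hη hc i).toLp, ?_, fun p hp => ?_⟩
    · rw [h, yukL_test hm hη hc]; exact conv_test_mem_sobolevGraph hm hη hc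
    · rw [h, yukL_test hm hη hc]; exact form_conv_test hm hη hc hp
  choose g hg hgf using hex
  have hdiff : ∀ n k i, ‖g n i - g k i‖ ^ 2 ≤ 1 / m * ‖F n - F k‖ ^ 2 := by
    intro n k i
    have hmem := (sobolevGraph d).sub_mem (hg n) (hg k)
    have h1 := hgf n _ hmem
    have h2 := hgf k _ hmem
    simp only [Prod.fst_sub, Prod.snd_sub, Pi.sub_apply] at h1 h2
    have h3 : ∑ i, ‖g n i - g k i‖ ^ 2 + m * ‖yukL m hm (F n) - yukL m hm (F k)‖ ^ 2 =
        ⟪F n - F k, yukL m hm (F n) - yukL m hm (F k)⟫_ℝ := by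
      simp only [← real_inner_self_eq_norm_sq]
      rw [inner_sub_left (F n), ← h1, ← h2, inner_sub_left (yukL m hm (F n))]
      simp only [inner_sub_left (g n _) (g k _), Finset.sum_sub_distrib]
      ring
    have h4 : ⟪F n - F k, yukL m hm (F n) - yukL m hm (F k)⟫_ℝ ≤ 1 / m * ‖F n - F k‖ ^ 2 := by
      rw [← map_sub]
      refine (real_inner_le_norm _ _).trans ?_
      have := (yukL m hm).le_of_opNorm_le (norm_yukL_le hm) (F n - F k)
      nlinarith [norm_nonneg (F n - F k)]
    have h5 : ‖g n i - g k i‖ ^ 2 ≤ ∑ i, ‖g n i - g k i‖ ^ 2 :=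
      Finset.single_le_sum (f := fun i => ‖g n i - g k i‖ ^ 2) (fun i _ => sq_nonneg _)
        (Finset.mem_univ i)
    have h6 : 0 ≤ m * ‖yukL m hm (F n) - yukL m hm (F k)‖ ^ 2 := by positivity
    linarith
  have hcau : ∀ i, ∃ G : L2 d, Tendsto (fun n => g n i) atTop (𝓝 G) := by
    intro i
    refine cauchySeq_tendsto_of_complete ?_
    have hFc := hFt.cauchySeq
    rw [Metric.cauchySeq_iff] at hFc ⊢
    intro ε hε
    obtain ⟨N, hN⟩ := hFc (ε * Real.sqrt m) (by positivity)
    refine ⟨N, fun n hn k hk => ?_⟩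
    have h := hN n hn k hk
    rw [dist_eq_norm] at h ⊢
    have h2 := hdiff n k i
    have h3 : ‖F n - F k‖ ^ 2 < (ε * Real.sqrt m) ^ 2 :=
      pow_lt_pow_left₀ h (norm_nonneg _) two_ne_zero
    rw [mul_pow, Real.sq_sqrt hm.le] at h3
    refine lt_of_pow_lt_pow_left₀ 2 hε.le (h2.trans_lt ?_)
    rw [one_div, inv_mul_lt_iff₀ hm]
    linarith
  choose G hG using hcau
  have hG' : Tendsto g atTop (𝓝 G) := tendsto_pi_nhds.2 hG
  have hY : Tendsto (fun n => yukL m hm (F n)) atTop (𝓝 (yukL m hm f)) :=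
    ((yukL m hm).continuous.tendsto f).comp hFt
  refine ⟨G, ?_, fun p hp => ?_⟩
  · exact isClosed_sobolevGraph.mem_of_tendsto (hY.prodMk_nhds hG') (Eventually.of_forall hg)
  · refine tendsto_nhds_unique (f := fun n => ∑ i, ⟪g n i, p.2 i⟫_ℝ + m * ⟪yukL m hm (F n), p.1⟫_ℝ)
      ?_ ((hFt.inner tendsto_const_nhds).congr fun n => (hgf n p hp).symm)
    exact (tendsto_finsetSum _ fun i _ => (hG i).inner tendsto_const_nhds).add
      ((hY.inner tendsto_const_nhds).const_mul m)

/-- Uniqueness of `H¹` solutions of `-Δu + m u = f`. -/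
theorem eq_yukL_of_weak {m : ℝ} (hm : 0 < m) {p : L2 d × (Fin d → L2 d)}
    (hp : p ∈ sobolevGraph d) (f : L2 d)
    (h : ∀ (φ : Space d → ℝ) (hφ : ContDiff ℝ ∞ φ) (hc : HasCompactSupport φ),
      ∑ i, ⟪(memLp_pd_test hφ hc i).toLp, p.2 i⟫_ℝ + m * ⟪(memLp_test hφ hc).toLp, p.1⟫_ℝ =
        ⟪(memLp_test hφ hc).toLp, f⟫_ℝ) : p.1 = yukL m hm f := by
  have key : ∀ g ∈ {f : L2 d | ∃ (η : Space d → ℝ) (hη : ContDiff ℝ ∞ η)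
      (hc : HasCompactSupport η), f = (memLp_test hη hc).toLp}, ⟪g, p.1⟫_ℝ = ⟪g, yukL m hm f⟫_ℝ := by
    rintro _ ⟨η, hη, hc, rfl⟩
    have hw := contDiff_conv_yukawa hm hη hc
    obtain ⟨φ, hφ, hφc, h1, h2⟩ := exists_test_tendsto hw (memLp_conv_test hm hη hc)
      (memLp_pd_conv_test hm hη hc)
    rw [← form_conv_test hm hη hc hp, ← inner_yukL_comm, yukL_test hm hη hc]
    refine tendsto_nhds_unique ?_ ((h1.inner tendsto_const_nhds).congr fun n =>
      (h (φ n) (hφ n) (hφc n)).symm)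
    exact (tendsto_finsetSum _ fun i _ => (h2 i).inner tendsto_const_nhds).add
      ((h1.inner tendsto_const_nhds).const_mul m)
  have h3 : ∀ g : L2 d, ⟪g, p.1⟫_ℝ = ⟪g, yukL m hm f⟫_ℝ := fun g =>
    congrFun (Continuous.ext_on (dense_test d) (by fun_prop) (by fun_prop) key) g
  exact ext_inner_left ℝ h3

/-! ### Compactness of `V (-Δ + m)⁻¹` -/

/-- Bounded sequences in `L²` have weakly convergent subsequences. -/
lemma L2.exists_weak_subseq (f : ℕ → L2 d) (hf : ∀ n, ‖f n‖ ≤ 1) :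
    ∃ g : L2 d, ‖g‖ ≤ 1 ∧ ∃ φ : ℕ → ℕ, StrictMono φ ∧
      ∀ h : L2 d, Tendsto (fun n => ⟪f (φ n), h⟫_ℝ) atTop (𝓝 ⟪g, h⟫_ℝ) := by
  have : Fact ((2 : ℝ≥0∞) ≠ ⊤) := ⟨by norm_num⟩
  have : SecondCountableTopology (L2 d) := Lp.SecondCountableTopology
  have hc := WeakDual.isSeqCompact_closedBall ℝ (L2 d) (0 : StrongDual ℝ (L2 d)) 1
  let x : ℕ → WeakDual ℝ (L2 d) := fun n =>
    StrongDual.toWeakDual (InnerProductSpace.toDual ℝ (L2 d) (f n))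
  obtain ⟨a, ha, φ, hφ, hlim⟩ := hc (x := x) (fun n => by
    simp [x]
    exact hf n)
  refine ⟨(InnerProductSpace.toDual ℝ (L2 d)).symm (WeakDual.toStrongDual a), ?_, φ, hφ, fun h => ?_⟩
  · simpa using ha
  · have := (WeakDual.eval_continuous (𝕜 := ℝ) (E := L2 d) h).tendsto a |>.comp hlim
    refine (this.congr fun n => ?_).trans (le_of_eq ?_)
    · simp [x]
    · simp

lemma conv_eq_inner {k : Space d → ℝ} (hk : MemLp k 2 volume) (x : Space d) :
    ∃ h : L2 d, ∀ f : L2 d, conv k f x = ⟪f, h⟫_ℝ := by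
  have hk' : MemLp (fun y => k (x - y)) 2 volume :=
    hk.comp_measurePreserving (Measure.measurePreserving_sub_left volume x)
  refine ⟨hk'.toLp, fun f => ?_⟩
  rw [real_inner_comm, L2.inner_toLp, conv_apply']

lemma isCompactOperator_mul_conv_of_memLp (V : Space d →ᵇ ℝ) (hV : MemLp V 2 volume)
    {k : Space d → ℝ} (hk : Integrable k) (hk2 : MemLp k 2 volume) :
    IsCompactOperator (mulL V ∘L convL k hk) := by
  set A := mulL V ∘L convL k hk with hA
  have hAe : ∀ f : L2 d, A f =ᵐ[volume] fun x => V x * conv k f x := fun f => by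
    filter_upwards [mulL_coeFn V (convL k hk f), convL_coeFn k hk f] with x h1 h2
    rw [hA, ContinuousLinearMap.comp_apply, h1, h2]
  have hMem : ∀ f : L2 d, MemLp (fun x => V x * conv k f x) 2 volume := fun f =>
    (Lp.memLp (A f)).ae_eq (hAe f)
  have hAt : ∀ f : L2 d, A f = (hMem f).toLp := fun f =>
    Lp.ext ((hAe f).trans (MemLp.coeFn_toLp _).symm)
  have hcomp : IsCompact (A '' Metric.closedBall 0 1) := by
    refine IsSeqCompact.isCompact fun y hy => ?_
    choose f hf hfy using hy
    obtain ⟨g, hg, φ, hφ, hlim⟩ := L2.exists_weak_subseq f (fun n => by simpa using hf n)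
    refine ⟨A g, ⟨g, by simpa using hg, rfl⟩, φ, hφ, ?_⟩
    have : (y ∘ φ) = fun n => (hMem (f (φ n))).toLp := funext fun n => by
      rw [← hAt]; exact (hfy _).symm
    rw [this, hAt g]
    refine L2.tendsto_toLp_of_dominated _ _ (hV.norm.const_mul ‖hk2.toLp‖)
      (fun n => ae_of_all _ fun x => ?_) (ae_of_all _ fun x => ?_)
    · rw [abs_mul, mul_comm]
      refine mul_le_mul_of_nonneg_right ((abs_conv_le_of_memLp hk2 _ x).trans ?_) (abs_nonneg _)
      exact mul_le_of_le_one_right (norm_nonneg _) (by simpa using hf (φ n))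
    · obtain ⟨h, hh⟩ := conv_eq_inner hk2 x
      simp only [hh]
      exact (hlim h).const_mul _
  exact (isCompactOperator_iff_image_closedBall_subset_compact
    (A : L2 d →ₛₗ[RingHom.id ℝ] L2 d) one_pos).2 ⟨_, hcomp, le_rfl⟩

/-- An integrable kernel splits into a bounded part, which is square integrable, and a part of
small integral. -/
lemma exists_truncation {k : Space d → ℝ} (hk : Integrable k) (hk0 : ∀ x, 0 ≤ k x) {ε : ℝ}
    (hε : 0 < ε) : ∃ k₁ k₂ : Space d → ℝ, Integrable k₁ ∧ Integrable k₂ ∧ MemLp k₁ 2 volume ∧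
      (∀ x, 0 ≤ k₁ x) ∧ (∀ x, 0 ≤ k₂ x) ∧ (∀ x, k x = k₁ x + k₂ x) ∧ ∫ x, |k₂ x| ≤ ε := by
  have hmeas : ∀ n : ℕ, AEStronglyMeasurable (fun x => min (k x) n) volume := fun n =>
    hk.1.inf aestronglyMeasurable_const
  have h1 : ∀ n : ℕ, Integrable (fun x => min (k x) n) := fun n =>
    hk.mono' (hmeas n) (ae_of_all _ fun x => by
      rw [Real.norm_of_nonneg (le_min (hk0 x) n.cast_nonneg)]; exact min_le_left _ _)
  have hlim : Tendsto (fun n : ℕ => ∫ x, |k x - min (k x) n|) atTop (𝓝 0) := by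
    have := tendsto_integral_of_dominated_convergence (μ := volume)
      (F := fun (n : ℕ) x => |k x - min (k x) n|) (f := fun _ => (0 : ℝ)) k
      (fun n => (hk.1.sub (hmeas n)).norm) hk
      (fun n => ae_of_all _ fun x => by
        have h2 : 0 ≤ min (k x) n := le_min (hk0 x) n.cast_nonneg
        have h3 : min (k x) n ≤ k x := min_le_left _ _
        rw [Real.norm_eq_abs, abs_abs, abs_of_nonneg (by linarith)]
        linarith)
      (ae_of_all _ fun x => by
        refine tendsto_const_nhds.congr' ?_
        obtain ⟨N, hN⟩ := exists_nat_ge (k x)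
        filter_upwards [eventually_ge_atTop N] with n hn
        rw [min_eq_left (hN.trans (by exact_mod_cast hn)), sub_self, abs_zero])
    simpa using this
  obtain ⟨n, hn⟩ := (hlim.eventually (ge_mem_nhds hε)).exists
  refine ⟨fun x => min (k x) n, fun x => k x - min (k x) n, h1 n, hk.sub (h1 n), ?_,
    fun x => le_min (hk0 x) n.cast_nonneg, fun x => sub_nonneg.2 (min_le_left _ _),
    fun x => by ring, hn⟩
  rw [memLp_two_iff_integrable_sq (hmeas n)]
  refine (hk.const_mul (n : ℝ)).mono' ((hmeas n).pow 2) (ae_of_all _ fun x => ?_)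
  rw [Real.norm_of_nonneg (sq_nonneg _), pow_two]
  exact mul_le_mul (min_le_right _ _) (min_le_left _ _) (le_min (hk0 x) n.cast_nonneg)
    n.cast_nonneg

/-- If `V` is bounded and square integrable, `V (-Δ + m)⁻¹` is a compact operator on `L²`. -/
theorem isCompactOperator_mul_yukL (V : Space d →ᵇ ℝ) (hV : MemLp V 2 volume) {m : ℝ}
    (hm : 0 < m) : IsCompactOperator (mulL V ∘L yukL m hm) := by
  have hex : ∀ n : ℕ, ∃ A : L2 d →L[ℝ] L2 d, IsCompactOperator A ∧
      ‖A - mulL V ∘L yukL m hm‖ ≤ ‖V‖ * (1 / ((n : ℝ) + 1)) := by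
    intro n
    obtain ⟨k₁, k₂, h1, h2, h3, -, -, hk, hle⟩ := exists_truncation
      (integrable_yukawa (d := d) hm) (yukawa_nonneg m) (ε := 1 / ((n : ℝ) + 1)) (by positivity)
    refine ⟨mulL V ∘L convL k₁ h1, isCompactOperator_mul_conv_of_memLp V hV h1 h3, ?_⟩
    have e : mulL V ∘L convL k₁ h1 - mulL V ∘L yukL m hm = - (mulL V ∘L convL k₂ h2) := by
      ext1 f
      have : yukL m hm f = convL k₁ h1 f + convL k₂ h2 f := by
        refine Lp.ext ?_
        filter_upwards [convL_coeFn _ (integrable_yukawa hm) f, convL_coeFn k₁ h1 f,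
          convL_coeFn k₂ h2 f, Lp.coeFn_add (convL k₁ h1 f) (convL k₂ h2 f),
          conv_sq_le h1 (Lp.memLp f), conv_sq_le h2 (Lp.memLp f)] with x e1 e2 e3 e4 e5 e6
        rw [yukL, e1, e4, Pi.add_apply, e2, e3]
        simp only [conv_apply, hk, add_mul]
        exact integral_add e5.1 e6.1
      simp [this]
    rw [e, norm_neg]
    refine (ContinuousLinearMap.opNorm_comp_le _ _).trans ?_
    exact mul_le_mul (norm_mulL_le V) ((norm_convL_le _ _).trans hle) (norm_nonneg _) (norm_nonneg _)
  choose A hA hAle using hex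
  refine isCompactOperator_of_tendsto (l := atTop) (F := A) ?_ (Eventually.of_forall hA)
  rw [tendsto_iff_norm_sub_tendsto_zero]
  refine squeeze_zero (fun n => norm_nonneg _) hAle ?_
  simpa using (tendsto_one_div_add_atTop_nhds_zero_nat (𝕜 := ℝ)).const_mul ‖V‖

/-! ### Weak derivatives, energies and weak solutions -/

section WeakPartial

variable {F G : Type*} [NormedAddCommGroup F] [NormedSpace ℝ F] [NormedAddCommGroup G]
  [NormedSpace ℝ G]

lemma integrable_smul_test {φ : Space d → ℝ} {u : Space d → F} (hu : LocallyIntegrable u volume)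
    (hφ : Continuous φ) (hc : HasCompactSupport φ) : Integrable (fun x => φ x • u x) :=
  hu.integrable_smul_left_of_hasCompactSupport hφ hc

lemma locallyIntegrable_clm_comp (L : F →L[ℝ] G) {u : Space d → F}
    (hu : LocallyIntegrable u volume) : LocallyIntegrable (fun x => L (u x)) volume := fun x =>
  let ⟨s, hs, h⟩ := hu x
  ⟨s, hs, L.integrable_comp h⟩

lemma integrable_fderiv_smul_test {φ : Space d → ℝ} {u : Space d → F}
    (hu : LocallyIntegrable u volume) (hφ : ContDiff ℝ ∞ φ) (hc : HasCompactSupport φ)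
    (i : Fin d) : Integrable (fun x => fderiv ℝ φ x (EuclideanSpace.single i 1) • u x) :=
  integrable_smul_test hu (contDiff_pd hφ i).continuous (hasCompactSupport_pd hc i)

lemma integrable_laplacian_smul_test {V : Space d → ℝ} (hV : Continuous V) {φ : Space d → ℝ}
    {u : Space d → F} (hu : LocallyIntegrable u volume) (hφ : ContDiff ℝ ∞ φ)
    (hc : HasCompactSupport φ) :
    Integrable (fun x => (- (Laplacian.laplacian φ : Space d → ℝ) x + V x * φ x) • u x) :=
  integrable_smul_test hu ((continuous_laplacian hφ).neg.add (hV.mul hφ.continuous))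
    ((hasCompactSupport_laplacian hφ hc).neg.add hc.mul_left)

lemma HasWeakPartial.congr {i : Fin d} {u v g h : Space d → F} (hu : HasWeakPartial i u g)
    (huv : u =ᵐ[volume] v) (hgh : g =ᵐ[volume] h) : HasWeakPartial i v h := by
  refine ⟨hu.1.congr huv, hu.2.1.congr hgh, fun φ hφ hc => ?_⟩
  rw [← integral_congr_ae (huv.mono fun x hx => by dsimp only; rw [hx] :
      (fun x => fderiv ℝ φ x (EuclideanSpace.single i 1) • u x) =ᵐ[volume] fun x =>
        fderiv ℝ φ x (EuclideanSpace.single i 1) • v x),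
    ← integral_congr_ae (hgh.mono fun x hx => by dsimp only; rw [hx] :
      (fun x => φ x • g x) =ᵐ[volume] fun x => φ x • h x)]
  exact hu.2.2 φ hφ hc

lemma HasWeakPartial.add {i : Fin d} {u v g h : Space d → F} (hu : HasWeakPartial i u g)
    (hv : HasWeakPartial i v h) : HasWeakPartial i (u + v) (g + h) := by
  refine ⟨hu.1.add hv.1, hu.2.1.add hv.2.1, fun φ hφ hc => ?_⟩
  simp only [Pi.add_apply, smul_add]
  rw [integral_add (integrable_fderiv_smul_test hu.1 hφ hc i)
    (integrable_fderiv_smul_test hv.1 hφ hc i),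
    integral_add (integrable_smul_test hu.2.1 hφ.continuous hc)
      (integrable_smul_test hv.2.1 hφ.continuous hc), hu.2.2 φ hφ hc, hv.2.2 φ hφ hc]
  abel

variable [CompleteSpace F] [CompleteSpace G]

lemma HasWeakPartial.ae_eq {i : Fin d} {u v g h : Space d → F} (hu : HasWeakPartial i u g)
    (hv : HasWeakPartial i v h) (huv : u =ᵐ[volume] v) : g =ᵐ[volume] h := by
  refine ae_eq_of_integral_contDiff_smul_eq hu.2.1 hv.2.1 fun φ hφ hc => ?_
  rw [← neg_inj, ← hu.2.2 φ hφ hc, ← hv.2.2 φ hφ hc]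
  exact integral_congr_ae (huv.mono fun x hx => by dsimp only; rw [hx])

lemma HasWeakPartial.weakPartial_ae_eq {i : Fin d} {u g : Space d → F}
    (h : HasWeakPartial i u g) : weakPartial i u =ᵐ[volume] g := by
  have hex : ∃ g, HasWeakPartial i u g := ⟨g, h⟩
  rw [weakPartial, dif_pos hex]
  exact hex.choose_spec.ae_eq h EventuallyEq.rfl

lemma HasWeakPartial.clm_comp {i : Fin d} {u g : Space d → F} (h : HasWeakPartial i u g)
    (L : F →L[ℝ] G) : HasWeakPartial i (fun x => L (u x)) (fun x => L (g x)) := by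
  refine ⟨locallyIntegrable_clm_comp L h.1, locallyIntegrable_clm_comp L h.2.1,
    fun φ hφ hc => ?_⟩
  have := congrArg L (h.2.2 φ hφ hc)
  rw [map_neg, ← L.integral_comp_comm (integrable_fderiv_smul_test h.1 hφ hc i),
    ← L.integral_comp_comm (integrable_smul_test h.2.1 hφ.continuous hc)] at this
  simpa using this

lemma SchrodingerEq.clm_comp {V : Space d → ℝ} (hV : Continuous V) {u f : Space d → F}
    (h : SchrodingerEq V u f) (L : F →L[ℝ] G) :
    SchrodingerEq V (fun x => L (u x)) (fun x => L (f x)) := by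
  refine ⟨locallyIntegrable_clm_comp L h.1, locallyIntegrable_clm_comp L h.2.1,
    fun φ hφ hc => ?_⟩
  have := congrArg L (h.2.2 φ hφ hc)
  rw [← L.integral_comp_comm (integrable_laplacian_smul_test hV h.1 hφ hc),
    ← L.integral_comp_comm (integrable_smul_test h.2.1 hφ.continuous hc)] at this
  simpa using this

end WeakPartial

/-- The quadratic form `∫ |∇u|² + V u²` on pairs `(u, ∇u)`. -/
def energyForm (V : Space d →ᵇ ℝ) (p : L2 d × (Fin d → L2 d)) : ℝ :=
  ∑ i, ‖p.2 i‖ ^ 2 + ⟪mulL V p.1, p.1⟫_ℝ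

lemma inner_mulL_eq_integral (V : Space d →ᵇ ℝ) (f g : L2 d) :
    ⟪mulL V f, g⟫_ℝ = ∫ x, V x * (f x * g x) := by
  rw [L2.inner_eq]
  refine integral_congr_ae ((mulL_coeFn V f).mono fun x hx => ?_)
  dsimp only
  rw [hx]; ring

lemma integrable_mulL (V : Space d →ᵇ ℝ) (f : L2 d) : Integrable (fun x => V x * f x ^ 2) := by
  refine (((Lp.memLp (mulL V f)).integrable_mul (Lp.memLp f))).congr
    ((mulL_coeFn V f).mono fun x hx => ?_)
  simp only [Pi.mul_apply]
  rw [hx]; ring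

lemma abs_inner_mulL_le (V : Space d →ᵇ ℝ) (f g : L2 d) : |⟪mulL V f, g⟫_ℝ| ≤ ‖V‖ * ‖f‖ * ‖g‖ :=
  (abs_real_inner_le_norm _ _).trans (mul_le_mul_of_nonneg_right
    ((mulL V).le_of_opNorm_le (norm_mulL_le V) f) (norm_nonneg _))

lemma neg_le_energyForm (V : Space d →ᵇ ℝ) (p : L2 d × (Fin d → L2 d)) :
    -‖V‖ * ‖p.1‖ ^ 2 ≤ energyForm V p := by
  have h1 := neg_le_of_abs_le (abs_inner_mulL_le V p.1 p.1)
  have h2 : 0 ≤ ∑ i, ‖p.2 i‖ ^ 2 := Finset.sum_nonneg fun i _ => sq_nonneg _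
  unfold energyForm
  nlinarith

lemma energyForm_smul (V : Space d →ᵇ ℝ) (c : ℝ) (p : L2 d × (Fin d → L2 d)) :
    energyForm V (c • p) = c ^ 2 * energyForm V p := by
  simp only [energyForm, Prod.smul_fst, Prod.smul_snd, Pi.smul_apply, norm_smul, map_smul,
    inner_smul_left, inner_smul_right, mul_pow, Real.norm_eq_abs, sq_abs, ← Finset.mul_sum]
  simp; ring

lemma exists_sobolevGraph_of_memH1 {u : Space d → ℝ} (hu : MemH1 u) :
    ∃ p ∈ sobolevGraph d, u =ᵐ[volume] p.1 := by
  choose g hg hgw using hu.2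
  refine ⟨(hu.1.toLp, fun i => (hg i).toLp), ?_, hu.1.coeFn_toLp.symm⟩
  rw [mem_sobolevGraph_iff]
  exact fun i => (hgw i).congr hu.1.coeFn_toLp.symm (hg i).coeFn_toLp.symm

section RealFunctions

variable {u : Space d → ℝ} {p : L2 d × (Fin d → L2 d)}

lemma memH1_of_sobolevGraph (hp : p ∈ sobolevGraph d) (h : u =ᵐ[volume] p.1) : MemH1 u :=
  ⟨(Lp.memLp p.1).ae_eq h.symm, fun i => ⟨p.2 i, Lp.memLp _,
    (mem_sobolevGraph_iff.1 hp i).congr h.symm EventuallyEq.rfl⟩⟩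

lemma weakPartial_ae_eq (hp : p ∈ sobolevGraph d) (h : u =ᵐ[volume] p.1) (i : Fin d) :
    weakPartial i u =ᵐ[volume] p.2 i :=
  ((mem_sobolevGraph_iff.1 hp i).congr h.symm EventuallyEq.rfl).weakPartial_ae_eq

lemma energy_eq (V : Space d →ᵇ ℝ) (hp : p ∈ sobolevGraph d) (h : u =ᵐ[volume] p.1) :
    energy V u = energyForm V p := by
  have hI : ∀ i ∈ Finset.univ, Integrable (fun x => p.2 i x ^ 2) := fun i _ =>
    (Lp.memLp (p.2 i)).integrable_sq
  simp only [energyForm, inner_mulL_eq_integral, L2.norm_sq_eq]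
  rw [← integral_finsetSum _ hI, ← integral_add (integrable_finsetSum _ hI)
    (by simpa only [pow_two] using integrable_mulL V p.1)]
  refine integral_congr_ae ?_
  filter_upwards [h, ae_all_iff.2 (weakPartial_ae_eq hp h)] with x h1 h2
  simp only [h1, h2, Real.norm_eq_abs, sq_abs]
  ring

lemma h1Norm_eq (hp : p ∈ sobolevGraph d) (h : u =ᵐ[volume] p.1) :
    h1Norm u = Real.sqrt (‖p.1‖ ^ 2 + ∑ i, ‖p.2 i‖ ^ 2) := by
  unfold h1Norm
  congr 2
  · rw [L2.norm_sq_eq]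
    exact integral_congr_ae (h.mono fun x hx => by simp [hx])
  · refine Finset.sum_congr rfl fun i _ => ?_
    rw [L2.norm_sq_eq]
    exact integral_congr_ae ((weakPartial_ae_eq hp h i).mono fun x hx => by simp [hx])

end RealFunctions

section ComplexFunctions

lemma exists_sobolevGraph_of_memH1_complex {f : Space d → ℂ} (hf : MemH1 f) :
    ∃ p ∈ sobolevGraph d, ∃ q ∈ sobolevGraph d,
      (fun x => (f x).re) =ᵐ[volume] p.1 ∧ (fun x => (f x).im) =ᵐ[volume] q.1 := by
  have key : ∀ L : ℂ →L[ℝ] ℝ, MemH1 fun x => L (f x) := fun L =>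
    ⟨L.comp_memLp' hf.1, fun i => by
      obtain ⟨g, hg, hgw⟩ := hf.2 i
      exact ⟨fun x => L (g x), L.comp_memLp' hg, hgw.clm_comp L⟩⟩
  obtain ⟨p, hp, hp'⟩ := exists_sobolevGraph_of_memH1 (key Complex.reCLM)
  obtain ⟨q, hq, hq'⟩ := exists_sobolevGraph_of_memH1 (key Complex.imCLM)
  exact ⟨p, hp, q, hq, hp', hq'⟩

variable {f : Space d → ℂ} {p q : L2 d × (Fin d → L2 d)}

lemma hasWeakPartial_complex (hp : p ∈ sobolevGraph d) (hq : q ∈ sobolevGraph d)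
    (hre : (fun x => (f x).re) =ᵐ[volume] p.1) (him : (fun x => (f x).im) =ᵐ[volume] q.1)
    (i : Fin d) : HasWeakPartial i f
      (fun x => (p.2 i x : ℂ) + Complex.I * (q.2 i x : ℂ)) := by
  have h1 := (mem_sobolevGraph_iff.1 hp i).clm_comp Complex.ofRealCLM
  have h2 := (mem_sobolevGraph_iff.1 hq i).clm_comp (Complex.I • Complex.ofRealCLM)
  refine (h1.add h2).congr ?_ (ae_of_all _ fun x => by simp)
  filter_upwards [hre, him] with x h1 h2
  simp only [Pi.add_apply, ← h1, ← h2]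
  apply Complex.ext <;> simp

lemma memH1_complex (hp : p ∈ sobolevGraph d) (hq : q ∈ sobolevGraph d)
    (hre : (fun x => (f x).re) =ᵐ[volume] p.1) (him : (fun x => (f x).im) =ᵐ[volume] q.1) :
    MemH1 f := by
  have key : ∀ a b : L2 d, MemLp (fun x => (a x : ℂ) + Complex.I * (b x : ℂ)) 2 volume :=
    fun a b => (Complex.ofRealCLM.comp_memLp' (Lp.memLp a)).add
      ((Complex.I • Complex.ofRealCLM).comp_memLp' (Lp.memLp b))
  refine ⟨(key p.1 q.1).ae_eq ?_, fun i => ⟨_, key _ _, hasWeakPartial_complex hp hq hre him i⟩⟩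
  filter_upwards [hre, him] with x h1 h2
  simp only [← h1, ← h2]
  apply Complex.ext <;> simp

lemma norm_sq_complex (z : ℂ) : ‖z‖ ^ 2 = z.re ^ 2 + z.im ^ 2 := by
  rw [← Complex.normSq_eq_norm_sq, Complex.normSq_apply]; ring

lemma integral_norm_sq_complex
    (hre : (fun x => (f x).re) =ᵐ[volume] p.1) (him : (fun x => (f x).im) =ᵐ[volume] q.1) :
    ∫ x, ‖f x‖ ^ 2 = ‖p.1‖ ^ 2 + ‖q.1‖ ^ 2 := by
  rw [L2.norm_sq_eq, L2.norm_sq_eq, ← integral_add (Lp.memLp p.1).integrable_sq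
    (Lp.memLp q.1).integrable_sq]
  refine integral_congr_ae ?_
  filter_upwards [hre, him] with x h1 h2
  rw [norm_sq_complex, h1, h2]

lemma energy_complex (V : Space d →ᵇ ℝ) (hp : p ∈ sobolevGraph d) (hq : q ∈ sobolevGraph d)
    (hre : (fun x => (f x).re) =ᵐ[volume] p.1) (him : (fun x => (f x).im) =ᵐ[volume] q.1) :
    energy V f = energyForm V p + energyForm V q := by
  rw [← energy_eq V hp EventuallyEq.rfl, ← energy_eq V hq EventuallyEq.rfl]
  have hI : ∀ p ∈ sobolevGraph d, Integrable
      fun x => ∑ i, ‖weakPartial i (p.1 : Space d → ℝ) x‖ ^ 2 + V x * ‖p.1 x‖ ^ 2 := by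
    intro p hp
    refine (integrable_finsetSum _ fun i _ => ?_).add ?_
    · refine (Lp.memLp (p.2 i)).integrable_sq.congr
        ((weakPartial_ae_eq hp EventuallyEq.rfl i).mono fun x hx => ?_)
      simp only [hx, Real.norm_eq_abs, sq_abs]
    · simpa using integrable_mulL V p.1
  unfold energy
  rw [← integral_add (hI p hp) (hI q hq)]
  refine integral_congr_ae ?_
  filter_upwards [hre, him, ae_all_iff.2 fun i =>
    (hasWeakPartial_complex hp hq hre him i).weakPartial_ae_eq,
    ae_all_iff.2 (weakPartial_ae_eq hp EventuallyEq.rfl),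
    ae_all_iff.2 (weakPartial_ae_eq hq EventuallyEq.rfl)] with x h1 h2 h3 h4 h5
  simp only [h3, h4, h5, norm_sq_complex, h1, h2, Real.norm_eq_abs, sq_abs]
  simp [Finset.sum_add_distrib]
  ring

end ComplexFunctions

section GroundStateEnergy

variable (V : Space d →ᵇ ℝ)

lemma bddBelow_energy : BddBelow {e : ℝ | ∃ f : Space d → ℂ, MemH1 f ∧ ∫ x, ‖f x‖ ^ 2 = 1 ∧
    energy V f = e} := by
  refine ⟨-‖V‖, ?_⟩
  rintro e ⟨f, hf, hf1, rfl⟩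
  obtain ⟨p, hp, q, hq, h1, h2⟩ := exists_sobolevGraph_of_memH1_complex hf
  rw [energy_complex V hp hq h1 h2]
  rw [integral_norm_sq_complex h1 h2] at hf1
  have h3 := neg_le_energyForm V p
  have h4 := neg_le_energyForm V q
  have h5 : -‖V‖ = -‖V‖ * ‖p.1‖ ^ 2 + -‖V‖ * ‖q.1‖ ^ 2 := by rw [← mul_add, hf1, mul_one]
  rw [h5]
  exact add_le_add h3 h4

lemma sobolevGraph_snd_eq_zero {p : L2 d × (Fin d → L2 d)} (hp : p ∈ sobolevGraph d)
    (h : p.1 = 0) (i : Fin d) : p.2 i = 0 := by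
  have h0 := mem_sobolevGraph_iff.1 (sobolevGraph d).zero_mem i
  refine Lp.ext ((mem_sobolevGraph_iff.1 hp i).ae_eq h0 ?_)
  rw [h]; rfl

lemma groundStateEnergy_mul_le {p : L2 d × (Fin d → L2 d)} (hp : p ∈ sobolevGraph d) :
    groundStateEnergy V * ‖p.1‖ ^ 2 ≤ energyForm V p := by
  by_cases h0 : p.1 = 0
  · simp [energyForm, h0, sobolevGraph_snd_eq_zero hp h0]
  have hn : 0 < ‖p.1‖ := norm_pos_iff.2 h0
  set c := ‖p.1‖⁻¹ with hc
  have hcp : c • p ∈ sobolevGraph d := (sobolevGraph d).smul_mem c hp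
  set f : Space d → ℂ := fun x => ((c • p).1 x : ℂ)
  have hre : (fun x => (f x).re) =ᵐ[volume] (c • p).1 := ae_of_all _ fun x => by simp [f]
  have him : (fun x => (f x).im) =ᵐ[volume] (0 : L2 d × (Fin d → L2 d)).1 :=
    (Lp.coeFn_zero ℝ 2 volume).mono fun x hx => by simp [f]
  have hmem := (sobolevGraph d).zero_mem
  have h := csInf_le (bddBelow_energy V) ⟨f, memH1_complex hcp hmem hre him, by
    rw [integral_norm_sq_complex (q := 0) hre him]
    simp only [Prod.smul_fst, norm_smul, Prod.fst_zero, norm_zero, hc, norm_inv, norm_norm]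
    field_simp
    simp, energy_complex V hcp hmem hre him⟩
  have h1 : groundStateEnergy V ≤ energyForm V (c • p) + energyForm V 0 := h
  have h2 : energyForm V (0 : L2 d × (Fin d → L2 d)) = 0 := by simp [energyForm]
  rw [h2, add_zero, energyForm_smul, hc, inv_pow, le_inv_mul_iff₀ (by positivity)] at h1
  linarith

lemma le_groundStateEnergy {c : ℝ} (hne : ∃ p ∈ sobolevGraph d, p.1 ≠ 0)
    (h : ∀ p ∈ sobolevGraph d, c * ‖p.1‖ ^ 2 ≤ energyForm V p) : c ≤ groundStateEnergy V := by
  refine le_csInf ?_ ?_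
  · obtain ⟨p, hp, h0⟩ := hne
    have hn : 0 < ‖p.1‖ := norm_pos_iff.2 h0
    have hcp : ‖p.1‖⁻¹ • p ∈ sobolevGraph d := (sobolevGraph d).smul_mem _ hp
    have hre : (fun x => (((‖p.1‖⁻¹ • p).1 x : ℂ)).re) =ᵐ[volume] (‖p.1‖⁻¹ • p).1 :=
      ae_of_all _ fun x => by simp
    have him : (fun x => (((‖p.1‖⁻¹ • p).1 x : ℂ)).im) =ᵐ[volume] (0 : L2 d × (Fin d → L2 d)).1 :=
      (Lp.coeFn_zero ℝ 2 volume).mono fun x hx => by simp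
    refine ⟨_, _, memH1_complex hcp (sobolevGraph d).zero_mem hre him, ?_, rfl⟩
    rw [integral_norm_sq_complex (q := 0) hre him]
    simp only [Prod.smul_fst, norm_smul, Prod.fst_zero, norm_zero, norm_inv, norm_norm]
    field_simp
    simp
  · rintro e ⟨f, hf, hf1, rfl⟩
    obtain ⟨p, hp, q, hq, h1, h2⟩ := exists_sobolevGraph_of_memH1_complex hf
    rw [energy_complex V hp hq h1 h2]
    rw [integral_norm_sq_complex h1 h2] at hf1
    have := h p hp
    have := h q hq
    have h5 : c = c * ‖p.1‖ ^ 2 + c * ‖q.1‖ ^ 2 := by rw [← mul_add, hf1, mul_one]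
    linarith

end GroundStateEnergy

/-- `p = (u, ∇u)` with `u ∈ H¹` solves `-Δu + V u = f`, tested against all of `H¹`. -/
def IsWeakSol (V : Space d →ᵇ ℝ) (p : L2 d × (Fin d → L2 d)) (f : L2 d) : Prop :=
  p ∈ sobolevGraph d ∧ ∀ q ∈ sobolevGraph d,
    ∑ i, ⟪p.2 i, q.2 i⟫_ℝ + ⟪mulL V p.1, q.1⟫_ℝ = ⟪f, q.1⟫_ℝ

lemma test_mem_sobolevGraph {φ : Space d → ℝ} (hφ : ContDiff ℝ ∞ φ) (hc : HasCompactSupport φ) :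
    ((memLp_test hφ hc).toLp, fun i => (memLp_pd_test hφ hc i).toLp) ∈ sobolevGraph d := by
  rw [mem_sobolevGraph_iff]
  intro i
  refine HasWeakPartial.congr (u := φ) (g := pd i φ) ⟨hφ.continuous.locallyIntegrable,
    (contDiff_pd hφ i).continuous.locallyIntegrable, fun η hη hηc => ?_⟩
    (memLp_test hφ hc).coeFn_toLp.symm (memLp_pd_test hφ hc i).coeFn_toLp.symm
  rw [eq_comm, neg_eq_iff_eq_neg]
  exact integral_mul_fderiv_eq_neg_fderiv_mul_of_integrable
    (integrable_mul_test (contDiff_pd hη i) (hasCompactSupport_pd hηc i) (memLp_test hφ hc))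
    (integrable_mul_test hη hηc (memLp_pd_test hφ hc i))
    (integrable_mul_test hη hηc (memLp_test hφ hc))
    (fun x _ => hη.differentiable (by simp) x) (fun x _ => hφ.differentiable (by simp) x)

/-- The distributional operator `-Δ + V`, tested against `φ`, in terms of the weak gradient. -/
lemma integral_laplacian_test (V : Space d →ᵇ ℝ) {p : L2 d × (Fin d → L2 d)}
    (hp : p ∈ sobolevGraph d) {u : Space d → ℝ} (hu : u =ᵐ[volume] p.1) {φ : Space d → ℝ}
    (hφ : ContDiff ℝ ∞ φ) (hc : HasCompactSupport φ) :
    ∫ x, (- (Laplacian.laplacian φ : Space d → ℝ) x + V x * φ x) • u x =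
      ∑ i, ⟪(memLp_pd_test hφ hc i).toLp, p.2 i⟫_ℝ + ⟪(memLp_test hφ hc).toLp, mulL V p.1⟫_ℝ := by
  have h1 : ∀ i, ⟪(memLp_pd_test hφ hc i).toLp, p.2 i⟫_ℝ = - ∫ x, pd i (pd i φ) x * p.1 x :=
    fun i => by
      rw [L2.inner_toLp, hp i _ (contDiff_pd hφ i) (hasCompactSupport_pd hc i), neg_neg]
  have hI : ∀ i ∈ Finset.univ, Integrable (fun x => pd i (pd i φ) x * p.1 x) := fun i _ =>
    integrable_mul_test (contDiff_pd (contDiff_pd hφ i) i)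
      (hasCompactSupport_pd (hasCompactSupport_pd hc i) i) (Lp.memLp _)
  simp only [h1]
  have hI' : Integrable (fun x => ∑ i, pd i (pd i φ) x * p.1 x) := integrable_finsetSum _ hI
  have hI'' : Integrable (fun x => - ∑ i, pd i (pd i φ) x * p.1 x) := hI'.neg
  rw [Finset.sum_neg_distrib, ← integral_finsetSum _ hI, L2.inner_toLp, ← integral_neg,
    ← integral_add hI'' (integrable_mul_test hφ hc (Lp.memLp (mulL V p.1)))]
  refine integral_congr_ae ?_
  filter_upwards [hu, mulL_coeFn V p.1] with x h2 h3
  rw [h2, h3, laplacian_eq_sum_pd hφ, smul_eq_mul, ← Finset.sum_mul]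
  ring

lemma IsWeakSol.eq_yukL {V : Space d →ᵇ ℝ} {p : L2 d × (Fin d → L2 d)} {f : L2 d}
    (h : IsWeakSol V p f) {m : ℝ} (hm : 0 < m) : p.1 = yukL m hm (m • p.1 - mulL V p.1 + f) := by
  refine eq_yukL_of_weak hm h.1 _ fun φ hφ hc => ?_
  have := h.2 _ (test_mem_sobolevGraph hφ hc)
  have hsum : ∑ i, ⟪(memLp_pd_test hφ hc i).toLp, p.2 i⟫_ℝ =
      ∑ i, ⟪p.2 i, (memLp_pd_test hφ hc i).toLp⟫_ℝ :=
    Finset.sum_congr rfl fun i _ => real_inner_comm _ _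
  rw [hsum, inner_add_right, inner_sub_right, inner_smul_right]
  rw [real_inner_comm (mulL V p.1), real_inner_comm f, ← this]
  ring

lemma exists_isWeakSol_of_eq_yukL {V : Space d →ᵇ ℝ} {u f : L2 d} {m : ℝ} (hm : 0 < m)
    (h : u = yukL m hm (m • u - mulL V u + f)) : ∃ g, IsWeakSol V (u, g) f := by
  obtain ⟨g, hg, hgf⟩ := exists_gradient_yukL hm (m • u - mulL V u + f)
  rw [← h] at hg hgf
  refine ⟨g, hg, fun q hq => ?_⟩
  have := hgf q hq
  rw [inner_add_left, inner_sub_left, inner_smul_left] at this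
  simp only [conj_trivial] at this
  linarith

/-- An `H¹` solution in the sense of distributions is a solution tested against all of `H¹`. -/
theorem isWeakSol_of_schrodingerEq {V : Space d →ᵇ ℝ} {p : L2 d × (Fin d → L2 d)}
    (hp : p ∈ sobolevGraph d) {u F : Space d → ℝ} {f : L2 d} (hu : u =ᵐ[volume] p.1)
    (hf : F =ᵐ[volume] f) (h : SchrodingerEq V u F) : IsWeakSol V p f := by
  have key : p.1 = yukL 1 one_pos ((1 : ℝ) • p.1 - mulL V p.1 + f) := by
    refine eq_yukL_of_weak one_pos hp _ fun φ hφ hc => ?_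
    have h1 := h.2.2 φ hφ hc
    rw [integral_laplacian_test V hp hu hφ hc] at h1
    have h2 : ∫ x, φ x • F x = ⟪(memLp_test hφ hc).toLp, f⟫_ℝ := by
      rw [L2.inner_toLp]
      exact integral_congr_ae (hf.mono fun x hx => by dsimp only; rw [hx]; rfl)
    rw [inner_add_right, inner_sub_right, inner_smul_right]
    linarith
  obtain ⟨g, hg⟩ := exists_isWeakSol_of_eq_yukL one_pos key
  have hpg : p = (p.1, g) := by
    have h1 := (sobolevGraph d).sub_mem hp hg.1
    have h2 := sobolevGraph_snd_eq_zero h1 (by simp)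
    refine Prod.ext rfl (funext fun i => ?_)
    simpa [sub_eq_zero] using h2 i
  rw [hpg]; exact hg

theorem IsWeakSol.schrodingerEq {V : Space d →ᵇ ℝ} {p : L2 d × (Fin d → L2 d)} {f : L2 d}
    (h : IsWeakSol V p f) {u F : Space d → ℝ} (hu : u =ᵐ[volume] p.1) (hf : F =ᵐ[volume] f) :
    SchrodingerEq V u F := by
  refine ⟨(locallyIntegrable_of_memLp (Lp.memLp p.1)).congr hu.symm,
    (locallyIntegrable_of_memLp (Lp.memLp f)).congr hf.symm, fun φ hφ hc => ?_⟩
  rw [integral_laplacian_test V h.1 hu hφ hc]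
  have h2 : ∫ x, φ x • F x = ⟪(memLp_test hφ hc).toLp, f⟫_ℝ := by
    rw [L2.inner_toLp]
    exact integral_congr_ae (hf.mono fun x hx => by dsimp only; rw [hx]; rfl)
  rw [h2, real_inner_comm f, ← h.2 _ (test_mem_sobolevGraph hφ hc),
    real_inner_comm (mulL V p.1)]
  refine congrArg (· + _) (Finset.sum_congr rfl fun i _ => real_inner_comm _ _)

/-! ### The essential spectrum and the sign of the ground state energy -/

lemma HasWeakPartial.sub {F : Type*} [NormedAddCommGroup F] [NormedSpace ℝ F] [CompleteSpace F]
    {i : Fin d} {u v g h : Space d → F} (hu : HasWeakPartial i u g)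
    (hv : HasWeakPartial i v h) : HasWeakPartial i (u - v) (g - h) := by
  have := hu.add (hv.clm_comp (-ContinuousLinearMap.id ℝ F))
  simpa [sub_eq_add_neg, Pi.add_def, Pi.neg_def] using! this

lemma MemH1.sub {F : Type*} [NormedAddCommGroup F] [NormedSpace ℝ F] [CompleteSpace F]
    {u v : Space d → F} (hu : MemH1 u) (hv : MemH1 v) : MemH1 (u - v) := by
  refine ⟨hu.1.sub hv.1, fun i => ?_⟩
  obtain ⟨g, hg, hgw⟩ := hu.2 i
  obtain ⟨h, hh, hhw⟩ := hv.2 i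
  exact ⟨g - h, hg.sub hh, hgw.sub hhw⟩

lemma SchrodingerEq.sub {F : Type*} [NormedAddCommGroup F] [NormedSpace ℝ F]
    {V : Space d → ℝ} (hV : Continuous V) {u v f g : Space d → F} (hu : SchrodingerEq V u f)
    (hv : SchrodingerEq V v g) : SchrodingerEq V (u - v) (f - g) := by
  refine ⟨hu.1.sub hv.1, hu.2.1.sub hv.2.1, fun φ hφ hc => ?_⟩
  simp only [Pi.sub_apply, smul_sub]
  rw [integral_sub (integrable_laplacian_smul_test hV hu.1 hφ hc)
    (integrable_laplacian_smul_test hV hv.1 hφ hc),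
    integral_sub (integrable_smul_test hu.2.1 hφ.continuous hc)
      (integrable_smul_test hv.2.1 hφ.continuous hc), hu.2.2 φ hφ hc, hv.2.2 φ hφ hc]

lemma isWeakSol_test (V : Space d →ᵇ ℝ) {a : Space d → ℝ} (ha : ContDiff ℝ ∞ a)
    (hc : HasCompactSupport a)
    (hf : MemLp (fun x => - (Laplacian.laplacian a : Space d → ℝ) x + V x * a x) 2 volume) :
    IsWeakSol V ((memLp_test ha hc).toLp, fun i => (memLp_pd_test ha hc i).toLp) hf.toLp := by
  refine ⟨test_mem_sobolevGraph ha hc, fun q hq => ?_⟩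
  rw [L2.inner_toLp]
  have := integral_laplacian_test V hq EventuallyEq.rfl ha hc
  simp only [smul_eq_mul] at this
  rw [this, ← inner_mulL_comm]

/-- Stability estimate for test functions at a real point of the resolvent set. -/
lemma integral_sq_le_of_mem_resolventSet (V : Space d →ᵇ ℝ) {z : ℝ}
    (hz : (z : ℂ) ∈ resolventSet V) : ∃ C : ℝ, 0 ≤ C ∧ ∀ a : Space d → ℝ, ContDiff ℝ ∞ a →
      HasCompactSupport a → ∫ x, a x ^ 2 ≤
        C * ∫ x, (- (Laplacian.laplacian a : Space d → ℝ) x + V x * a x - z * a x) ^ 2 := by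
  obtain ⟨hinj, C, hC⟩ := hz
  refine ⟨(C : ℝ) ^ 2, by positivity, fun a ha hc => ?_⟩
  set f : Space d → ℝ := fun x => - (Laplacian.laplacian a : Space d → ℝ) x + V x * a x with hfdef
  have hfc : Continuous f := (continuous_laplacian ha).neg.add (V.continuous.mul ha.continuous)
  have hfs : HasCompactSupport f := (hasCompactSupport_laplacian ha hc).neg.add hc.mul_left
  have hf : MemLp f 2 volume := hfc.memLp_of_hasCompactSupport hfs
  have hg : MemLp (fun x => f x - z * a x) 2 volume :=
    hf.sub ((memLp_test ha hc).const_mul z)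
  have hsol := isWeakSol_test V ha hc hf
  have hae := (memLp_test ha hc).coeFn_toLp.symm
  have hS : SchrodingerEq V a f := hsol.schrodingerEq hae hf.coeFn_toLp.symm
  obtain ⟨u, hu, huS, hule⟩ := hC (fun x => ((f x - z * a x : ℝ) : ℂ))
    (Complex.ofRealCLM.comp_memLp' hg)
  have haS := hS.clm_comp V.continuous Complex.ofRealCLM
  have haH : MemH1 fun x => (a x : ℂ) :=
    memH1_complex (test_mem_sobolevGraph ha hc) (sobolevGraph d).zero_mem
      (hae.mono fun x hx => by simpa using hx) (ae_of_all _ fun x => by simp)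
  have hdiff := hinj _ (hu.sub haH) (by
    have := huS.sub V.continuous haS
    have e : (fun x => (z : ℂ) * (u - fun x => (a x : ℂ)) x) =
        (fun x => (z : ℂ) * u x + ((f x - z * a x : ℝ) : ℂ)) -
          fun x => Complex.ofRealCLM (f x) := by
      funext x
      simp only [Pi.sub_apply, Complex.ofRealCLM_apply, Complex.ofReal_sub, Complex.ofReal_mul]
      ring
    rw [e]
    exact this)
  have hua : u =ᵐ[volume] fun x => (a x : ℂ) := hdiff.mono fun x hx => sub_eq_zero.1 hx
  rw [eLpNorm_congr_ae hua] at hule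
  have e1 : eLpNorm (fun x => (a x : ℂ)) 2 volume = eLpNorm a 2 volume :=
    eLpNorm_congr_norm_ae (ae_of_all _ fun x => by simp)
  have e2 : eLpNorm (fun x => ((f x - z * a x : ℝ) : ℂ)) 2 volume =
      eLpNorm (fun x => f x - z * a x) 2 volume :=
    eLpNorm_congr_norm_ae (ae_of_all _ fun x => by rw [Complex.norm_real])
  rw [e1, e2] at hule
  have h1 : ‖(memLp_test ha hc).toLp‖ ≤ C * ‖hg.toLp‖ := by
    rw [Lp.norm_toLp, Lp.norm_toLp]
    have := ENNReal.toReal_mono (ENNReal.mul_ne_top ENNReal.coe_ne_top hg.2.ne) hule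
    simpa [ENNReal.toReal_mul] using this
  have h2 := pow_le_pow_left₀ (norm_nonneg _) h1 2
  rwa [mul_pow, L2.norm_toLp_sq, L2.norm_toLp_sq] at h2

lemma laplacian_mul {c χ : Space d → ℝ} (hc : ContDiff ℝ ∞ c) (hχ : ContDiff ℝ ∞ χ) (x : Space d) :
    Laplacian.laplacian (fun x => c x * χ x) x = (∑ i, pd i (pd i c) x) * χ x +
      2 * ∑ i, pd i c x * pd i χ x + c x * Laplacian.laplacian χ x := by
  rw [laplacian_eq_sum_pd (hc.mul hχ), laplacian_eq_sum_pd hχ, Finset.sum_mul, Finset.mul_sum,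
    Finset.mul_sum, ← Finset.sum_add_distrib, ← Finset.sum_add_distrib]
  refine Finset.sum_congr rfl fun i _ => ?_
  have h1 : pd i (fun x => c x * χ x) = (fun x => pd i c x * χ x) + fun x => c x * pd i χ x :=
    funext fun x => pd_mul hc hχ i x
  have h2 : pd i ((fun x => pd i c x * χ x) + fun x => c x * pd i χ x) x =
      pd i (fun x => pd i c x * χ x) x + pd i (fun x => c x * pd i χ x) x := by
    unfold pd
    rw [fderiv_add]
    · rfl
    · exact ((contDiff_pd hc i).mul hχ).differentiable (by simp) x
    · exact (hc.mul (contDiff_pd hχ i)).differentiable (by simp) x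
  rw [h1, h2, pd_mul (contDiff_pd hc i) hχ, pd_mul hc (contDiff_pd hχ i)]
  ring

lemma pd_cos_coord (κ : ℝ) (j i : Fin d) :
    pd i (fun x : Space d => Real.cos (κ * x j)) =
      fun x => if i = j then -(κ * Real.sin (κ * x j)) else 0 := by
  funext x
  have h : HasFDerivAt (fun x : Space d => κ * x j) (κ • (EuclideanSpace.proj j : Space d →L[ℝ] ℝ)) x :=
    ((EuclideanSpace.proj j : Space d →L[ℝ] ℝ).hasFDerivAt).const_mul κ
  unfold pd
  rw [h.cos.fderiv]
  by_cases hij : i = j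
  · subst hij; simp; ring
  · simp [hij, Ne.symm hij]

lemma pd_sin_coord (κ : ℝ) (j i : Fin d) :
    pd i (fun x : Space d => Real.sin (κ * x j)) =
      fun x => if i = j then κ * Real.cos (κ * x j) else 0 := by
  funext x
  have h : HasFDerivAt (fun x : Space d => κ * x j) (κ • (EuclideanSpace.proj j : Space d →L[ℝ] ℝ)) x :=
    ((EuclideanSpace.proj j : Space d →L[ℝ] ℝ).hasFDerivAt).const_mul κ
  unfold pd
  rw [h.sin.fderiv]
  by_cases hij : i = j
  · subst hij; simp; ring
  · simp [hij, Ne.symm hij]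

lemma contDiff_coord (κ : ℝ) (j : Fin d) : ContDiff ℝ ∞ fun x : Space d => κ * x j :=
  contDiff_const.mul (EuclideanSpace.proj j : Space d →L[ℝ] ℝ).contDiff

/-- Modulating a test function by a plane wave of energy `κ²` turns the stability estimate at
`κ²` into an estimate without zeroth order term. -/
lemma integral_sq_le_modulated (V : Space d →ᵇ ℝ) {κ C : ℝ} (j : Fin d)
    (h : ∀ a : Space d → ℝ, ContDiff ℝ ∞ a → HasCompactSupport a → ∫ x, a x ^ 2 ≤
        C * ∫ x, (- (Laplacian.laplacian a : Space d → ℝ) x + V x * a x - κ ^ 2 * a x) ^ 2)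
    {χ : Space d → ℝ} (hχ : ContDiff ℝ ∞ χ) (hc : HasCompactSupport χ) :
    ∫ x, χ x ^ 2 ≤ C * ∫ x, ((V x * χ x - (Laplacian.laplacian χ : Space d → ℝ) x) ^ 2 +
      4 * κ ^ 2 * pd j χ x ^ 2) := by
  have hcos : ContDiff ℝ ∞ fun x : Space d => Real.cos (κ * x j) :=
    Real.contDiff_cos.comp (contDiff_coord κ j)
  have hsin : ContDiff ℝ ∞ fun x : Space d => Real.sin (κ * x j) :=
    Real.contDiff_sin.comp (contDiff_coord κ j)
  have hΔcos : ∀ x : Space d, ∑ i, pd i (pd i fun x : Space d => Real.cos (κ * x j)) x =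
      - κ ^ 2 * Real.cos (κ * x j) := by
    intro x
    rw [Finset.sum_eq_single j]
    · rw [pd_cos_coord]
      simp only [if_true]
      have e : (fun x : Space d => -(κ * Real.sin (κ * x j))) =
          fun x => (-κ) • Real.sin (κ * x j) := by funext x; simp
      rw [e]
      have := congrFun (pd_sin_coord κ j j) x
      unfold pd at this ⊢
      rw [fderiv_fun_const_smul (hsin.differentiable (by simp) x)]
      simp only [_root_.smul_apply, this]
      simp; ring
    · intro i _ hij
      rw [pd_cos_coord]; simp [hij, pd]
    · simp
  have hΔsin : ∀ x : Space d, ∑ i, pd i (pd i fun x : Space d => Real.sin (κ * x j)) x =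
      - κ ^ 2 * Real.sin (κ * x j) := by
    intro x
    rw [Finset.sum_eq_single j]
    · rw [pd_sin_coord]
      simp only [if_true]
      have e : (fun x : Space d => κ * Real.cos (κ * x j)) =
          fun x => κ • Real.cos (κ * x j) := by funext x; simp
      rw [e]
      have := congrFun (pd_cos_coord κ j j) x
      unfold pd at this ⊢
      rw [fderiv_fun_const_smul (hcos.differentiable (by simp) x)]
      simp only [_root_.smul_apply, this]
      simp; ring
    · intro i _ hij
      rw [pd_sin_coord]; simp [hij, pd]
    · simp
  have h1 := h _ (hcos.mul hχ) hc.mul_left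
  have h2 := h _ (hsin.mul hχ) hc.mul_left
  have hI : ∀ a : Space d → ℝ, Continuous a → HasCompactSupport a → Integrable a := fun a ha hac =>
    ha.integrable_of_hasCompactSupport hac
  have hsq : ∀ a : Space d → ℝ, ContDiff ℝ ∞ a → HasCompactSupport a →
      Integrable (fun x => a x ^ 2) := fun a ha hac => (memLp_test ha hac).integrable_sq
  have hR : ∀ a : Space d → ℝ, ContDiff ℝ ∞ a → HasCompactSupport a → Integrable (fun x =>
      (- (Laplacian.laplacian a : Space d → ℝ) x + V x * a x - κ ^ 2 * a x) ^ 2) := by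
    intro a ha hac
    have : MemLp (fun x => - (Laplacian.laplacian a : Space d → ℝ) x + V x * a x - κ ^ 2 * a x) 2
        volume :=
      (((continuous_laplacian ha).neg.add (V.continuous.mul ha.continuous)).sub
        (continuous_const.mul ha.continuous)).memLp_of_hasCompactSupport
        (((hasCompactSupport_laplacian ha hac).neg.add hac.mul_left).sub hac.mul_left)
    exact this.integrable_sq
  have h3 := add_le_add h1 h2
  rw [← integral_add (hsq _ (hcos.mul hχ) hc.mul_left) (hsq _ (hsin.mul hχ) hc.mul_left),
    ← mul_add, ← integral_add (hR _ (hcos.mul hχ) hc.mul_left)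
      (hR _ (hsin.mul hχ) hc.mul_left)] at h3
  refine le_trans (le_of_eq ?_) (h3.trans (le_of_eq ?_))
  · refine integral_congr_ae (ae_of_all _ fun x => ?_)
    dsimp only
    linear_combination (- χ x ^ 2) * Real.sin_sq_add_cos_sq (κ * x j)
  · congr 1
    refine integral_congr_ae (ae_of_all _ fun x => ?_)
    dsimp only
    rw [laplacian_mul hcos hχ, laplacian_mul hsin hχ, hΔcos, hΔsin]
    simp only [pd_cos_coord, pd_sin_coord]
    simp only [ite_mul, zero_mul, Finset.sum_ite_eq', Finset.mem_univ, if_true]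
    linear_combination ((V x * χ x - (Laplacian.laplacian χ : Space d → ℝ) x) ^ 2 +
      4 * κ ^ 2 * pd j χ x ^ 2) * Real.sin_sq_add_cos_sq (κ * x j)

/-- The positive half line contains no point of the resolvent set. -/
theorem notMem_resolventSet (hd : 1 ≤ d) (V : Space d →ᵇ ℝ)
    (hV : Tendsto V (cocompact (Space d)) (𝓝 0)) {z : ℝ} (hz : 0 < z) :
    (z : ℂ) ∉ resolventSet V := by
  intro hmem
  obtain ⟨C, hC0, hC⟩ := integral_sq_le_of_mem_resolventSet V hmem
  let j : Fin d := ⟨0, hd⟩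
  set κ := Real.sqrt z with hκ
  have hκ2 : κ ^ 2 = z := Real.sq_sqrt hz.le
  rw [← hκ2] at hC
  have hmod := fun {χ : Space d → ℝ} => integral_sq_le_modulated V (C := C) (κ := κ) j hC (χ := χ)
  -- translating the test function to infinity removes the potential
  have hfree : ∀ χ : Space d → ℝ, ContDiff ℝ ∞ χ → HasCompactSupport χ →
      ∫ x, χ x ^ 2 ≤ C * ∫ x, ((Laplacian.laplacian χ : Space d → ℝ) x ^ 2 +
        4 * κ ^ 2 * pd j χ x ^ 2) := by
    intro χ hχ hc
    let y : ℕ → Space d := fun n => (n : ℝ) • EuclideanSpace.single j (1 : ℝ)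
    have hy : ∀ x : Space d, Tendsto (fun n => -y n + x) atTop (cocompact (Space d)) := by
      intro x
      refine tendsto_cocompact_of_tendsto_dist_comp_atTop x ?_
      simp only [dist_eq_norm, add_sub_cancel_right, norm_neg, y, norm_smul]
      simpa using tendsto_natCast_atTop_atTop
    have key : ∀ n, ∫ x, χ x ^ 2 ≤ C * ∫ x, ((V (-y n + x) * χ x -
        (Laplacian.laplacian χ : Space d → ℝ) x) ^ 2 + 4 * κ ^ 2 * pd j χ x ^ 2) := by
      intro n
      have hχn : ContDiff ℝ ∞ fun x => χ (y n + x) := hχ.comp (contDiff_const.add contDiff_id)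
      have hcn : HasCompactSupport fun x => χ (y n + x) :=
        hc.comp_homeomorph (Homeomorph.addLeft (y n))
      have h := hmod hχn hcn
      simp only [laplacian_comp_add hχ, pd_comp_add] at h
      rw [integral_add_left_eq_self (fun x => χ x ^ 2)] at h
      have e := integral_add_left_eq_self (μ := volume) (fun x => (V (-y n + x) * χ x -
        (Laplacian.laplacian χ : Space d → ℝ) x) ^ 2 + 4 * κ ^ 2 * pd j χ x ^ 2) (y n)
      simp only [neg_add_cancel_left] at e
      rw [← e]; exact h
    suffices hlim : Tendsto (fun n => ∫ x, ((V (-y n + x) * χ x -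
        (Laplacian.laplacian χ : Space d → ℝ) x) ^ 2 + 4 * κ ^ 2 * pd j χ x ^ 2)) atTop
        (𝓝 (∫ x, ((Laplacian.laplacian χ : Space d → ℝ) x ^ 2 + 4 * κ ^ 2 * pd j χ x ^ 2))) from
      ge_of_tendsto' (hlim.const_mul C) key
    have hb : Integrable fun x => (‖V‖ * |χ x| + |(Laplacian.laplacian χ : Space d → ℝ) x|) ^ 2 +
        4 * κ ^ 2 * pd j χ x ^ 2 := by
      refine MemLp.integrable_sq ?_ |>.add ((memLp_pd_test hχ hc j).integrable_sq.const_mul _)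
      exact ((memLp_test hχ hc).norm.const_mul _).add
        ((continuous_laplacian hχ).memLp_of_hasCompactSupport (hasCompactSupport_laplacian hχ hc)).norm
    refine tendsto_integral_of_dominated_convergence _ (fun n => ?_) hb
      (fun n => ae_of_all _ fun x => ?_) (ae_of_all _ fun x => ?_)
    · refine Continuous.aestronglyMeasurable ?_
      have := continuous_laplacian hχ
      have := (contDiff_pd hχ j).continuous
      have := hχ.continuous
      fun_prop
    · rw [Real.norm_of_nonneg (by positivity)]
      gcongr ?_ + _
      rw [← sq_abs]
      refine pow_le_pow_left₀ (abs_nonneg _) ((abs_sub _ _).trans ?_) 2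
      rw [abs_mul]
      gcongr
      exact V.norm_coe_le_norm _
    · have h0 := (hV.comp (hy x)).mul_const (χ x)
      have := ((h0.sub_const ((Laplacian.laplacian χ : Space d → ℝ) x)).pow 2).add_const
        (4 * κ ^ 2 * pd j χ x ^ 2)
      simpa using this
  -- dilating the test function makes the right-hand side small
  obtain ⟨b, hb, hbc, hb0⟩ : ∃ b : Space d → ℝ, ContDiff ℝ ∞ b ∧ HasCompactSupport b ∧ b 0 ≠ 0 := by
    let b : ContDiffBump (0 : Space d) := ⟨1, 2, by norm_num, by norm_num⟩
    exact ⟨b, b.contDiff, b.hasCompactSupport, by simp [b.eventuallyEq_one.eq_of_nhds]⟩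
  have hbpos : 0 < ∫ x, b x ^ 2 := by
    refine Continuous.integral_pos_of_hasCompactSupport_nonneg_nonzero (x := 0)
      (hb.continuous.pow 2) ?_ (fun x => sq_nonneg _) ?_
    · exact hbc.comp_left (g := fun t : ℝ => t ^ 2) (by simp)
    · exact pow_ne_zero 2 hb0
  set A := ∫ x, (Laplacian.laplacian b : Space d → ℝ) x ^ 2 with hA
  set B := ∫ x, pd j b x ^ 2 with hB
  have hpds : ∀ (r : ℝ) (φ : Space d → ℝ) (i : Fin d), pd i (fun x => φ (r • x)) =
      fun x => r * pd i φ (r • x) := by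
    intro r φ i
    funext x
    unfold pd
    rw [fderiv_comp_smul]; rfl
  have hpdc : ∀ (r : ℝ) (φ : Space d → ℝ) (i : Fin d), Differentiable ℝ φ → pd i (fun x => r * φ x) =
      fun x => r * pd i φ x := by
    intro r φ i hφ
    funext x
    unfold pd
    rw [fderiv_const_mul (hφ x)]; rfl
  have hscale : ∀ n : ℕ, ∫ x, b x ^ 2 ≤ C * ((1 / ((n : ℝ) + 1)) ^ 4 * A +
      4 * κ ^ 2 * ((1 / ((n : ℝ) + 1)) ^ 2 * B)) := by
    intro n
    set r : ℝ := 1 / ((n : ℝ) + 1) with hr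
    have hr0 : 0 < r := by positivity
    have hbr : ContDiff ℝ ∞ fun x => b (r • x) := hb.comp (contDiff_const_smul _)
    have h := hfree (fun x => b (r • x)) hbr
      (hbc.comp_homeomorph (Homeomorph.smulOfNeZero r hr0.ne'))
    have hΔ : ∀ x, (Laplacian.laplacian fun x => b (r • x)) x =
        r ^ 2 * (Laplacian.laplacian b : Space d → ℝ) (r • x) := by
      intro x
      rw [laplacian_eq_sum_pd hbr, laplacian_eq_sum_pd hb, Finset.mul_sum]
      refine Finset.sum_congr rfl fun i _ => ?_
      rw [hpds, hpdc r (fun x => pd i b (r • x)) i (((contDiff_pd hb i).comp (contDiff_const_smul r)).differentiable (by simp)),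
        hpds]
      ring
    simp only [hΔ, hpds] at h
    rw [Measure.integral_comp_smul volume (fun x => b x ^ 2),
      Measure.integral_comp_smul volume (fun x => (r ^ 2 * (Laplacian.laplacian b : Space d → ℝ) x) ^ 2 +
        4 * κ ^ 2 * (r * pd j b x) ^ 2), smul_eq_mul, smul_eq_mul, mul_left_comm] at h
    have h' := le_of_mul_le_mul_left h (by positivity)
    refine h'.trans (le_of_eq ?_)
    congr 1
    have i1 : Integrable fun x => (Laplacian.laplacian b : Space d → ℝ) x ^ 2 :=
      ((continuous_laplacian hb).memLp_of_hasCompactSupport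
        (hasCompactSupport_laplacian hb hbc)).integrable_sq
    have i2 : Integrable fun x => pd j b x ^ 2 := (memLp_pd_test hb hbc j).integrable_sq
    simp only [mul_pow]
    rw [integral_add (i1.const_mul _) ((i2.const_mul _).const_mul _)]
    simp only [integral_const_mul]
    rw [← pow_mul]
  have hlim : Tendsto (fun n : ℕ => C * ((1 / ((n : ℝ) + 1)) ^ 4 * A +
      4 * κ ^ 2 * ((1 / ((n : ℝ) + 1)) ^ 2 * B))) atTop (𝓝 0) := by
    have h0 := tendsto_one_div_add_atTop_nhds_zero_nat (𝕜 := ℝ)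
    have := (((h0.pow 4).mul_const A).add (((h0.pow 2).mul_const B).const_mul (4 * κ ^ 2))).const_mul C
    simpa using this
  exact absurd (ge_of_tendsto' hlim hscale) (not_le.2 hbpos)

lemma IsWeakSol.energyForm_eq {V : Space d →ᵇ ℝ} {p : L2 d × (Fin d → L2 d)} {lam : ℝ}
    (h : IsWeakSol V p (lam • p.1)) : energyForm V p = lam * ‖p.1‖ ^ 2 := by
  have := h.2 p h.1
  rw [inner_smul_left] at this
  simpa [energyForm, real_inner_self_eq_norm_sq] using this

/-- A discrete eigenvalue forces the ground state energy to be negative. -/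
theorem groundStateEnergy_neg (hd : 1 ≤ d) (V : Space d →ᵇ ℝ)
    (hV : Tendsto V (cocompact (Space d)) (𝓝 0)) (h : ∃ lam : ℝ, IsDiscreteEigenvalue V lam) :
    groundStateEnergy V < 0 ∧ ∃ p ∈ sobolevGraph d, p.1 ≠ 0 := by
  obtain ⟨lam, ⟨u, ⟨huH, huS⟩, hu0⟩, -, hiso⟩ := h
  have hlam : lam < 0 := by
    by_contra hge
    rw [not_lt] at hge
    have ht : Tendsto (fun x : ℝ => (x : ℂ)) (𝓝[>] lam) (𝓝[≠] (lam : ℂ)) := by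
      refine tendsto_nhdsWithin_iff.2 ⟨(Complex.continuous_ofReal.tendsto lam).mono_left
        nhdsWithin_le_nhds, ?_⟩
      filter_upwards [self_mem_nhdsWithin] with x hx
      simpa using (ne_of_gt hx : x ≠ lam)
    obtain ⟨z, hz1, hz2⟩ := ((ht.eventually hiso).and self_mem_nhdsWithin).exists
    exact notMem_resolventSet hd V hV (hge.trans_lt hz2) hz1
  obtain ⟨p, hp, q, hq, h1, h2⟩ := exists_sobolevGraph_of_memH1_complex huH
  have key : ∀ (L : ℂ →L[ℝ] ℝ) (p : L2 d × (Fin d → L2 d)), p ∈ sobolevGraph d →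
      (fun x => L (u x)) =ᵐ[volume] p.1 → p.1 ≠ 0 → groundStateEnergy V ≤ lam := by
    intro L p hp hL hne
    have hS := huS.clm_comp V.continuous L
    have hw : IsWeakSol V p (lam • p.1) := by
      refine isWeakSol_of_schrodingerEq hp hL ?_ hS
      filter_upwards [hL, Lp.coeFn_smul lam p.1] with x e1 e2
      rw [e2, Pi.smul_apply, ← e1, ← map_smul]
      simp
    have h3 := groundStateEnergy_mul_le V hp
    rw [hw.energyForm_eq] at h3
    exact le_of_mul_le_mul_right h3 (by have := norm_pos_iff.2 hne; positivity)
  by_cases hp0 : p.1 = 0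
  · by_cases hq0 : q.1 = 0
    · refine absurd (Lp.ext ?_) hu0
      filter_upwards [h1, h2, Lp.coeFn_zero ℝ 2 (volume : Measure (Space d)),
        Lp.coeFn_zero ℂ 2 (volume : Measure (Space d))] with x e1 e2 e3 e4
      rw [hp0, e3] at e1
      rw [hq0, e3] at e2
      rw [e4]
      exact Complex.ext e1 e2
    · exact ⟨(key Complex.imCLM q hq h2 hq0).trans_lt hlam, q, hq, hq0⟩
  · exact ⟨(key Complex.reCLM p hp h1 hp0).trans_lt hlam, p, hp, hp0⟩

/-! ### The form of `H - E₀` and its spectral gap -/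

/-- The bilinear form of `H - E₀` on pairs `(u, ∇u)`. -/
def shiftForm (V : Space d →ᵇ ℝ) (p q : L2 d × (Fin d → L2 d)) : ℝ :=
  ∑ i, ⟪p.2 i, q.2 i⟫_ℝ + ⟪mulL V p.1, q.1⟫_ℝ - groundStateEnergy V * ⟪p.1, q.1⟫_ℝ

section ShiftForm

variable {V : Space d →ᵇ ℝ} {p q : L2 d × (Fin d → L2 d)}

lemma shiftForm_self (V : Space d →ᵇ ℝ) (p : L2 d × (Fin d → L2 d)) :
    shiftForm V p p = energyForm V p - groundStateEnergy V * ‖p.1‖ ^ 2 := by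
  simp [shiftForm, energyForm]

lemma shiftForm_self_nonneg (hp : p ∈ sobolevGraph d) : 0 ≤ shiftForm V p p := by
  rw [shiftForm_self, sub_nonneg]
  exact groundStateEnergy_mul_le V hp

lemma shiftForm_comm (p q : L2 d × (Fin d → L2 d)) : shiftForm V p q = shiftForm V q p := by
  unfold shiftForm
  rw [inner_mulL_comm, real_inner_comm p.1, real_inner_comm p.1]
  simp only [real_inner_comm]

lemma shiftForm_add_smul_self (p q : L2 d × (Fin d → L2 d)) (t : ℝ) :
    shiftForm V (p + t • q) (p + t • q) =
      shiftForm V p p + 2 * shiftForm V p q * t + shiftForm V q q * t ^ 2 := by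
  have h1 : shiftForm V (p + t • q) (p + t • q) = shiftForm V p p + t * shiftForm V p q +
      t * shiftForm V q p + t ^ 2 * shiftForm V q q := by
    simp only [shiftForm, Prod.fst_add, Prod.snd_add, Prod.smul_fst, Prod.smul_snd, Pi.add_apply,
      Pi.smul_apply, inner_add_left, inner_add_right, inner_smul_left, inner_smul_right, map_add,
      map_smul, conj_trivial, Finset.sum_add_distrib, ← Finset.mul_sum]
    ring
  rw [h1, shiftForm_comm q p]
  ring

/-- Cauchy–Schwarz for the nonnegative form `H - E₀ + ⟨h, ·⟩ h`. -/
lemma sq_shiftForm_add_le (h : L2 d) (hp : p ∈ sobolevGraph d) (hq : q ∈ sobolevGraph d) :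
    (shiftForm V p q + ⟪h, p.1⟫_ℝ * ⟪h, q.1⟫_ℝ) ^ 2 ≤
      (shiftForm V p p + ⟪h, p.1⟫_ℝ ^ 2) * (shiftForm V q q + ⟪h, q.1⟫_ℝ ^ 2) := by
  have key : ∀ t : ℝ, 0 ≤ (shiftForm V q q + ⟪h, q.1⟫_ℝ ^ 2) * (t * t) +
      2 * (shiftForm V p q + ⟪h, p.1⟫_ℝ * ⟪h, q.1⟫_ℝ) * t +
        (shiftForm V p p + ⟪h, p.1⟫_ℝ ^ 2) := by
    intro t
    have h1 := shiftForm_self_nonneg (V := V)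
      ((sobolevGraph d).add_mem hp ((sobolevGraph d).smul_mem t hq))
    rw [shiftForm_add_smul_self] at h1
    nlinarith [sq_nonneg (⟪h, p.1⟫_ℝ + t * ⟪h, q.1⟫_ℝ)]
  have := discrim_le_zero key
  unfold discrim at this
  nlinarith

lemma sq_shiftForm_le (hp : p ∈ sobolevGraph d) (hq : q ∈ sobolevGraph d) :
    shiftForm V p q ^ 2 ≤ shiftForm V p p * shiftForm V q q := by
  simpa using sq_shiftForm_add_le (V := V) 0 hp hq

lemma IsWeakSol.shiftForm_eq {f : L2 d} (hp : IsWeakSol V p (f + groundStateEnergy V • p.1))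
    (hq : q ∈ sobolevGraph d) : shiftForm V p q = ⟪f, q.1⟫_ℝ := by
  have := hp.2 q hq
  rw [inner_add_left, inner_smul_left] at this
  simp only [conj_trivial] at this
  unfold shiftForm
  linarith

lemma IsWeakSol.shiftForm_eq_zero (hp : IsWeakSol V p (groundStateEnergy V • p.1))
    (hq : q ∈ sobolevGraph d) : shiftForm V p q = 0 := by
  have h : IsWeakSol V p (0 + groundStateEnergy V • p.1) := by rwa [zero_add]
  rw [h.shiftForm_eq hq, inner_zero_left]

/-- Minimizers are eigenfunctions, by Cauchy–Schwarz for the form of `H - E₀`. -/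
lemma isWeakSol_of_shiftForm_self_le (hp : p ∈ sobolevGraph d) (h : shiftForm V p p ≤ 0) :
    IsWeakSol V p (groundStateEnergy V • p.1) := by
  refine ⟨hp, fun q hq => ?_⟩
  have h1 := sq_shiftForm_le (V := V) hp hq
  rw [le_antisymm h (shiftForm_self_nonneg hp), zero_mul] at h1
  have h2 : shiftForm V p q = 0 := pow_eq_zero_iff two_ne_zero |>.1 (le_antisymm h1 (sq_nonneg _))
  unfold shiftForm at h2
  rw [inner_smul_left]
  simp only [conj_trivial]
  linarith

/-- If `H - E₀ + ⟨h, ·⟩ h` is injective, it has a bounded inverse: its composition with the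
resolvent `(-Δ - E₀)⁻¹` is a compact perturbation of the identity. -/
theorem exists_inverse (hV : MemLp V 2 volume) (hE : groundStateEnergy V < 0) (h : L2 d)
    (hinj : ∀ p, IsWeakSol V p (groundStateEnergy V • p.1 - ⟪h, p.1⟫_ℝ • h) → p.1 = 0) :
    ∃ T : L2 d →L[ℝ] L2 d, ∀ g, ∃ G,
      IsWeakSol V (T g, G) (g - ⟪h, T g⟫_ℝ • h + groundStateEnergy V • T g) := by
  set E := groundStateEnergy V with hEdef
  have hm : 0 < -E := by linarith
  -- `Y (1 + K)⁻¹`, with `1 + K` the composition of `H - E₀ + ⟨h, ·⟩ h` with `Y = (-Δ - E₀)⁻¹`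
  let Y : L2 d →L[ℝ] L2 d := yukL (-E) hm
  let K : L2 d →L[ℝ] L2 d := mulL V ∘L Y +
    (ContinuousLinearMap.toSpanSingleton ℝ h) ∘L ((innerSL ℝ h) ∘L Y)
  have hKapp : ∀ f, K f = mulL V (Y f) + ⟪h, Y f⟫_ℝ • h := fun f => by simp [K]
  have hK : IsCompactOperator K := by
    refine (isCompactOperator_mul_yukL V hV hm).add ?_
    have hl : IsCompactOperator ((innerSL ℝ h) ∘L Y) :=
      isCompactOperator_of_locallyCompactSpace_dom ((innerSL ℝ h) ∘L Y)
    exact hl.clm_comp (ContinuousLinearMap.toSpanSingleton ℝ h)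
  have hne : ¬ Module.End.HasEigenvalue (K : Module.End ℝ (L2 d)) (-1) := by
    intro hev
    obtain ⟨f, hf⟩ := hev.exists_hasEigenvector
    have hKf : K f = -f := by simpa using hf.apply_eq_smul
    have hf' : f = -(mulL V (Y f)) - ⟪h, Y f⟫_ℝ • h := by
      rw [hKapp] at hKf
      rw [eq_neg_iff_add_eq_zero] at hKf
      rw [eq_sub_iff_add_eq, eq_neg_iff_add_eq_zero, ← hKf]
      abel
    have hYf : Y f = Y (-E • Y f - mulL V (Y f) + (E • Y f - ⟪h, Y f⟫_ℝ • h)) := by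
      congr 1
      refine hf'.trans ?_
      rw [neg_smul]; abel
    obtain ⟨g, hg⟩ := exists_isWeakSol_of_eq_yukL hm hYf
    have h0 : Y f = 0 := hinj _ hg
    rw [h0] at hf'
    simp at hf'
    exact hf.2 hf'
  have hres := (hK.hasEigenvalue_or_mem_resolventSet (μ := (-1 : ℝ)) (by norm_num)).resolve_left hne
  obtain ⟨U, hU⟩ := spectrum.mem_resolventSet_iff.1 hres
  let S : L2 d →L[ℝ] L2 d := -(↑U⁻¹ : L2 d →L[ℝ] L2 d)
  have hS : ∀ g, S g + K (S g) = g := by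
    intro g
    have h1 : (U : L2 d →L[ℝ] L2 d) ((↑U⁻¹ : L2 d →L[ℝ] L2 d) g) = g := by
      rw [← mul_apply_eq_comp, Units.mul_inv]; rfl
    rw [hU] at h1
    simp only [Algebra.algebraMap_eq_smul_one, _root_.sub_apply,
      _root_.smul_apply, one_apply_eq_self] at h1
    simp only [S, _root_.neg_apply, map_neg]
    simpa [sub_eq_add_neg] using h1
  refine ⟨Y ∘L S, fun g => ?_⟩
  rw [ContinuousLinearMap.comp_apply]
  refine exists_isWeakSol_of_eq_yukL hm ?_
  have h2 := hS g
  rw [hKapp] at h2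
  change Y (S g) = Y _
  congr 1
  rw [neg_smul]
  nth_rewrite 4 [← h2]
  abel

/-- Spectral gap: invertibility of `H - E₀ + ⟨h, ·⟩ h` makes its form coercive. This is Cauchy–Schwarz
for the form at `T u` and `u`, where its value is `‖u‖²`. -/
lemma norm_sq_le_of_inverse (h : L2 d) {T : L2 d →L[ℝ] L2 d}
    (hT : ∀ g, ∃ G, IsWeakSol V (T g, G) (g - ⟪h, T g⟫_ℝ • h + groundStateEnergy V • T g))
    (hp : p ∈ sobolevGraph d) :
    ‖p.1‖ ^ 2 ≤ (‖T‖ + 1) * (shiftForm V p p + ⟪h, p.1⟫_ℝ ^ 2) := by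
  obtain ⟨G, hG⟩ := hT p.1
  have hform : ∀ q ∈ sobolevGraph d,
      shiftForm V (T p.1, G) q + ⟪h, T p.1⟫_ℝ * ⟪h, q.1⟫_ℝ = ⟪p.1, q.1⟫_ℝ := by
    intro q hq
    rw [hG.shiftForm_eq hq, inner_sub_left, inner_smul_left]
    simp
  have h1 := sq_shiftForm_add_le (V := V) h hG.1 hp
  rw [hform p hp, pow_two ⟪h, (T p.1, G).1⟫_ℝ] at h1
  rw [hform _ hG.1, real_inner_self_eq_norm_sq] at h1
  have h2 : ⟪p.1, T p.1⟫_ℝ ≤ (‖T‖ + 1) * ‖p.1‖ ^ 2 := by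
    refine (real_inner_le_norm _ _).trans ?_
    have := T.le_opNorm p.1
    nlinarith [norm_nonneg p.1, sq_nonneg ‖p.1‖]
  set X := shiftForm V p p + ⟪h, p.1⟫_ℝ ^ 2
  have hX : 0 ≤ X := add_nonneg (shiftForm_self_nonneg hp) (sq_nonneg _)
  rcases (sq_nonneg ‖p.1‖).eq_or_lt with h0 | h0
  · rw [← h0]; positivity
  · refine le_of_mul_le_mul_left ?_ h0
    calc ‖p.1‖ ^ 2 * ‖p.1‖ ^ 2 = (‖p.1‖ ^ 2) ^ 2 := by ring
      _ ≤ ⟪p.1, T p.1⟫_ℝ * X := h1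
      _ ≤ ((‖T‖ + 1) * ‖p.1‖ ^ 2) * X := by gcongr
      _ = _ := by ring

/-- The infimum `E₀ < 0` is an eigenvalue: otherwise the form of `H - E₀` would be coercive, and `E₀`
could be increased. -/
theorem exists_eigenfunction (hV : MemLp V 2 volume) (hE : groundStateEnergy V < 0)
    (hne : ∃ p ∈ sobolevGraph d, p.1 ≠ 0) :
    ∃ p, IsWeakSol V p (groundStateEnergy V • p.1) ∧ p.1 ≠ 0 := by
  by_contra! hcon
  obtain ⟨T, hT⟩ := exists_inverse hV hE 0 (fun p hp => hcon p (by simpa using hp))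
  have h1 : groundStateEnergy V + (‖T‖ + 1)⁻¹ ≤ groundStateEnergy V := by
    refine le_groundStateEnergy V hne fun p hp => ?_
    have h2 := norm_sq_le_of_inverse 0 hT hp
    rw [inner_zero_left, shiftForm_self] at h2
    have hT0 : 0 < ‖T‖ + 1 := by positivity
    rw [← inv_mul_le_iff₀ hT0] at h2
    linarith
  have : 0 < (‖T‖ + 1)⁻¹ := by positivity
  linarith

end ShiftForm

/-! ### Order properties and bootstrapping -/

lemma L2.coeFn_mul_nonneg {f g : L2 d} (hf : 0 ≤ f) (hg : 0 ≤ g) : ∀ᵐ x, 0 ≤ f x * g x := by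
  filter_upwards [(Lp.coeFn_nonneg f).2 hf, (Lp.coeFn_nonneg g).2 hg] with x h1 h2
  exact mul_nonneg h1 h2

lemma L2.inner_nonneg {f g : L2 d} (hf : 0 ≤ f) (hg : 0 ≤ g) : 0 ≤ ⟪f, g⟫_ℝ := by
  rw [L2.inner_eq]
  exact integral_nonneg_of_ae (L2.coeFn_mul_nonneg hf hg)

lemma L2.integrable_mul (f g : L2 d) : Integrable (fun x => f x * g x) :=
  (Lp.memLp f).integrable_mul (Lp.memLp g)

lemma L2.eq_zero_of_inner_nonpos {f g : L2 d} (hf : ∀ᵐ x, 0 < f x) (hg : 0 ≤ g)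
    (h : ⟪f, g⟫_ℝ ≤ 0) : g = 0 := by
  have hf0 : 0 ≤ f := (Lp.coeFn_nonneg f).1 (hf.mono fun x hx => hx.le)
  have h0 := le_antisymm h (L2.inner_nonneg hf0 hg)
  rw [L2.inner_eq, integral_eq_zero_iff_of_nonneg_ae (L2.coeFn_mul_nonneg hf0 hg)
    (L2.integrable_mul f g)] at h0
  refine Lp.ext ?_
  filter_upwards [h0, hf, Lp.coeFn_zero ℝ 2 (volume : Measure (Space d))] with x h1 h2 h3
  rw [h3]
  exact (mul_eq_zero.1 h1).resolve_left h2.ne'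

lemma L2.abs_eq_zero {f : L2 d} (h : |f| = 0) : f = 0 := by
  rw [← norm_eq_zero, ← norm_abs_eq_norm, h, norm_zero]

lemma mulL_mono {W : Space d →ᵇ ℝ} (hW : ∀ x, 0 ≤ W x) {f g : L2 d} (h : f ≤ g) :
    mulL W f ≤ mulL W g := by
  rw [← Lp.coeFn_le] at h ⊢
  filter_upwards [h, mulL_coeFn W f, mulL_coeFn W g] with x h1 h2 h3
  rw [h2, h3]
  exact mul_le_mul_of_nonneg_left h1 (hW x)

lemma mulL_nonneg {W : Space d →ᵇ ℝ} (hW : ∀ x, 0 ≤ W x) {f : L2 d} (h : 0 ≤ f) :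
    0 ≤ mulL W f := by
  simpa using mulL_mono hW h

lemma abs_mulL {W : Space d →ᵇ ℝ} (hW : ∀ x, 0 ≤ W x) (f : L2 d) :
    |mulL W f| = mulL W |f| := by
  refine Lp.ext ?_
  filter_upwards [Lp.coeFn_abs (mulL W f), mulL_coeFn W f, mulL_coeFn W |f|,
    Lp.coeFn_abs f] with x h1 h2 h3 h4
  rw [h1, h2, h3, h4, abs_mul, abs_of_nonneg (hW x)]

lemma ae_abs_mulL_le (W : Space d →ᵇ ℝ) {f : L2 d} {B : ℝ} (hB : ∀ᵐ x, |f x| ≤ B) :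
    ∀ᵐ x, |mulL W f x| ≤ ‖W‖ * B := by
  filter_upwards [mulL_coeFn W f, hB] with x h1 h2
  rw [h1, abs_mul]
  exact mul_le_mul (W.norm_coe_le_norm x) h2 (abs_nonneg _) (norm_nonneg _)

section Yukawa

variable {m : ℝ} (hm : 0 < m)

lemma yukL_mono {f g : L2 d} (h : f ≤ g) : yukL m hm f ≤ yukL m hm g :=
  convL_mono _ (yukawa_nonneg m) h

lemma abs_yukL_le (f : L2 d) : |yukL m hm f| ≤ yukL m hm |f| := by
  refine abs_le'.2 ⟨yukL_mono hm (le_abs_self f), ?_⟩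
  rw [← map_neg]
  exact yukL_mono hm (neg_le_abs f)

lemma ae_abs_yukL_le {f : L2 d} {B : ℝ} (hB : ∀ᵐ x, |f x| ≤ B) :
    ∀ᵐ x, |yukL m hm f x| ≤ B / m := by
  filter_upwards [convL_coeFn _ (integrable_yukawa hm) f] with x hx
  rw [yukL, hx]
  refine (abs_conv_le_of_bounded (integrable_yukawa hm) hB x).trans_eq ?_
  rw [integral_abs_yukawa hm]; ring

/-- Subsolutions of `u ≤ B + c (-Δ + m)⁻¹ u` are bounded: the singular part of the kernel can be
taken small in `L¹`, and its regular part maps `L²` to bounded functions. -/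
theorem exists_ae_bound {c : ℝ} (hc : 0 ≤ c) : ∃ τ : ℝ, 0 ≤ τ ∧ ∀ B : ℝ, 0 ≤ B → ∀ u : L2 d,
    (∀ᵐ x, |u x| ≤ B + c * yukL m hm |u| x) → ∀ᵐ x, |u x| ≤ 2 * B + τ * ‖u‖ := by
  -- the singular part `k₂` satisfies `c ∫ k₂ ≤ 1 / 2`
  obtain ⟨k₁, k₂, h1, h2, h3, hk₁, hk₂, hk, hle⟩ := exists_truncation
    (integrable_yukawa (d := d) hm) (yukawa_nonneg m) (ε := 1 / (2 * (c + 1))) (by positivity)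
  have hcε : c * (1 / (2 * (c + 1))) ≤ 1 / 2 := by
    rw [mul_one_div, div_le_div_iff₀ (by positivity) (by norm_num)]; linarith
  refine ⟨2 * (c * ‖h3.toLp‖), by positivity, fun B hB u hu => ?_⟩
  set v : L2 d := |u| with hv
  have hvn : ‖v‖ = ‖u‖ := norm_abs_eq_norm u
  set A : ℝ := B + c * ‖h3.toLp‖ * ‖u‖ with hA
  have hA0 : 0 ≤ A := by positivity
  have hvx : ∀ᵐ x, v x = |u x| := Lp.coeFn_abs u
  -- with `v = |u|`, one has `v ≤ A + c k₂ ⋆ v`; the excess `w` of `v` over `2 A` satisfies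
  -- `w ≤ c k₂ ⋆ w`, which forces `‖w‖ ≤ ‖w‖ / 2`
  set w : Space d → ℝ := fun x => max (v x - 2 * A) 0 with hw
  have hwm : MemLp w 2 volume := by
    refine MemLp.of_le (Lp.memLp v) (((Lp.aestronglyMeasurable v).sub
      aestronglyMeasurable_const).sup aestronglyMeasurable_const) ?_
    filter_upwards [hvx] with x hx
    have h4 : 0 ≤ v x := hx ▸ abs_nonneg _
    rw [Real.norm_of_nonneg (le_max_right _ _), Real.norm_of_nonneg h4]
    exact max_le (by linarith) h4
  have hk2ε : ∫ y, k₂ y ≤ 1 / (2 * (c + 1)) :=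
    (integral_mono h2 h2.abs fun x => le_abs_self _).trans hle
  have hk20 : 0 ≤ ∫ y, k₂ y := integral_nonneg hk₂
  have key : ∀ᵐ x, w x ≤ c * conv k₂ w x := by
    filter_upwards [hu, hvx, convL_coeFn _ (integrable_yukawa hm) v, conv_sq_le h1 (Lp.memLp v),
      conv_sq_le h2 (Lp.memLp v), conv_sq_le h2 hwm] with x e1 e2 e3 e4 e5 e6
    have hw0 : 0 ≤ conv k₂ w x := conv_nonneg hk₂ (ae_of_all _ fun x => le_max_right _ _) x
    have h4 : yukL m hm v x = conv k₁ v x + conv k₂ v x := by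
      rw [yukL, e3]
      simp only [conv_apply, hk, add_mul]
      exact integral_add e4.1 e5.1
    have h5 : conv k₁ v x ≤ ‖h3.toLp‖ * ‖u‖ :=
      hvn ▸ (le_abs_self _).trans (abs_conv_le_of_memLp h3 v x)
    have h6 : conv k₂ v x ≤ 2 * A * (1 / (2 * (c + 1))) + conv k₂ w x := by
      calc conv k₂ v x ≤ ∫ y, (k₂ y * (2 * A) + k₂ y * w (x - y)) := by
            refine integral_mono e5.1 ((h2.mul_const _).add e6.1) fun y => ?_
            dsimp only
            rw [← mul_add]
            refine mul_le_mul_of_nonneg_left ?_ (hk₂ y)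
            have := le_max_left (v (x - y) - 2 * A) 0
            simp only [hw]; linarith
        _ = (∫ y, k₂ y) * (2 * A) + conv k₂ w x := by
            rw [integral_add (h2.mul_const _) e6.1, integral_mul_const]; rfl
        _ ≤ _ := by nlinarith
    have h7 : v x ≤ 2 * A + c * conv k₂ w x := by
      rw [e2]
      calc |u x| ≤ B + c * (conv k₁ v x + conv k₂ v x) := by rw [← h4]; exact e1
        _ ≤ B + c * (‖h3.toLp‖ * ‖u‖ + (2 * A * (1 / (2 * (c + 1))) + conv k₂ w x)) := by gcongr
        _ = A + 2 * A * (c * (1 / (2 * (c + 1)))) + c * conv k₂ w x := by rw [hA]; ring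
        _ ≤ A + 2 * A * (1 / 2) + c * conv k₂ w x := by gcongr
        _ = _ := by ring
    exact max_le (by linarith) (by positivity)
  have hwz : hwm.toLp = 0 := by
    have h4 : ‖hwm.toLp‖ ≤ c * ‖convL k₂ h2 hwm.toLp‖ := by
      refine Lp.norm_le_mul_norm_of_ae_le_mul ?_
      filter_upwards [key, hwm.coeFn_toLp, convL_coeFn k₂ h2 hwm.toLp] with x e1 e2 e3
      rw [e2, e3, conv_congr hwm.coeFn_toLp, Real.norm_of_nonneg (le_max_right _ _)]
      exact e1.trans (mul_le_mul_of_nonneg_left (le_abs_self _) hc)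
    have h5 := (convL k₂ h2).le_of_opNorm_le ((norm_convL_le k₂ h2).trans hle) hwm.toLp
    have h6 : ‖hwm.toLp‖ ≤ 1 / 2 * ‖hwm.toLp‖ := by
      refine h4.trans ((mul_le_mul_of_nonneg_left h5 hc).trans ?_)
      rw [← mul_assoc]
      exact mul_le_mul_of_nonneg_right hcε (norm_nonneg _)
    exact norm_le_zero_iff.1 (by linarith)
  filter_upwards [hwm.coeFn_toLp, hvx, Lp.coeFn_zero ℝ 2 (volume : Measure (Space d))]
    with x e1 e2 e3
  rw [hwz, e3] at e1
  have h4 := le_max_left (v x - 2 * A) 0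
  have h5 : max (v x - 2 * A) 0 = 0 := e1.symm
  rw [← e2]
  have h6 : 2 * A = 2 * B + 2 * (c * ‖h3.toLp‖) * ‖u‖ := by rw [hA]; ring
  linarith

/-- Solutions of `u = (-Δ + m)⁻¹ (W u + g)` with bounded `g` are bounded. -/
theorem exists_ae_bound_of_eq_yukL (W : Space d →ᵇ ℝ) : ∃ τ : ℝ, 0 ≤ τ ∧ ∀ B : ℝ, 0 ≤ B →
    ∀ u g : L2 d, (∀ᵐ x, |g x| ≤ B) → u = yukL m hm (mulL W u + g) →
      ∀ᵐ x, |u x| ≤ 2 * (B / m) + τ * ‖u‖ := by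
  obtain ⟨τ, hτ, h⟩ := exists_ae_bound (d := d) hm (norm_nonneg W)
  refine ⟨τ, hτ, fun B hB u g hg hu => h _ (by positivity) u ?_⟩
  have h1 : |mulL W u| ≤ ‖W‖ • |u| := by
    rw [← Lp.coeFn_le]
    filter_upwards [Lp.coeFn_abs (mulL W u), mulL_coeFn W u, Lp.coeFn_smul ‖W‖ |u|,
      Lp.coeFn_abs u] with x e1 e2 e3 e4
    rw [e1, e2, e3, Pi.smul_apply, e4, abs_mul, smul_eq_mul]
    exact mul_le_mul_of_nonneg_right (W.norm_coe_le_norm x) (abs_nonneg _)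
  have h2 : |yukL m hm (mulL W u)| ≤ ‖W‖ • yukL m hm |u| := by
    rw [← map_smul]
    exact (abs_yukL_le hm _).trans (yukL_mono hm h1)
  rw [← Lp.coeFn_le] at h2
  rw [map_add] at hu
  filter_upwards [h2, Lp.coeFn_abs (yukL m hm (mulL W u)), Lp.coeFn_smul ‖W‖ (yukL m hm |u|),
    ae_abs_yukL_le hm hg, Lp.coeFn_add (yukL m hm (mulL W u)) (yukL m hm g)] with x e1 e2 e3 e4 e5
  rw [e2, e3, Pi.smul_apply, smul_eq_mul] at e1
  have h3 : u x = yukL m hm (mulL W u) x + yukL m hm g x := by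
    conv_lhs => rw [hu]
    exact e5
  rw [h3]
  exact (abs_add_le _ _).trans (by linarith)

lemma exists_continuous_yukL {f : L2 d} {B : ℝ} (hB : ∀ᵐ x, |f x| ≤ B) :
    ∃ ψ : Space d → ℝ, Continuous ψ ∧ yukL m hm f =ᵐ[volume] ψ :=
  ⟨conv (yukawa m) f, continuous_conv_of_bounded (integrable_yukawa hm)
    (locallyIntegrable_of_memLp (Lp.memLp f)) hB, convL_coeFn _ (integrable_yukawa hm) f⟩

/-- `(-Δ + m)⁻¹` maps nonnegative nonzero functions to everywhere positive ones. -/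
lemma exists_continuous_pos_yukL {f : L2 d} {B : ℝ} (hB : ∀ᵐ x, |f x| ≤ B) (hf : 0 ≤ f)
    (hne : f ≠ 0) : ∃ ψ : Space d → ℝ, Continuous ψ ∧ (∀ x, 0 < ψ x) ∧
      yukL m hm f =ᵐ[volume] ψ := by
  refine ⟨conv (yukawa m) f, continuous_conv_of_bounded (integrable_yukawa hm)
    (locallyIntegrable_of_memLp (Lp.memLp f)) hB, fun x => ?_, convL_coeFn _ (integrable_yukawa hm) f⟩
  refine conv_pos (integrable_yukawa hm) (ae_yukawa_pos hm) (Lp.aestronglyMeasurable f) hB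
    ((Lp.coeFn_nonneg f).2 hf) (fun h0 => hne (Lp.ext (h0.trans ?_))) x
  exact (Lp.coeFn_zero ℝ 2 (volume : Measure (Space d))).symm

/-- Strong maximum principle for the integral equation `u = (-Δ + m)⁻¹ (W u)` with `W ≥ 0`. -/
lemma exists_continuous_pos_of_eq_yukL {W : Space d →ᵇ ℝ} (hW : ∀ x, 0 ≤ W x) {u : L2 d}
    (hu : u = yukL m hm (mulL W u)) (h0 : 0 ≤ u) (hne : u ≠ 0) :
    ∃ ψ : Space d → ℝ, Continuous ψ ∧ (∀ x, 0 < ψ x) ∧ u =ᵐ[volume] ψ := by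
  obtain ⟨τ, hτ, h⟩ := exists_ae_bound_of_eq_yukL (d := d) hm W
  have hb := h 0 le_rfl u 0 ((Lp.coeFn_zero ℝ 2 (volume : Measure (Space d))).mono
    fun x hx => by simp) (by simpa using hu)
  obtain ⟨ψ, hψ, hpos, he⟩ := exists_continuous_pos_yukL hm (ae_abs_mulL_le W hb)
    (mulL_nonneg hW h0) (fun hz => hne (by rw [hu, hz, map_zero]))
  rw [← hu] at he
  exact ⟨ψ, hψ, hpos, he⟩

end Yukawa

/-! ### The ground state -/

/-- The constant `M`, large enough for `M + E₀ - V ≥ 1`. The eigenvalue equation becomes the integral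
equation `u = (-Δ + M)⁻¹ ((M + E₀ - V) u)`. -/
def massConst (V : Space d →ᵇ ℝ) : ℝ := 1 + ‖V‖ - groundStateEnergy V

/-- The potential `M + E₀ - V ≥ 1`. -/
def posPot (V : Space d →ᵇ ℝ) : Space d →ᵇ ℝ := BoundedContinuousFunction.const _ (1 + ‖V‖) - V

section GroundState

variable {V : Space d →ᵇ ℝ}

lemma posPot_apply (x : Space d) : posPot V x = 1 + ‖V‖ - V x := rfl

lemma one_le_posPot (x : Space d) : 1 ≤ posPot V x := by
  have := (le_abs_self _).trans (V.norm_coe_le_norm x)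
  rw [posPot_apply]; linarith

lemma posPot_nonneg (x : Space d) : 0 ≤ posPot V x := zero_le_one.trans (one_le_posPot x)

lemma massConst_pos (hE : groundStateEnergy V < 0) : 0 < massConst V := by
  have := norm_nonneg V
  unfold massConst; linarith

lemma mulL_posPot (f : L2 d) : mulL (posPot V) f = (1 + ‖V‖) • f - mulL V f := by
  rw [posPot, mulL_sub, mulL_const]

lemma IsWeakSol.eq_yukL_posPot (hM : 0 < massConst V) {p : L2 d × (Fin d → L2 d)} {f : L2 d}
    (hp : IsWeakSol V p (f + groundStateEnergy V • p.1)) :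
    p.1 = yukL (massConst V) hM (mulL (posPot V) p.1 + f) := by
  refine (hp.eq_yukL hM).trans (congrArg _ ?_)
  rw [mulL_posPot, massConst, sub_smul]
  abel

lemma exists_shiftForm_yukL (hM : 0 < massConst V) (f : L2 d) :
    ∃ G, (yukL _ hM f, G) ∈ sobolevGraph d ∧ ∀ q ∈ sobolevGraph d,
      shiftForm V (yukL _ hM f, G) q = ⟪f - mulL (posPot V) (yukL _ hM f), q.1⟫_ℝ := by
  obtain ⟨G, hG, h⟩ := exists_gradient_yukL hM f
  refine ⟨G, hG, fun q hq => ?_⟩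
  have hMe : massConst V = 1 + ‖V‖ - groundStateEnergy V := rfl
  rw [inner_sub_left, ← h q hq, mulL_posPot, inner_sub_left, inner_smul_left, shiftForm]
  simp only [conj_trivial]
  linear_combination -⟪yukL _ hM f, q.1⟫_ℝ * hMe

/-- If `u` is an eigenfunction, then `q = (-Δ + M)⁻¹ ((M + E₀ - V) |u|)` is a minimizer: the form of
`H - E₀` at `q` is `-⟨(M + E₀ - V) (q - |u|), q⟩`, and `q ≥ |u|`. -/
lemma isWeakSol_yukL_abs (hM : 0 < massConst V) {u : L2 d}
    (hu : u = yukL (massConst V) hM (mulL (posPot V) u)) :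
    |u| ≤ yukL _ hM (mulL (posPot V) |u|) ∧
    ⟪mulL (posPot V) (yukL _ hM (mulL (posPot V) |u|) - |u|),
      yukL _ hM (mulL (posPot V) |u|)⟫_ℝ ≤ 0 ∧
    ∃ G, IsWeakSol V (yukL _ hM (mulL (posPot V) |u|), G)
      (groundStateEnergy V • yukL _ hM (mulL (posPot V) |u|)) := by
  set q := yukL _ hM (mulL (posPot V) |u|) with hq
  have h1 : |u| ≤ q := by
    rw [hq, ← abs_mulL posPot_nonneg]
    conv_lhs => rw [hu]
    exact abs_yukL_le hM _
  obtain ⟨G, hG, hform⟩ := exists_shiftForm_yukL hM (mulL (posPot V) |u|)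
  have h2 := hform _ hG
  rw [← hq] at h2 hG
  have h3 : 0 ≤ ⟪mulL (posPot V) (q - |u|), q⟫_ℝ :=
    L2.inner_nonneg (mulL_nonneg posPot_nonneg (sub_nonneg.2 h1)) ((abs_nonneg u).trans h1)
  have h4 : shiftForm V (q, G) (q, G) = - ⟪mulL (posPot V) (q - |u|), q⟫_ℝ := by
    rw [h2, ← map_sub, ← inner_neg_left, ← map_neg, neg_sub]
  have h5 := shiftForm_self_nonneg (V := V) hG
  exact ⟨h1, by linarith, G, isWeakSol_of_shiftForm_self_le hG (by linarith)⟩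

lemma eigenfunction_eq_yukL (hM : 0 < massConst V) {p : L2 d × (Fin d → L2 d)}
    (hp : IsWeakSol V p (groundStateEnergy V • p.1)) :
    p.1 = yukL (massConst V) hM (mulL (posPot V) p.1) := by
  have h : IsWeakSol V p (0 + groundStateEnergy V • p.1) := by rwa [zero_add]
  simpa using h.eq_yukL_posPot hM

lemma eigenfunction_ae_bound (hE : groundStateEnergy V < 0) {p : L2 d × (Fin d → L2 d)}
    (hp : IsWeakSol V p (groundStateEnergy V • p.1)) : ∃ B : ℝ, ∀ᵐ x, |p.1 x| ≤ B := by
  have hM := massConst_pos hE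
  obtain ⟨τ, hτ, h⟩ := exists_ae_bound_of_eq_yukL (d := d) hM (posPot V)
  exact ⟨_, h 0 le_rfl p.1 0 ((Lp.coeFn_zero ℝ 2 (volume : Measure (Space d))).mono
    fun x hx => by simp) (by simpa using eigenfunction_eq_yukL hM hp)⟩

lemma exists_pos_yukL_abs (hE : groundStateEnergy V < 0) {p : L2 d × (Fin d → L2 d)}
    (hp : IsWeakSol V p (groundStateEnergy V • p.1)) (hne : p.1 ≠ 0) :
    ∃ ψ : Space d → ℝ, Continuous ψ ∧ (∀ x, 0 < ψ x) ∧
      yukL _ (massConst_pos hE) (mulL (posPot V) |p.1|) =ᵐ[volume] ψ := by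
  obtain ⟨B, hB⟩ := eigenfunction_ae_bound hE hp
  have hB' : ∀ᵐ x, |(|p.1| : L2 d) x| ≤ B := by
    filter_upwards [hB, Lp.coeFn_abs p.1] with x h1 h2
    rwa [h2, abs_abs]
  refine exists_continuous_pos_yukL _ (ae_abs_mulL_le _ hB')
    (mulL_nonneg posPot_nonneg (abs_nonneg _)) fun h0 => hne ?_
  rw [← abs_mulL posPot_nonneg] at h0
  rw [eigenfunction_eq_yukL (massConst_pos hE) hp, L2.abs_eq_zero h0, map_zero]

/-- The ground state energy has a ground state. -/
theorem exists_isGroundState (hV : MemLp V 2 volume) (hE : groundStateEnergy V < 0)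
    (hne : ∃ p ∈ sobolevGraph d, p.1 ≠ 0) : ∃ ψ, IsGroundState V ψ := by
  obtain ⟨p, hp, hp0⟩ := exists_eigenfunction hV hE hne
  obtain ⟨ψ, hψ, hpos, hae⟩ := exists_pos_yukL_abs hE hp hp0
  obtain ⟨-, -, G, hG⟩ := isWeakSol_yukL_abs _ (eigenfunction_eq_yukL (massConst_pos hE) hp)
  set q := yukL _ (massConst_pos hE) (mulL (posPot V) |p.1|)
  have hq0 : q ≠ 0 := by
    intro h0
    rw [h0] at hae
    obtain ⟨x, h1, h2⟩ := (hae.and (Lp.coeFn_zero ℝ 2 (volume : Measure (Space d)))).exists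
    have := hpos x
    rw [← h1, h2] at this
    exact lt_irrefl _ this
  have hn : 0 < ‖q‖ := norm_pos_iff.2 hq0
  set r : L2 d × (Fin d → L2 d) := ‖q‖⁻¹ • (q, G) with hr
  have hrG : r ∈ sobolevGraph d := (sobolevGraph d).smul_mem _ hG.1
  have hrw : IsWeakSol V r (groundStateEnergy V • r.1) := by
    refine isWeakSol_of_shiftForm_self_le hrG ?_
    have h1 : shiftForm V r r = ‖q‖⁻¹ ^ 2 * shiftForm V (q, G) (q, G) := by
      rw [shiftForm_self, hr, energyForm_smul, shiftForm_self, Prod.smul_fst, norm_smul, norm_inv,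
        norm_norm]
      ring
    rw [h1, hG.shiftForm_eq_zero hG.1, mul_zero]
  have hrae : (fun x => ‖q‖⁻¹ * ψ x) =ᵐ[volume] r.1 := by
    filter_upwards [hae, Lp.coeFn_smul ‖q‖⁻¹ q] with x h1 h2
    rw [hr, Prod.smul_fst, h2, Pi.smul_apply, h1, smul_eq_mul]
  have hrn : ‖r.1‖ = 1 := by
    rw [hr, Prod.smul_fst, norm_smul, norm_inv, norm_norm, inv_mul_cancel₀ hn.ne']
  refine ⟨fun x => ‖q‖⁻¹ * ψ x, by fun_prop, fun x => mul_pos (inv_pos.2 hn) (hpos x),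
    memH1_of_sobolevGraph hrG hrae, ?_, ?_, hrw.schrodingerEq hrae ?_⟩
  · have h1 := L2.norm_sq_eq r.1
    rw [hrn, one_pow] at h1
    rw [h1]
    exact integral_congr_ae (hrae.mono fun x hx => by dsimp only at hx ⊢; rw [hx])
  · rw [energy_eq V hrG hrae, hrw.energyForm_eq, hrn, one_pow, mul_one]
  · filter_upwards [hrae, Lp.coeFn_smul (groundStateEnergy V) r.1] with x h1 h2
    rw [h2, Pi.smul_apply, ← h1, smul_eq_mul]

/-- The minimizer that dominates `|u|` is positive, so it equals `|u|`. -/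
lemma abs_eigenfunction_eq_yukL (hE : groundStateEnergy V < 0) {p : L2 d × (Fin d → L2 d)}
    (hp : IsWeakSol V p (groundStateEnergy V • p.1)) (hne : p.1 ≠ 0) :
    |p.1| = yukL _ (massConst_pos hE) (mulL (posPot V) |p.1|) := by
  obtain ⟨ψ, -, hpos, hae⟩ := exists_pos_yukL_abs hE hp hne
  obtain ⟨h1, h2, -⟩ := isWeakSol_yukL_abs _ (eigenfunction_eq_yukL (massConst_pos hE) hp)
  generalize yukL _ (massConst_pos hE) (mulL (posPot V) |p.1|) = q at *
  generalize |p.1| = a at *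
  have h3 := L2.eq_zero_of_inner_nonpos (hae.mono fun x hx => hx ▸ hpos x)
    (mulL_nonneg posPot_nonneg (sub_nonneg.2 h1)) (by rwa [real_inner_comm])
  have h4 : q - a = 0 := by
    refine Lp.ext ?_
    filter_upwards [mulL_coeFn (posPot V) (q - a),
      Lp.coeFn_zero ℝ 2 (volume : Measure (Space d))] with x e1 e2
    rw [h3, e2] at e1
    rw [e2]
    exact (mul_eq_zero.1 e1.symm).resolve_left (zero_lt_one.trans_le (one_le_posPot x)).ne'
  exact (sub_eq_zero.1 h4).symm

/-- Simplicity of the ground state energy: an eigenfunction orthogonal to a positive function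
vanishes. -/
theorem eigenfunction_eq_zero (hE : groundStateEnergy V < 0) {h : L2 d} (hh : ∀ᵐ x, 0 < h x)
    {p : L2 d × (Fin d → L2 d)} (hp : IsWeakSol V p (groundStateEnergy V • p.1))
    (horth : ⟪h, p.1⟫_ℝ = 0) : p.1 = 0 := by
  by_contra hne
  have hu := eigenfunction_eq_yukL (massConst_pos hE) hp
  have habs := abs_eigenfunction_eq_yukL hE hp hne
  generalize p.1 = u at *
  have hv0 : 0 ≤ |u| + u := neg_le_iff_add_nonneg.1 (neg_le_abs u)
  have hv : |u| + u = yukL _ (massConst_pos hE) (mulL (posPot V) (|u| + u)) := by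
    rw [map_add, map_add, ← habs, ← hu]
  suffices h3 : ⟪h, |u|⟫_ℝ = 0 from
    hne (L2.abs_eq_zero (L2.eq_zero_of_inner_nonpos hh (abs_nonneg u) h3.le))
  by_cases hvz : |u| + u = 0
  · rw [eq_neg_of_add_eq_zero_left hvz, inner_neg_right, horth, neg_zero]
  · obtain ⟨φ, -, hφ, hφe⟩ :=
      exists_continuous_pos_of_eq_yukL (massConst_pos hE) posPot_nonneg hv hv0 hvz
    have h4 : |u| = u := by
      refine Lp.ext ?_
      filter_upwards [hφe, Lp.coeFn_add |u| u, Lp.coeFn_abs u] with x e1 e2 e3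
      rw [e2, Pi.add_apply, e3] at e1
      rw [e3, abs_of_pos]
      have := hφ x
      by_contra hneg
      rw [abs_of_nonpos (not_lt.1 hneg)] at e1
      linarith
    rw [h4, horth]

end GroundState

/-! ### The nonlinearity -/

/-- The nonlinearity `s ↦ |s|^{2σ} s`. -/
def nl (σ s : ℝ) : ℝ := |s| ^ (2 * σ) * s

/-- The derivative of the nonlinearity. -/
def nlDeriv (σ s : ℝ) : ℝ := (2 * σ + 1) * |s| ^ (2 * σ)

/-- The nearest point projection of `ℝ` onto `[-β, β]`. -/
def clamp (β s : ℝ) : ℝ := max (-β) (min s β)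

lemma abs_clamp_le {β : ℝ} (hβ : 0 ≤ β) (s : ℝ) : |clamp β s| ≤ β :=
  abs_le.2 ⟨le_max_left _ _, max_le (by linarith) (min_le_right _ _)⟩

lemma clamp_of_abs_le {β s : ℝ} (h : |s| ≤ β) : clamp β s = s := by
  rw [clamp, min_eq_left (abs_le.1 h).2, max_eq_right (abs_le.1 h).1]

lemma clamp_zero {β : ℝ} (hβ : 0 ≤ β) : clamp β 0 = 0 := clamp_of_abs_le (by simpa)

lemma lipschitzWith_clamp (β : ℝ) : LipschitzWith 1 (clamp β) :=
  (LipschitzWith.id.min_const β).const_max (-β)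

lemma nl_zero {σ : ℝ} : nl σ 0 = 0 := by simp [nl]

section Nonlinearity

variable {σ : ℝ}

lemma hasDerivAt_nl (hσ : 1 ≤ σ) (s : ℝ) : HasDerivAt (nl σ) (nlDeriv σ s) s := by
  have h := (hasDerivAt_abs_rpow s (p := 2 * σ) (by linarith)).mul (hasDerivAt_id s)
  convert! h using 1
  rw [nlDeriv, id]
  rcases eq_or_ne s 0 with rfl | hs
  · rw [abs_zero, Real.zero_rpow (by linarith)]; simp
  · have h2 : |s| ^ (2 * σ) = |s| ^ (2 * σ - 2) * s ^ 2 := by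
      rw [← sq_abs, ← Real.rpow_natCast, ← Real.rpow_add (abs_pos.2 hs)]
      congr 1; push_cast; ring
    rw [h2]; ring

lemma hasDerivAt_nlDeriv (hσ : 1 ≤ σ) (s : ℝ) :
    HasDerivAt (nlDeriv σ) ((2 * σ + 1) * (2 * σ * |s| ^ (2 * σ - 2) * s)) s :=
  (hasDerivAt_abs_rpow s (p := 2 * σ) (by linarith)).const_mul _

lemma continuous_nlDeriv (hσ : 1 ≤ σ) : Continuous (nlDeriv σ) :=
  continuous_iff_continuousAt.2 fun s => (hasDerivAt_nlDeriv hσ s).continuousAt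

lemma nlDeriv_nonneg (hσ : 1 ≤ σ) (s : ℝ) : 0 ≤ nlDeriv σ s := by
  unfold nlDeriv; positivity

lemma nlDeriv_le (hσ : 1 ≤ σ) {β s : ℝ} (hs : |s| ≤ β) : nlDeriv σ s ≤ nlDeriv σ β := by
  unfold nlDeriv
  have : |s| ≤ |β| := hs.trans (le_abs_self β)
  gcongr

lemma abs_nl_sub_le (hσ : 1 ≤ σ) {β s t : ℝ} (hs : |s| ≤ β) (ht : |t| ≤ β) :
    |nl σ s - nl σ t| ≤ nlDeriv σ β * |s - t| := by
  have := Convex.norm_image_sub_le_of_norm_hasDerivWithin_le (s := Set.Icc (-β) β)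
    (C := nlDeriv σ β) (fun x _ => (hasDerivAt_nl hσ x).hasDerivWithinAt) (fun x hx => ?_)
    (convex_Icc _ _) (abs_le.1 ht) (abs_le.1 hs)
  · simpa using this
  · rw [Real.norm_of_nonneg (nlDeriv_nonneg hσ x)]
    exact nlDeriv_le hσ (abs_le.2 hx)

/-- Taylor remainder of the nonlinearity, in Lipschitz form. -/
lemma exists_abs_nl_sub_sub_le (hσ : 1 ≤ σ) (β : ℝ) : ∃ K : ℝ, 0 ≤ K ∧ ∀ a s t r : ℝ, |a| ≤ β → |s| ≤ β →
    |t| ≤ β → |s - a| ≤ r → |t - a| ≤ r →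
      |nl σ s - nl σ t - nlDeriv σ a * (s - t)| ≤ K * r * |s - t| := by
  refine ⟨(2 * σ + 1) * (2 * σ * |β| ^ (2 * σ - 2) * |β|), by positivity, ?_⟩
  intro a s t r ha hs ht hsa hta
  set K := (2 * σ + 1) * (2 * σ * |β| ^ (2 * σ - 2) * |β|) with hK
  have hK0 : 0 ≤ K := by positivity
  have h1 : ∀ x ∈ Set.Icc (-β) β, |nlDeriv σ x - nlDeriv σ a| ≤ K * |x - a| := by
    intro x hx
    refine Convex.norm_image_sub_le_of_norm_hasDerivWithin_le (s := Set.Icc (-β) β)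
      (fun x _ => (hasDerivAt_nlDeriv hσ x).hasDerivWithinAt) (fun y hy => ?_)
      (convex_Icc _ _) (abs_le.1 ha) hx
    have hy' : |y| ≤ |β| := (abs_le.2 hy).trans (le_abs_self β)
    have h0 : 0 ≤ 2 * σ - 2 := by linarith
    rw [Real.norm_eq_abs, abs_mul, abs_mul, abs_of_nonneg (by linarith : 0 ≤ 2 * σ + 1),
      abs_of_nonneg (by positivity : 0 ≤ 2 * σ * |y| ^ (2 * σ - 2))]
    rw [hK]
    gcongr
  have h2 := Convex.norm_image_sub_le_of_norm_hasDerivWithin_le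
    (f := fun x => nl σ x - nlDeriv σ a * x) (f' := fun x => nlDeriv σ x - nlDeriv σ a * 1)
    (s := Set.Icc (-β) β ∩ Set.Icc (a - r) (a + r)) (x := t) (y := s) (C := K * r)
    (fun x _ => ((hasDerivAt_nl hσ x).sub ((hasDerivAt_id x).const_mul _)).hasDerivWithinAt)
    (fun x hx => ?_) ((convex_Icc _ _).inter (convex_Icc _ _))
    ⟨abs_le.1 ht, by constructor <;> linarith [(abs_le.1 hta).1, (abs_le.1 hta).2]⟩
    ⟨abs_le.1 hs, by constructor <;> linarith [(abs_le.1 hsa).1, (abs_le.1 hsa).2]⟩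
  · refine le_trans (le_of_eq ?_) h2
    rw [Real.norm_eq_abs]
    congr 1; ring
  · rw [mul_one, Real.norm_eq_abs]
    refine (h1 x hx.1).trans (mul_le_mul_of_nonneg_left (abs_le.2 ?_) hK0)
    constructor <;> linarith [hx.2.1, hx.2.2]

lemma lipschitzWith_nl_clamp (hσ : 1 ≤ σ) {β : ℝ} (hβ : 0 ≤ β) :
    LipschitzWith (nlDeriv σ β).toNNReal fun s => nl σ (clamp β s) := by
  refine LipschitzWith.of_dist_le_mul fun s t => ?_
  rw [Real.dist_eq, Real.dist_eq, Real.coe_toNNReal _ (nlDeriv_nonneg hσ β)]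
  refine (abs_nl_sub_le hσ (abs_clamp_le hβ s) (abs_clamp_le hβ t)).trans ?_
  refine mul_le_mul_of_nonneg_left ?_ (nlDeriv_nonneg hσ β)
  simpa [Real.dist_eq] using (lipschitzWith_clamp β).dist_le_mul s t

end Nonlinearity

/-- The superposition operator on `L²` of the nonlinearity truncated at height `β`. -/
def nlL (σ β : ℝ) (hσ : 1 ≤ σ) (hβ : 0 ≤ β) : L2 d → L2 d :=
  (lipschitzWith_nl_clamp hσ hβ).compLp (by simp [clamp_zero hβ, nl_zero])

lemma nlL_coeFn {σ β : ℝ} (hσ : 1 ≤ σ) (hβ : 0 ≤ β) (u : L2 d) :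
    nlL σ β hσ hβ u =ᵐ[volume] fun x => nl σ (clamp β (u x)) :=
  LipschitzWith.coeFn_compLp _ _ u

lemma norm_nlL_sub_le {σ β : ℝ} (hσ : 1 ≤ σ) (hβ : 0 ≤ β) (u v : L2 d) :
    ‖nlL σ β hσ hβ u - nlL σ β hσ hβ v‖ ≤ nlDeriv σ β * ‖u - v‖ := by
  have := LipschitzWith.norm_compLp_sub_le (lipschitzWith_nl_clamp hσ hβ)
    (by simp [clamp_zero hβ, nl_zero]) u v
  rwa [Real.coe_toNNReal _ (nlDeriv_nonneg hσ β)] at this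

lemma isClosed_ae_abs_le {r : ℝ} (hr : 0 ≤ r) : IsClosed {u : L2 d | ∀ᵐ x, |u x| ≤ r} := by
  have h0 := clamp_zero hr
  have e : {u : L2 d | ∀ᵐ x, |u x| ≤ r} = {u | (lipschitzWith_clamp r).compLp h0 u = u} := by
    ext u
    simp only [Set.mem_ofPred_eq]
    constructor
    · intro h
      refine Lp.ext ?_
      filter_upwards [h, (lipschitzWith_clamp r).coeFn_compLp h0 u] with x h1 h2
      rw [h2, Function.comp_apply, clamp_of_abs_le h1]
    · intro h
      filter_upwards [(lipschitzWith_clamp r).coeFn_compLp h0 u] with x h2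
      rw [h] at h2
      rw [h2]
      exact abs_clamp_le hr _
  rw [e]
  exact isClosed_eq ((lipschitzWith_clamp r).continuous_compLp h0) continuous_id

/-! ### The Lyapunov–Schmidt fixed point -/

/-- Contraction principle on the set of functions bounded by `r` in `L²` and uniformly. -/
lemma exists_fixedPoint_of_lipschitz {Ψ : L2 d → L2 d} {r : ℝ} (hr : 0 ≤ r)
    (hmaps : ∀ R, ‖R‖ ≤ r → (∀ᵐ x, |R x| ≤ r) → ‖Ψ R‖ ≤ r ∧ ∀ᵐ x, |Ψ R x| ≤ r)
    (hlip : ∀ R R', ‖R‖ ≤ r → (∀ᵐ x, |R x| ≤ r) → ‖R'‖ ≤ r → (∀ᵐ x, |R' x| ≤ r) →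
      ‖Ψ R - Ψ R'‖ ≤ 1 / 2 * ‖R - R'‖) :
    ∃ R, ‖R‖ ≤ r ∧ (∀ᵐ x, |R x| ≤ r) ∧ R = Ψ R := by
  set B : Set (L2 d) := {R | ‖R‖ ≤ r ∧ ∀ᵐ x, |R x| ≤ r} with hB
  have hBc : IsClosed B :=
    (isClosed_le continuous_norm continuous_const).inter (isClosed_ae_abs_le hr)
  have h0B : (0 : L2 d) ∈ B := by
    refine ⟨by simpa using hr, ?_⟩
    filter_upwards [Lp.coeFn_zero ℝ 2 (volume : Measure (Space d))] with x hx
    rw [hx]; simpa using hr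
  have hM : Set.MapsTo Ψ B B := fun R hR => hmaps R hR.1 hR.2
  have hcontr : ContractingWith (1 / 2) (hM.restrict Ψ B B) := by
    refine ⟨by rw [← NNReal.coe_lt_coe]; norm_num, LipschitzWith.of_dist_le_mul fun R R' => ?_⟩
    have := hlip R R' R.2.1 R.2.2 R'.2.1 R'.2.2
    rw [Subtype.dist_eq, Subtype.dist_eq, dist_eq_norm, dist_eq_norm]
    simpa using this
  obtain ⟨R, hRB, hfix, -⟩ := hcontr.exists_fixedPoint' hBc.isComplete hM h0B (edist_ne_top _ _)
  exact ⟨R, hRB.1, hRB.2, hfix.symm⟩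

lemma norm_smul_sub_smul_le {ψ : L2 d} (hψ : ‖ψ‖ = 1) {μ : ℝ} (hμ : 0 ≤ μ) (v : L2 d) (e : ℝ) :
    ‖μ • v - e • ψ‖ ≤ μ * ‖v‖ + |e| := by
  refine (norm_sub_le _ _).trans_eq ?_
  rw [norm_smul, norm_smul, hψ, mul_one, Real.norm_of_nonneg hμ, Real.norm_eq_abs]

lemma ae_abs_smul_sub_smul_le {ψ : L2 d} {b : ℝ} (hb : ∀ᵐ x, |ψ x| ≤ b) {μ : ℝ} (hμ : 0 ≤ μ)
    (v : L2 d) (e : ℝ) : ∀ᵐ x, |(μ • v - e • ψ : L2 d) x| ≤ μ * |v x| + |e| * b := by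
  filter_upwards [hb, Lp.coeFn_sub (μ • v) (e • ψ), Lp.coeFn_smul μ v, Lp.coeFn_smul e ψ]
    with x e2 e3 e4 e5
  rw [e3, Pi.sub_apply, e4, e5, Pi.smul_apply, Pi.smul_apply, smul_eq_mul, smul_eq_mul]
  refine (abs_sub _ _).trans ?_
  rw [abs_mul, abs_mul, abs_of_nonneg hμ]
  gcongr

/-- The equation `R = μ S N(R) - k ⟨ψ, Q(R)⟩ ψ` with Lipschitz `N` and superlinear `Q` has a solution
of size `O(μ)` for small `μ`. -/
theorem exists_fixedPoint_of_small {N Q : L2 d → L2 d} {ψ : L2 d} {S : L2 d →L[ℝ] L2 d}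
    {L k K nb b τ : ℝ} (hL : 0 ≤ L) (hk : 0 ≤ k) (hK : 0 ≤ K) (hnb : 0 ≤ nb) (hb0 : 0 ≤ b)
    (hψ : ‖ψ‖ = 1) (hb : ∀ᵐ x, |ψ x| ≤ b)
    (hN : ∀ R R', ‖N R - N R'‖ ≤ L * ‖R - R'‖)
    (hNb : ∀ R : L2 d, (∀ᵐ x, |R x| ≤ 1) → ∀ᵐ x, |N R x| ≤ nb) (hQ0 : Q 0 = 0)
    (hQ : ∀ r ≤ (1 : ℝ), ∀ R R' : L2 d, (∀ᵐ x, |R x| ≤ r) → (∀ᵐ x, |R' x| ≤ r) →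
      ‖Q R - Q R'‖ ≤ K * r * ‖R - R'‖)
    (hτ : 0 ≤ τ)
    (hSτ : ∀ B : ℝ, 0 ≤ B → ∀ g : L2 d, (∀ᵐ x, |g x| ≤ B) → ∀ᵐ x, |S g x| ≤ τ * (B + ‖g‖)) :
    ∃ A : ℝ, 0 ≤ A ∧ ∃ δ : ℝ, 0 < δ ∧ ∀ μ : ℝ, 0 < μ → μ ≤ δ → A * μ ≤ 1 ∧ ∃ R : L2 d,
      ‖R‖ ≤ A * μ ∧ (∀ᵐ x, |R x| ≤ A * μ) ∧ R = μ • S (N R) - (k * ⟪ψ, Q R⟫_ℝ) • ψ := by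
  -- `n₂` and `nb` bound `N` in `L²` and uniformly, so `A μ` is twice the size of `μ S N(R)`
  obtain ⟨n₂, hn₂⟩ : ∃ n₂, n₂ = ‖N 0‖ + L := ⟨_, rfl⟩
  have hn₂0 : 0 ≤ n₂ := by rw [hn₂]; positivity
  obtain ⟨A, hA⟩ : ∃ A, A = 2 * (‖S‖ * n₂ + τ * (nb + n₂)) := ⟨_, rfl⟩
  have hA0 : 0 ≤ A := by rw [hA]; positivity
  -- the condition `μ Z ≤ 1` makes the quadratic term and the Lipschitz constant small
  obtain ⟨D₀, hD₀⟩ : ∃ D₀, D₀ = k * K * A * (b + 1) := ⟨_, rfl⟩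
  have hD₀0 : 0 ≤ D₀ := by rw [hD₀]; positivity
  obtain ⟨Z, hZ⟩ : ∃ Z, Z = A + 4 * D₀ + 4 * (‖S‖ * L) + 1 := ⟨_, rfl⟩
  have hZ0 : 0 < Z := by rw [hZ]; positivity
  refine ⟨A, hA0, Z⁻¹, inv_pos.2 hZ0, fun μ hμ hμδ => ?_⟩
  have hμZ : μ * Z ≤ 1 := by
    calc μ * Z ≤ Z⁻¹ * Z := by gcongr
      _ = 1 := inv_mul_cancel₀ hZ0.ne'
  have p1 : 0 ≤ μ * A := by positivity
  have p2 : 0 ≤ μ * D₀ := by positivity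
  have p3 : 0 ≤ μ * (‖S‖ * L) := by positivity
  have hsum : μ * Z = μ * A + 4 * (μ * D₀) + 4 * (μ * (‖S‖ * L)) + μ := by rw [hZ]; ring
  obtain ⟨r, hr⟩ : ∃ r, r = A * μ := ⟨_, rfl⟩
  rw [← hr]
  have hr0 : 0 ≤ r := by rw [hr]; positivity
  have hr1 : r ≤ 1 := by rw [hr, mul_comm]; linarith
  refine ⟨hr1, ?_⟩
  have hinner : ∀ v : L2 d, |⟪ψ, v⟫_ℝ| ≤ ‖v‖ := fun v => by
    simpa [hψ] using abs_real_inner_le_norm ψ v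
  have hcoef : ∀ R : L2 d, ‖R‖ ≤ r → (∀ᵐ x, |R x| ≤ r) → |k * ⟪ψ, Q R⟫_ℝ| * (b + 1) ≤ r / 4 := by
    intro R hR hR'
    have h1 := hQ r hr1 R 0 hR' ((Lp.coeFn_zero ℝ 2 (volume : Measure (Space d))).mono
      fun x hx => by rw [hx]; simpa using hr0)
    rw [hQ0, sub_zero, sub_zero] at h1
    have h2 : ‖Q R‖ ≤ K * r * r := h1.trans (mul_le_mul_of_nonneg_left hR (by positivity))
    rw [abs_mul, abs_of_nonneg hk]
    calc k * |⟪ψ, Q R⟫_ℝ| * (b + 1) ≤ k * (K * r * r) * (b + 1) := by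
          gcongr; exact (hinner _).trans h2
      _ = (μ * D₀) * r := by rw [hD₀, hr]; ring
      _ ≤ r / 4 := by nlinarith
  have hNle : ∀ R : L2 d, ‖R‖ ≤ r → ‖N R‖ ≤ n₂ := by
    intro R hR
    have h1 := hN R 0
    rw [sub_zero] at h1
    have h2 : ‖N R‖ ≤ ‖N 0‖ + ‖N R - N 0‖ := by
      simpa using norm_add_le (N 0) (N R - N 0)
    have h3 : L * ‖R‖ ≤ L * 1 := mul_le_mul_of_nonneg_left (hR.trans hr1) hL
    rw [hn₂]; linarith
  refine exists_fixedPoint_of_lipschitz hr0 (fun R hR hR' => ?_) fun R R' hR hRb hR' hRb' => ?_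
  · have hc1 := hcoef R hR hR'
    generalize k * ⟪ψ, Q R⟫_ℝ = e at hc1 ⊢
    have hc2 : |e| ≤ r / 4 := by nlinarith [abs_nonneg e]
    have hc3 : |e| * b ≤ r / 4 := by nlinarith [abs_nonneg e]
    have q1 : 0 ≤ μ * (τ * (nb + n₂)) := by positivity
    have q2 : 0 ≤ μ * (‖S‖ * n₂) := by positivity
    have hrA : r = 2 * (μ * (‖S‖ * n₂)) + 2 * (μ * (τ * (nb + n₂))) := by rw [hr, hA]; ring
    constructor
    · refine (norm_smul_sub_smul_le hψ hμ.le _ _).trans ?_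
      have h1 : ‖S (N R)‖ ≤ ‖S‖ * n₂ := (S.le_opNorm _).trans
        (mul_le_mul_of_nonneg_left (hNle R hR) (norm_nonneg _))
      have h2 : μ * ‖S (N R)‖ ≤ μ * (‖S‖ * n₂) := mul_le_mul_of_nonneg_left h1 hμ.le
      linarith
    · have h1 := hSτ nb hnb (N R) (hNb R (hR'.mono fun x hx => hx.trans hr1))
      have h4 : τ * (nb + ‖N R‖) ≤ τ * (nb + n₂) :=
        mul_le_mul_of_nonneg_left (by linarith [hNle R hR]) hτ
      filter_upwards [h1, ae_abs_smul_sub_smul_le hb hμ.le (S (N R)) e] with x e1 e2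
      have h2 : μ * |S (N R) x| ≤ μ * (τ * (nb + n₂)) :=
        mul_le_mul_of_nonneg_left (e1.trans h4) hμ.le
      linarith
  · have e : μ • S (N R) - (k * ⟪ψ, Q R⟫_ℝ) • ψ - (μ • S (N R') - (k * ⟪ψ, Q R'⟫_ℝ) • ψ) =
        μ • S (N R - N R') - (k * ⟪ψ, Q R - Q R'⟫_ℝ) • ψ := by
      rw [map_sub, smul_sub, inner_sub_right, mul_sub, sub_smul]
      abel
    rw [e]
    refine (norm_smul_sub_smul_le hψ hμ.le _ _).trans ?_
    rw [abs_mul, abs_of_nonneg hk]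
    have h1 : ‖S (N R - N R')‖ ≤ ‖S‖ * (L * ‖R - R'‖) := (S.le_opNorm _).trans
      (mul_le_mul_of_nonneg_left (hN R R') (norm_nonneg _))
    have h2 : |⟪ψ, Q R - Q R'⟫_ℝ| ≤ K * r * ‖R - R'‖ :=
      (hinner _).trans (hQ r hr1 R R' hRb hRb')
    have h3 : k * (K * r) ≤ μ * D₀ := by
      have e3 : μ * D₀ = k * (K * r) * (b + 1) := by rw [hD₀, hr]; ring
      rw [e3]
      exact le_mul_of_one_le_right (by positivity) (by linarith)
    calc μ * ‖S (N R - N R')‖ + k * |⟪ψ, Q R - Q R'⟫_ℝ|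
        ≤ μ * (‖S‖ * (L * ‖R - R'‖)) + k * (K * r * ‖R - R'‖) := by gcongr
      _ = (μ * (‖S‖ * L) + k * (K * r)) * ‖R - R'‖ := by ring
      _ ≤ 1 / 2 * ‖R - R'‖ := mul_le_mul_of_nonneg_right (by linarith) (norm_nonneg _)

lemma ae_abs_add_smul_le {T S : L2 d →L[ℝ] L2 d} {ℓ : L2 d →L[ℝ] ℝ} {ψ : L2 d}
    (hS : ∀ g, S g = T g + ℓ (T g) • ψ) {τ b : ℝ} (hb0 : 0 ≤ b) (hb : ∀ᵐ x, |ψ x| ≤ b)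
    (hTτ : ∀ B : ℝ, 0 ≤ B → ∀ g : L2 d, (∀ᵐ x, |g x| ≤ B) → ∀ᵐ x, |T g x| ≤ τ * (B + ‖g‖))
    (B : ℝ) (hB : 0 ≤ B) (g : L2 d) (hg : ∀ᵐ x, |g x| ≤ B) :
    ∀ᵐ x, |S g x| ≤ (τ + ‖ℓ ∘L T‖ * b) * (B + ‖g‖) := by
  have h2 : |ℓ (T g)| ≤ ‖ℓ ∘L T‖ * ‖g‖ := (ℓ ∘L T).le_opNorm g
  filter_upwards [hTτ B hB g hg, hb, Lp.coeFn_add (T g) (ℓ (T g) • ψ),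
    Lp.coeFn_smul (ℓ (T g)) ψ] with x e1 e2 e3 e4
  rw [hS, e3, Pi.add_apply, e4, Pi.smul_apply, smul_eq_mul]
  refine (abs_add_le _ _).trans ?_
  rw [abs_mul]
  have h3 : |ℓ (T g)| * |ψ x| ≤ (‖ℓ ∘L T‖ * ‖g‖) * b := by gcongr
  have h4 : 0 ≤ ‖ℓ ∘L T‖ * b * B := by positivity
  nlinarith

/-- The quadratic remainder `f(ψ + R) - f(ψ) - f'(ψ) R` of the truncated nonlinearity. -/
def nlRem (σ β : ℝ) (hσ : 1 ≤ σ) (hβ : 0 ≤ β) (ψ : L2 d) (D : L2 d →L[ℝ] L2 d) (R : L2 d) : L2 d :=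
  nlL σ β hσ hβ (ψ + R) - nlL σ β hσ hβ ψ - D R

/-- The right-hand side `N(R) = f(ψ + R) / c - (ψ + R)` of the equation `(H - E₀) R = μ N(R)` for the
correction `R`, with the nonlinearity truncated at height `β`. -/
def rhs (σ β c : ℝ) (hσ : 1 ≤ σ) (hβ : 0 ≤ β) (ψ R : L2 d) : L2 d :=
  c⁻¹ • nlL σ β hσ hβ (ψ + R) - (ψ + R)

section FixedPoint

variable {σ b c : ℝ} (hσ : 1 ≤ σ) (hβ : 0 ≤ b + 1) {ψ : L2 d} {D T : L2 d →L[ℝ] L2 d}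

lemma norm_rhs_sub_le (hc : 0 < c) (R R' : L2 d) :
    ‖rhs σ (b + 1) c hσ hβ ψ R - rhs σ (b + 1) c hσ hβ ψ R'‖ ≤
      (c⁻¹ * nlDeriv σ (b + 1) + 1) * ‖R - R'‖ := by
  have h1 := norm_nlL_sub_le hσ hβ (ψ + R) (ψ + R')
  rw [add_sub_add_left_eq_sub] at h1
  have e : rhs σ (b + 1) c hσ hβ ψ R - rhs σ (b + 1) c hσ hβ ψ R' =
      c⁻¹ • (nlL σ (b + 1) hσ hβ (ψ + R) - nlL σ (b + 1) hσ hβ (ψ + R')) - (R - R') := by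
    rw [rhs, rhs, smul_sub]; abel
  rw [e]
  refine (norm_sub_le _ _).trans ?_
  rw [norm_smul, Real.norm_of_nonneg (inv_pos.2 hc).le, add_mul, one_mul, mul_assoc]
  gcongr

lemma ae_abs_rhs_le (hc : 0 < c) (hb : ∀ᵐ x, |ψ x| ≤ b) {R : L2 d} (hR : ∀ᵐ x, |R x| ≤ 1) :
    ∀ᵐ x, |rhs σ (b + 1) c hσ hβ ψ R x| ≤ (c⁻¹ * nlDeriv σ (b + 1) + 1) * (b + 1) := by
  filter_upwards [hb, hR, nlL_coeFn hσ hβ (ψ + R), Lp.coeFn_add ψ R,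
    Lp.coeFn_sub (c⁻¹ • nlL σ (b + 1) hσ hβ (ψ + R)) (ψ + R),
    Lp.coeFn_smul c⁻¹ (nlL σ (b + 1) hσ hβ (ψ + R))] with x h1 h2 h3 h4 h5 h6
  have h7 : |(ψ + R : L2 d) x| ≤ b + 1 := by
    rw [h4, Pi.add_apply]; exact (abs_add_le _ _).trans (add_le_add h1 h2)
  have h8 := abs_nl_sub_le hσ (abs_clamp_le hβ ((ψ + R : L2 d) x)) (t := 0) (by simpa using hβ)
  rw [nl_zero, sub_zero, sub_zero] at h8
  have h9 := h8.trans (mul_le_mul_of_nonneg_left (abs_clamp_le hβ _) (nlDeriv_nonneg hσ _))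
  rw [rhs, h5, Pi.sub_apply, h6, Pi.smul_apply, h3, smul_eq_mul]
  refine (abs_sub _ _).trans ?_
  rw [abs_mul, abs_of_pos (inv_pos.2 hc), add_mul, one_mul, mul_assoc]
  have := inv_pos.2 hc
  gcongr

lemma exists_norm_nlRem_sub_le (hb : ∀ᵐ x, |ψ x| ≤ b)
    (hD : ∀ R : L2 d, D R =ᵐ[volume] fun x => nlDeriv σ (ψ x) * R x) :
    ∃ K : ℝ, 0 ≤ K ∧ ∀ r ≤ (1 : ℝ), ∀ R R' : L2 d, (∀ᵐ x, |R x| ≤ r) → (∀ᵐ x, |R' x| ≤ r) →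
      ‖nlRem σ (b + 1) hσ hβ ψ D R - nlRem σ (b + 1) hσ hβ ψ D R'‖ ≤ K * r * ‖R - R'‖ := by
  obtain ⟨K, hK, h⟩ := exists_abs_nl_sub_sub_le hσ (b + 1)
  refine ⟨K, hK, fun r hr R R' hR hR' => ?_⟩
  have e : nlRem σ (b + 1) hσ hβ ψ D R - nlRem σ (b + 1) hσ hβ ψ D R' =
      nlL σ (b + 1) hσ hβ (ψ + R) - nlL σ (b + 1) hσ hβ (ψ + R') - D (R - R') := by
    rw [nlRem, nlRem, map_sub]; abel
  rw [e]
  refine Lp.norm_le_mul_norm_of_ae_le_mul ?_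
  filter_upwards [hb, hR, hR', nlL_coeFn hσ hβ (ψ + R), nlL_coeFn hσ hβ (ψ + R'),
    Lp.coeFn_add ψ R, Lp.coeFn_add ψ R', hD (R - R'), Lp.coeFn_sub R R',
    Lp.coeFn_sub (nlL σ (b + 1) hσ hβ (ψ + R) - nlL σ (b + 1) hσ hβ (ψ + R')) (D (R - R')),
    Lp.coeFn_sub (nlL σ (b + 1) hσ hβ (ψ + R)) (nlL σ (b + 1) hσ hβ (ψ + R'))]
    with x h1 h2 h3 h4 h5 h6 h7 h8 h9 h10 h11
  have e1 : |ψ x + R x| ≤ b + 1 := (abs_add_le _ _).trans (add_le_add h1 (h2.trans hr))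
  have e2 : |ψ x + R' x| ≤ b + 1 := (abs_add_le _ _).trans (add_le_add h1 (h3.trans hr))
  have := h (ψ x) (ψ x + R x) (ψ x + R' x) r (by linarith) e1 e2 (by simpa) (by simpa)
  rw [h10, Pi.sub_apply, h11, Pi.sub_apply, h4, h5, h8, h9, h6, h7, Pi.add_apply, Pi.add_apply,
    Pi.sub_apply, clamp_of_abs_le e1, clamp_of_abs_le e2, Real.norm_eq_abs, Real.norm_eq_abs]
  rwa [add_sub_add_left_eq_sub] at this

/-- At a fixed point of the Lyapunov–Schmidt map the right-hand side `N` is orthogonal to `ψ`: the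
choice of the coefficient `a` gives `⟨ψ, N⟩ = 2σμ ⟨ψ, N⟩`. -/
lemma inner_rhs_eq_zero (hc : 0 < c) (hψ : ‖ψ‖ = 1) (hTψ : ∀ g, ⟪ψ, T g⟫_ℝ = ⟪ψ, g⟫_ℝ)
    (hF : ⟪ψ, nlL σ (b + 1) hσ hβ ψ⟫_ℝ = c) (hDψ : ⟪ψ, D ψ⟫_ℝ = (2 * σ + 1) * c) {μ : ℝ}
    (hμ : 2 * σ * μ ≠ 1) {R : L2 d} {a : ℝ}
    (hR : R = μ • T (rhs σ (b + 1) c hσ hβ ψ R) + a • ψ)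
    (ha : 2 * σ * a = μ * (2 * σ * ⟪ψ, T (rhs σ (b + 1) c hσ hβ ψ R)⟫_ℝ -
      (c⁻¹ * ⟪ψ, D (T (rhs σ (b + 1) c hσ hβ ψ R))⟫_ℝ - ⟪ψ, T (rhs σ (b + 1) c hσ hβ ψ R)⟫_ℝ)) -
        c⁻¹ * ⟪ψ, nlRem σ (b + 1) hσ hβ ψ D R⟫_ℝ) :
    ⟪ψ, rhs σ (b + 1) c hσ hβ ψ R⟫_ℝ = 0 := by
  set N := rhs σ (b + 1) c hσ hβ ψ R with hN
  have h1 : N = c⁻¹ • (nlRem σ (b + 1) hσ hβ ψ D R + nlL σ (b + 1) hσ hβ ψ + D R) - (ψ + R) := by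
    rw [hN, rhs, nlRem]; congr 2; abel
  have h2 : ⟪ψ, N⟫_ℝ = c⁻¹ * (⟪ψ, nlRem σ (b + 1) hσ hβ ψ D R⟫_ℝ + c + ⟪ψ, D R⟫_ℝ) -
      (1 + ⟪ψ, R⟫_ℝ) := by
    conv_lhs => rw [h1]
    rw [inner_sub_right, inner_smul_right, inner_add_right, inner_add_right, inner_add_right, hF,
      real_inner_self_eq_norm_sq, hψ, one_pow]
  have h3 : ⟪ψ, D R⟫_ℝ = μ * ⟪ψ, D (T N)⟫_ℝ + a * ((2 * σ + 1) * c) := by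
    conv_lhs => rw [hR]
    rw [map_add, map_smul, map_smul, inner_add_right, inner_smul_right, inner_smul_right, hDψ]
  have h4 : ⟪ψ, R⟫_ℝ = μ * ⟪ψ, T N⟫_ℝ + a := by
    conv_lhs => rw [hR]
    rw [inner_add_right, inner_smul_right, inner_smul_right, real_inner_self_eq_norm_sq, hψ]
    ring
  have hcc : c⁻¹ * c = 1 := inv_mul_cancel₀ hc.ne'
  have h5 : ⟪ψ, N⟫_ℝ = 2 * σ * μ * ⟪ψ, N⟫_ℝ := by
    rw [← hTψ N]
    rw [← hTψ N] at h2
    rw [h3, h4] at h2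
    linear_combination h2 + ha + (1 + a * (2 * σ + 1)) * hcc
  have h6 : (1 - 2 * σ * μ) * ⟪ψ, N⟫_ℝ = 0 := by linear_combination h5
  exact (mul_eq_zero.1 h6).resolve_left (sub_ne_zero.2 (Ne.symm hμ))

/-- Existence of the correction `R` for every small `μ`. Here `T` is the inverse of
`H - E₀ + ⟨ψ, ·⟩ ψ`, and `D` is multiplication by `f'(ψ)`. -/
theorem exists_correction {τ : ℝ} (hc : 0 < c) (hb0 : 0 ≤ b) (hb : ∀ᵐ x, |ψ x| ≤ b)
    (hψ : ‖ψ‖ = 1) (hτ : 0 ≤ τ)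
    (hTτ : ∀ B : ℝ, 0 ≤ B → ∀ g : L2 d, (∀ᵐ x, |g x| ≤ B) → ∀ᵐ x, |T g x| ≤ τ * (B + ‖g‖))
    (hTψ : ∀ g, ⟪ψ, T g⟫_ℝ = ⟪ψ, g⟫_ℝ)
    (hD : ∀ R : L2 d, D R =ᵐ[volume] fun x => nlDeriv σ (ψ x) * R x)
    (hF : ⟪ψ, nlL σ (b + 1) hσ hβ ψ⟫_ℝ = c) (hDψ : ⟪ψ, D ψ⟫_ℝ = (2 * σ + 1) * c) :
    ∃ A : ℝ, 0 ≤ A ∧ ∃ δ : ℝ, 0 < δ ∧ ∀ μ : ℝ, 0 < μ → μ ≤ δ → A * μ ≤ 1 ∧ ∃ R : L2 d,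
      ‖R‖ ≤ A * μ ∧ (∀ᵐ x, |R x| ≤ A * μ) ∧ ⟪ψ, rhs σ (b + 1) c hσ hβ ψ R⟫_ℝ = 0 ∧
        ∃ a : ℝ, R = μ • T (rhs σ (b + 1) c hσ hβ ψ R) + a • ψ := by
  obtain ⟨K, hK, hQ⟩ := exists_norm_nlRem_sub_le hσ hβ hb hD
  have hκ0 : 0 < (2 * σ)⁻¹ := by positivity
  have hσκ : 2 * σ * (2 * σ)⁻¹ = 1 := mul_inv_cancel₀ (by positivity)
  generalize (2 * σ)⁻¹ = κ at hκ0 hσκ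
  have hcinv : 0 < c⁻¹ := inv_pos.2 hc
  -- the component of the fixed point along `ψ` is chosen so that the linear part of `⟨ψ, N(R)⟩`,
  -- which is `2σ` at `ψ`, cancels the contribution of `T N(R)` up to a multiple of `⟨ψ, N(R)⟩`
  obtain ⟨ℓ, hℓ⟩ : ∃ ℓ : L2 d →L[ℝ] ℝ, ∀ v, ℓ v = ⟪ψ, v⟫_ℝ - κ * (c⁻¹ * ⟪ψ, D v⟫_ℝ - ⟪ψ, v⟫_ℝ) :=
    ⟨innerSL ℝ ψ - κ • ((innerSL ℝ ψ) ∘L (c⁻¹ • D) - innerSL ℝ ψ), fun v => by simp⟩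
  obtain ⟨S, hS⟩ : ∃ S : L2 d →L[ℝ] L2 d, ∀ g, S g = T g + ℓ (T g) • ψ :=
    ⟨T + (ContinuousLinearMap.toSpanSingleton ℝ ψ) ∘L (ℓ ∘L T), fun g => by simp⟩
  obtain ⟨A, hA, δ, hδ, h⟩ := exists_fixedPoint_of_small (N := rhs σ (b + 1) c hσ hβ ψ)
    (Q := nlRem σ (b + 1) hσ hβ ψ D) (k := κ * c⁻¹) (ψ := ψ) (S := S)
    (by have := nlDeriv_nonneg hσ (b + 1); positivity) (by positivity) hK
    (by have := nlDeriv_nonneg hσ (b + 1); positivity) hb0 hψ hb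
    (norm_rhs_sub_le hσ hβ hc) (fun R hR => ae_abs_rhs_le hσ hβ hc hb hR) (by simp [nlRem]) hQ
    (by positivity : 0 ≤ τ + ‖ℓ ∘L T‖ * b) (ae_abs_add_smul_le hS hb0 hb hTτ)
  refine ⟨A, hA, min δ (4 * σ)⁻¹, lt_min hδ (by positivity), fun μ hμ hμδ => ?_⟩
  obtain ⟨h1, R, h2, h3, h4⟩ := h μ hμ (hμδ.trans (min_le_left _ _))
  have hμσ : 2 * σ * μ ≠ 1 := by
    have h5 : μ * (4 * σ) ≤ (4 * σ)⁻¹ * (4 * σ) := by gcongr; exact hμδ.trans (min_le_right _ _)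
    rw [inv_mul_cancel₀ (by positivity)] at h5
    linarith
  have hRe : R = μ • T (rhs σ (b + 1) c hσ hβ ψ R) + (μ * ℓ (T (rhs σ (b + 1) c hσ hβ ψ R)) -
      κ * c⁻¹ * ⟪ψ, nlRem σ (b + 1) hσ hβ ψ D R⟫_ℝ) • ψ := by
    refine h4.trans ?_
    rw [hS, smul_add, sub_smul, smul_smul]
    abel
  refine ⟨h1, R, h2, h3, ?_, _, hRe⟩
  refine inner_rhs_eq_zero hσ hβ hc hψ hTψ hF hDψ hμσ hRe ?_
  rw [hℓ]
  linear_combination (-(μ * (c⁻¹ * ⟪ψ, D (T (rhs σ (b + 1) c hσ hβ ψ R))⟫_ℝ -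
    ⟪ψ, T (rhs σ (b + 1) c hσ hβ ψ R)⟫_ℝ)) -
      c⁻¹ * ⟪ψ, nlRem σ (b + 1) hσ hβ ψ D R⟫_ℝ) * hσκ

end FixedPoint

/-! ### The bifurcating branch -/

lemma IsWeakSol.add {V : Space d →ᵇ ℝ} {p q : L2 d × (Fin d → L2 d)} {f g : L2 d}
    (hp : IsWeakSol V p f) (hq : IsWeakSol V q g) : IsWeakSol V (p + q) (f + g) := by
  refine ⟨(sobolevGraph d).add_mem hp.1 hq.1, fun r hr => ?_⟩
  have h1 := hp.2 r hr
  have h2 := hq.2 r hr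
  simp only [Prod.fst_add, Prod.snd_add, Pi.add_apply, inner_add_left, map_add,
    Finset.sum_add_distrib]
  linarith

lemma IsWeakSol.smul {V : Space d →ᵇ ℝ} {p : L2 d × (Fin d → L2 d)} {f : L2 d}
    (hp : IsWeakSol V p f) (t : ℝ) : IsWeakSol V (t • p) (t • f) := by
  refine ⟨(sobolevGraph d).smul_mem t hp.1, fun r hr => ?_⟩
  have h1 := hp.2 r hr
  simp only [Prod.smul_fst, Prod.smul_snd, Pi.smul_apply, inner_smul_left, map_smul, conj_trivial,
    ← Finset.mul_sum]
  rw [← h1]; ring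

lemma forall_abs_le_of_ae {u : Space d → ℝ} (hu : Continuous u) {b : ℝ} (h : ∀ᵐ x, |u x| ≤ b)
    (x : Space d) : |u x| ≤ b := by
  have h1 : (fun x => min |u x| b) = fun x => |u x| :=
    (Continuous.ae_eq_iff_eq volume (by fun_prop) (by fun_prop)).1
      (h.mono fun x hx => min_eq_left hx)
  have h2 : min |u x| b = |u x| := congrFun h1 x
  rw [← h2]
  exact min_le_right _ _

/-- A ground state in the `L²` setting: `ψ = ψ₀` almost everywhere, `p = (ψ, ∇ψ)` solves the
eigenvalue equation, and `ψ₀ ≤ b`. -/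
structure IsGround (V : Space d →ᵇ ℝ) (ψ₀ : Space d → ℝ) (b : ℝ) (p : L2 d × (Fin d → L2 d)) :
    Prop where
  continuous : Continuous ψ₀
  pos : ∀ x, 0 < ψ₀ x
  le : ∀ x, ψ₀ x ≤ b
  ae_eq : ψ₀ =ᵐ[volume] p.1
  weak : IsWeakSol V p (groundStateEnergy V • p.1)
  norm_eq : ‖p.1‖ = 1

section Branch

variable {V : Space d →ᵇ ℝ} {ψ₀ : Space d → ℝ} {b : ℝ} {p : L2 d × (Fin d → L2 d)}

lemma IsGroundState.exists_isGround (hE : groundStateEnergy V < 0) (h : IsGroundState V ψ₀) :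
    ∃ b p, IsGround V ψ₀ b p := by
  obtain ⟨p, hp, hae⟩ := exists_sobolevGraph_of_memH1 h.memH1
  have hw : IsWeakSol V p (groundStateEnergy V • p.1) := by
    refine isWeakSol_of_schrodingerEq hp hae ?_ h.eigen
    filter_upwards [hae, Lp.coeFn_smul (groundStateEnergy V) p.1] with x h1 h2
    rw [h2, Pi.smul_apply, ← h1, smul_eq_mul]
  obtain ⟨b, hb⟩ := eigenfunction_ae_bound hE hw
  refine ⟨b, p, h.continuous, h.pos, fun x => (le_abs_self _).trans
    (forall_abs_le_of_ae h.continuous (b := b) ?_ x), hae, hw, ?_⟩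
  · filter_upwards [hb, hae] with x h1 h2
    rwa [h2]
  · have h1 : ‖p.1‖ ^ 2 = 1 := by
      rw [L2.norm_sq_eq, ← h.normalized]
      exact integral_congr_ae (hae.mono fun x hx => by dsimp only; rw [hx])
    nlinarith [norm_nonneg p.1]

lemma IsGround.ae_pos (h : IsGround V ψ₀ b p) : ∀ᵐ x, 0 < p.1 x :=
  h.ae_eq.mono fun x hx => hx ▸ h.pos x

lemma IsGround.bound_pos (h : IsGround V ψ₀ b p) : 0 < b := (h.pos 0).trans_le (h.le 0)

lemma IsGround.ae_abs_le (h : IsGround V ψ₀ b p) : ∀ᵐ x, |p.1 x| ≤ b :=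
  h.ae_eq.mono fun x hx => by rw [← hx, abs_of_pos (h.pos x)]; exact h.le x

/-- `H - E₀ + ⟨ψ, ·⟩ ψ` is invertible on `L²`, because `E₀` is simple, and its inverse maps bounded
functions to bounded functions. -/
lemma IsGround.exists_inverse (h : IsGround V ψ₀ b p) (hV : MemLp V 2 volume)
    (hE : groundStateEnergy V < 0) : ∃ T : L2 d →L[ℝ] L2 d,
    (∀ g, ∃ G, IsWeakSol V (T g, G) (g - ⟪p.1, T g⟫_ℝ • p.1 + groundStateEnergy V • T g)) ∧
    (∀ g, ⟪p.1, T g⟫_ℝ = ⟪p.1, g⟫_ℝ) ∧ ∃ τ : ℝ, 0 ≤ τ ∧ ∀ B : ℝ, 0 ≤ B → ∀ g : L2 d,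
      (∀ᵐ x, |g x| ≤ B) → ∀ᵐ x, |T g x| ≤ τ * (B + ‖g‖) := by
  have key : ∀ (q : L2 d × (Fin d → L2 d)) (g : L2 d),
      IsWeakSol V q (g - ⟪p.1, q.1⟫_ℝ • p.1 + groundStateEnergy V • q.1) →
        ⟪p.1, q.1⟫_ℝ = ⟪p.1, g⟫_ℝ := by
    intro q g hq
    have h1 := hq.shiftForm_eq h.weak.1
    rw [shiftForm_comm, h.weak.shiftForm_eq_zero hq.1, inner_sub_left, inner_smul_left,
      real_inner_self_eq_norm_sq, h.norm_eq, real_inner_comm] at h1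
    simp only [conj_trivial] at h1
    linarith
  obtain ⟨T, hT⟩ := NLSBif.exists_inverse hV hE p.1 (fun q hq => by
    have h1 := key q 0 (by rwa [zero_sub, neg_add_eq_sub])
    rw [inner_zero_right] at h1
    rw [h1, zero_smul, sub_zero] at hq
    exact eigenfunction_eq_zero hE h.ae_pos hq h1)
  refine ⟨T, hT, fun g => ?_, ?_⟩
  · obtain ⟨G, hG⟩ := hT g
    exact key _ g hG
  · have hM := massConst_pos hE
    obtain ⟨τ, hτ, hbd⟩ := exists_ae_bound_of_eq_yukL (d := d) hM (posPot V)
    have hb0 := h.bound_pos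
    refine ⟨2 * ((1 + ‖T‖ * b) / massConst V) + τ * ‖T‖, by positivity, fun B hB g hg => ?_⟩
    obtain ⟨G, hG⟩ := hT g
    have hTg : ‖T g‖ ≤ ‖T‖ * ‖g‖ := T.le_opNorm g
    have hin : |⟪p.1, T g⟫_ℝ| ≤ ‖T‖ * ‖g‖ := by
      refine (abs_real_inner_le_norm _ _).trans ?_
      rwa [h.norm_eq, one_mul]
    have hB' : ∀ᵐ x, |(g - ⟪p.1, T g⟫_ℝ • p.1 : L2 d) x| ≤ B + ‖T‖ * ‖g‖ * b := by
      filter_upwards [hg, h.ae_abs_le, Lp.coeFn_sub g (⟪p.1, T g⟫_ℝ • p.1),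
        Lp.coeFn_smul ⟪p.1, T g⟫_ℝ p.1] with x e1 e2 e3 e4
      rw [e3, Pi.sub_apply, e4, Pi.smul_apply, smul_eq_mul]
      refine (abs_sub _ _).trans ?_
      rw [abs_mul]
      gcongr
    filter_upwards [hbd _ (by positivity) _ _ hB' (hG.eq_yukL_posPot hM)] with x hx
    refine hx.trans ?_
    have e1 : 2 * ((1 + ‖T‖ * b) / massConst V) * (B + ‖g‖) =
        2 * ((B + ‖T‖ * ‖g‖ * b) / massConst V) +
          2 * ((‖g‖ + ‖T‖ * b * B) / massConst V) := by ring
    have e2 : 0 ≤ 2 * ((‖g‖ + ‖T‖ * b * B) / massConst V) := by positivity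
    have e3 : τ * ‖T g‖ ≤ τ * (‖T‖ * ‖g‖) := by gcongr
    have e4 : 0 ≤ τ * ‖T‖ * B := by positivity
    nlinarith

section Moments

variable {σ : ℝ}

lemma rpow_two_mul_add_two {s : ℝ} (hs : 0 < s) : s ^ (2 * σ + 2) = s * nl σ s := by
  rw [nl, abs_of_pos hs, Real.rpow_add hs, Real.rpow_two]; ring

lemma IsGround.ae_nl_eq (h : IsGround V ψ₀ b p) (hσ : 1 ≤ σ) (hβ : 0 ≤ b + 1) :
    ∀ᵐ x, nlL σ (b + 1) hσ hβ p.1 x = nl σ (ψ₀ x) := by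
  filter_upwards [nlL_coeFn hσ hβ p.1, h.ae_eq, h.ae_abs_le] with x e1 e2 e3
  rw [e1, clamp_of_abs_le (by linarith), e2]

lemma IsGround.integrable_rpow (h : IsGround V ψ₀ b p) (hσ : 1 ≤ σ) :
    Integrable (fun x => ψ₀ x ^ (2 * σ + 2)) := by
  have hβ : 0 ≤ b + 1 := by linarith [h.bound_pos]
  refine (L2.integrable_mul p.1 (nlL σ (b + 1) hσ hβ p.1)).congr ?_
  filter_upwards [h.ae_nl_eq hσ hβ, h.ae_eq] with x e1 e2
  rw [e1, ← e2, rpow_two_mul_add_two (h.pos x)]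

lemma IsGround.inner_nl (h : IsGround V ψ₀ b p) (hσ : 1 ≤ σ) (hβ : 0 ≤ b + 1) :
    ⟪p.1, nlL σ (b + 1) hσ hβ p.1⟫_ℝ = ∫ x, ψ₀ x ^ (2 * σ + 2) := by
  rw [L2.inner_eq]
  refine integral_congr_ae ?_
  filter_upwards [h.ae_nl_eq hσ hβ, h.ae_eq] with x e1 e2
  rw [e1, ← e2, rpow_two_mul_add_two (h.pos x)]

lemma IsGround.integral_rpow_pos (h : IsGround V ψ₀ b p) (hσ : 1 ≤ σ) :
    0 < ∫ x, ψ₀ x ^ (2 * σ + 2) := by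
  rw [integral_pos_iff_support_of_nonneg (fun x => Real.rpow_nonneg (h.pos x).le _)
    (h.integrable_rpow hσ)]
  have : Function.support (fun x => ψ₀ x ^ (2 * σ + 2)) = Set.univ :=
    Set.eq_univ_of_forall fun x => (Real.rpow_pos_of_pos (h.pos x) _).ne'
  rw [this]
  exact Measure.measure_univ_pos.2 (NeZero.ne _)

/-- The part of `ψ₀` below a small height has small mass. -/
lemma IsGround.exists_small (h : IsGround V ψ₀ b p) {ε : ℝ} (hε : 0 < ε) :
    ∃ t : ℝ, 0 < t ∧ ∫ x, {x | ψ₀ x ≤ t}.indicator (fun x => ψ₀ x ^ 2) x ≤ ε := by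
  have hI : Integrable fun x => ψ₀ x ^ 2 :=
    (Lp.memLp p.1).integrable_sq.congr (h.ae_eq.mono fun x hx => by dsimp only; rw [hx])
  have hlim : Tendsto (fun t : ℝ => ∫ x, {x | ψ₀ x ≤ t}.indicator (fun x => ψ₀ x ^ 2) x) (𝓝[>] 0)
      (𝓝 (∫ _ : Space d, (0 : ℝ))) := by
    refine tendsto_integral_filter_of_dominated_convergence (fun x => ψ₀ x ^ 2)
      (Eventually.of_forall fun t => ?_) (Eventually.of_forall fun t => ae_of_all _ fun x => ?_) hI
      (ae_of_all _ fun x => ?_)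
    · exact (hI.indicator (measurableSet_le h.continuous.measurable measurable_const)).1
    · rw [Real.norm_of_nonneg (Set.indicator_nonneg (fun _ _ => sq_nonneg _) _)]
      exact Set.indicator_le_self' (fun _ _ => sq_nonneg _) x
    · refine tendsto_const_nhds.congr' ?_
      filter_upwards [Ioo_mem_nhdsGT (h.pos x)] with t ht
      rw [Set.indicator_of_notMem]
      simpa using ht.2
  rw [integral_zero] at hlim
  obtain ⟨t, h1, h2⟩ := ((hlim.eventually (ge_mem_nhds hε)).and self_mem_nhdsWithin).exists
  exact ⟨t, h2, h1⟩

end Moments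

/-- The correction `R` with its gradient and its equation `(H - E₀) R = μ N(R)`. -/
theorem IsGround.exists_branch (h : IsGround V ψ₀ b p) {σ : ℝ} (hσ : 1 ≤ σ) (hβ : 0 ≤ b + 1)
    {T : L2 d →L[ℝ] L2 d}
    (hT : ∀ g, ∃ G, IsWeakSol V (T g, G) (g - ⟪p.1, T g⟫_ℝ • p.1 + groundStateEnergy V • T g))
    (hTψ : ∀ g, ⟪p.1, T g⟫_ℝ = ⟪p.1, g⟫_ℝ) {τ : ℝ} (hτ : 0 ≤ τ)
    (hTτ : ∀ B : ℝ, 0 ≤ B → ∀ g : L2 d, (∀ᵐ x, |g x| ≤ B) → ∀ᵐ x, |T g x| ≤ τ * (B + ‖g‖)) :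
    ∃ A : ℝ, 0 ≤ A ∧ ∃ δ : ℝ, 0 < δ ∧ ∀ μ : ℝ, 0 < μ → μ ≤ δ → A * μ ≤ 1 ∧
      ∃ (R : L2 d) (G : Fin d → L2 d), ‖R‖ ≤ A * μ ∧ (∀ᵐ x, |R x| ≤ A * μ) ∧
        IsWeakSol V (R, G)
          (μ • rhs σ (b + 1) (∫ x, ψ₀ x ^ (2 * σ + 2)) hσ hβ p.1 R + groundStateEnergy V • R) := by
  have hcont : Continuous fun x => nlDeriv σ (ψ₀ x) := (continuous_nlDeriv hσ).comp h.continuous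
  let W : Space d →ᵇ ℝ := BoundedContinuousFunction.ofNormedAddCommGroup _ hcont (nlDeriv σ b)
    fun x => by
      rw [Real.norm_of_nonneg (nlDeriv_nonneg hσ _)]
      exact nlDeriv_le hσ (by rw [abs_of_pos (h.pos x)]; exact h.le x)
  have hD : ∀ R : L2 d, mulL W R =ᵐ[volume] fun x => nlDeriv σ (p.1 x) * R x := fun R => by
    filter_upwards [mulL_coeFn W R, h.ae_eq] with x e1 e2
    rw [e1, ← e2]; rfl
  have hDψ : ⟪p.1, mulL W p.1⟫_ℝ = (2 * σ + 1) * ∫ x, ψ₀ x ^ (2 * σ + 2) := by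
    rw [L2.inner_eq, ← integral_const_mul]
    refine integral_congr_ae ?_
    filter_upwards [hD p.1, h.ae_eq] with x e1 e2
    rw [e1, ← e2, rpow_two_mul_add_two (h.pos x), nlDeriv, nl]; ring
  obtain ⟨A, hA, δ, hδ, hR⟩ := exists_correction hσ hβ (h.integral_rpow_pos hσ) h.bound_pos.le
    h.ae_abs_le h.norm_eq hτ hTτ hTψ hD (h.inner_nl hσ hβ) hDψ
  refine ⟨A, hA, δ, hδ, fun μ hμ hμδ => ?_⟩
  obtain ⟨h1, R, h2, h3, h4, a, h5⟩ := hR μ hμ hμδ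
  obtain ⟨G, hG⟩ := hT (rhs σ (b + 1) (∫ x, ψ₀ x ^ (2 * σ + 2)) hσ hβ p.1 R)
  rw [hTψ, h4, zero_smul, sub_zero] at hG
  have hsum := (hG.smul μ).add (h.weak.smul a)
  refine ⟨h1, R, (μ • G + a • p.2), h2, h3, ?_⟩
  generalize rhs σ (b + 1) (∫ x, ψ₀ x ^ (2 * σ + 2)) hσ hβ p.1 R = N at *
  have e1 : μ • (T N, G) + a • p = (R, μ • G + a • p.2) := by
    refine Prod.ext ?_ rfl
    exact h5.symm
  have e2 : μ • (N + groundStateEnergy V • T N) + a • groundStateEnergy V • p.1 =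
      μ • N + groundStateEnergy V • R := by
    conv_rhs => rw [h5]
    simp only [smul_add, smul_smul, mul_comm]
    abel
  rw [← e1, ← e2]
  exact hsum

/-- Energy estimate for the gradient of a weak solution. -/
lemma IsWeakSol.norm_sq_add_le {q : L2 d × (Fin d → L2 d)} {f : L2 d} (hq : IsWeakSol V q f) :
    ‖q.1‖ ^ 2 + ∑ i, ‖q.2 i‖ ^ 2 ≤ (1 + ‖V‖) * ‖q.1‖ ^ 2 + ‖f‖ * ‖q.1‖ := by
  have h1 := hq.2 q hq.1
  simp only [real_inner_self_eq_norm_sq] at h1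
  have h2 := neg_le_of_abs_le (abs_inner_mulL_le V q.1 q.1)
  have h3 := real_inner_le_norm f q.1
  nlinarith

/-- Functions dominated by the inverse of a perturbed operator: the estimate that excludes a
negative part. If `n = u⁻`, then `q = (-Δ + M)⁻¹ (W n) ≥ n` almost minimizes the form, and it is
almost orthogonal to `ψ` because `n` lives where `ψ` is small. -/
theorem IsGround.eq_zero_of_le (h : IsGround V ψ₀ b p) (hE : groundStateEnergy V < 0)
    {T : L2 d →L[ℝ] L2 d}
    (hT : ∀ g, ∃ G, IsWeakSol V (T g, G) (g - ⟪p.1, T g⟫_ℝ • p.1 + groundStateEnergy V • T g))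
    {W : Space d →ᵇ ℝ} (hW : ∀ x, 0 ≤ W x) {s ε t : ℝ} (hs : ‖W - posPot V‖ ≤ s) (hε : 0 ≤ ε)
    (ht : ∫ x, {x | ψ₀ x ≤ t}.indicator (fun x => ψ₀ x ^ 2) x ≤ ε ^ 2)
    (hsmall : (‖T‖ + 1) * (s + (‖W‖ * ε) ^ 2) < 1) {n : L2 d} (hn0 : 0 ≤ n)
    (hn : n ≤ yukL _ (massConst_pos hE) (mulL W n)) (hnt : ∀ᵐ x, t < ψ₀ x → n x = 0) :
    n = 0 := by
  have hM := massConst_pos hE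
  obtain ⟨G, hG, hform⟩ := exists_shiftForm_yukL hM (mulL W n)
  have h1 := hform _ hG
  have hψ := eigenfunction_eq_yukL hM h.weak
  have hψ0 : 0 ≤ p.1 := (Lp.coeFn_nonneg _).1 (h.ae_pos.mono fun x hx => hx.le)
  have hsym := inner_yukL_comm hM (mulL (posPot V) p.1) (mulL W n)
  rw [← hψ] at hsym
  have hgap := norm_sq_le_of_inverse p.1 hT hG
  have hn' : n ≤ yukL (massConst V) hM (mulL W n) := hn
  dsimp only at h1 hgap
  generalize yukL (massConst V) hM (mulL W n) = q at *
  have hq0 : 0 ≤ q := hn0.trans hn'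
  have hnq : ‖n‖ ≤ ‖q‖ := norm_le_norm_of_abs_le_abs (by rwa [abs_of_nonneg hn0, abs_of_nonneg hq0])
  -- the form of `H - E₀` at `q`
  have h2 : shiftForm V (q, G) (q, G) ≤ s * ‖q‖ ^ 2 := by
    rw [h1]
    have e1 : ⟪mulL W n - mulL (posPot V) q, q⟫_ℝ ≤ ⟪mulL W q - mulL (posPot V) q, q⟫_ℝ := by
      rw [inner_sub_left, inner_sub_left]
      have := L2.inner_nonneg (mulL_nonneg hW (sub_nonneg.2 hn')) hq0
      rw [map_sub, inner_sub_left] at this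
      linarith
    refine e1.trans ?_
    rw [← mulL_sub]
    refine ((le_abs_self _).trans (abs_inner_mulL_le _ q q)).trans ?_
    rw [mul_assoc, ← pow_two]
    gcongr
  -- the overlap of `q` with the ground state
  have h3 : ⟪p.1, q⟫_ℝ ≤ ⟪p.1, mulL W n⟫_ℝ := by
    rw [hsym, ← sub_nonneg, ← inner_sub_left]
    refine L2.inner_nonneg ?_ hq0
    rw [sub_nonneg, ← Lp.coeFn_le]
    filter_upwards [mulL_coeFn (posPot V) p.1, h.ae_pos] with x e1 e2
    rw [e1]
    exact le_mul_of_one_le_left e2.le (one_le_posPot x)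
  have hI : Integrable fun x => {x | ψ₀ x ≤ t}.indicator (fun x => ψ₀ x ^ 2) x :=
    Integrable.indicator ((Lp.memLp p.1).integrable_sq.congr
      (h.ae_eq.mono fun x hx => by dsimp only; rw [hx]))
      (measurableSet_le h.continuous.measurable measurable_const)
  have hmem : MemLp (fun x => {x | ψ₀ x ≤ t}.indicator ψ₀ x) 2 volume :=
    ((Lp.memLp p.1).ae_eq h.ae_eq.symm).indicator
      (measurableSet_le h.continuous.measurable measurable_const)
  have hnorm : ‖hmem.toLp‖ ≤ ε := by
    refine le_of_sq_le_sq ?_ hε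
    rw [L2.norm_toLp_sq]
    refine le_trans (le_of_eq ?_) ht
    congr 1
    funext x
    by_cases hx : x ∈ {x | ψ₀ x ≤ t}
    · rw [Set.indicator_of_mem hx, Set.indicator_of_mem hx]
    · rw [Set.indicator_of_notMem hx, Set.indicator_of_notMem hx]; norm_num
  have h4 : ⟪p.1, mulL W n⟫_ℝ = ⟪hmem.toLp, mulL W n⟫_ℝ := by
    rw [L2.inner_eq, L2.inner_toLp]
    refine integral_congr_ae ?_
    filter_upwards [h.ae_eq, mulL_coeFn W n, hnt] with x e1 e2 e3
    rw [e2, ← e1]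
    by_cases hx : ψ₀ x ≤ t
    · rw [Set.indicator_of_mem (by exact hx)]
    · rw [e3 (not_le.1 hx)]; simp
  have h5 : ⟪p.1, q⟫_ℝ ≤ ‖W‖ * ε * ‖q‖ := by
    rw [h4] at h3
    refine h3.trans ((real_inner_le_norm _ _).trans ?_)
    calc ‖hmem.toLp‖ * ‖mulL W n‖ ≤ ε * (‖W‖ * ‖q‖) := by
          gcongr
          exact ((mulL W).le_of_opNorm_le (norm_mulL_le W) n).trans (by gcongr)
      _ = ‖W‖ * ε * ‖q‖ := by ring
  have h6 : ⟪p.1, q⟫_ℝ ^ 2 ≤ (‖W‖ * ε * ‖q‖) ^ 2 :=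
    pow_le_pow_left₀ (L2.inner_nonneg hψ0 hq0) h5 2
  have h7 : ‖q‖ ^ 2 ≤ (‖T‖ + 1) * (s + (‖W‖ * ε) ^ 2) * ‖q‖ ^ 2 := by
    refine hgap.trans ?_
    rw [mul_assoc]
    refine mul_le_mul_of_nonneg_left ?_ (by positivity)
    rw [mul_pow (‖W‖ * ε)] at h6
    linarith
  have h8 : ‖q‖ ^ 2 ≤ 0 := by nlinarith [sq_nonneg ‖q‖]
  have h9 : ‖q‖ = 0 := pow_eq_zero_iff two_ne_zero |>.1 (le_antisymm h8 (sq_nonneg _))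
  exact norm_le_zero_iff.1 (h9 ▸ hnq)

end Branch

/-! ### Positivity of the branch -/

/-- The negative part `u⁻ = (|u| - u) / 2` of a solution of `u = (-Δ + m)⁻¹ (W u)` with `W ≥ 0` is a
subsolution. -/
lemma negPart_le_yukL {m : ℝ} (hm : 0 < m) {W : Space d →ᵇ ℝ} (hW : ∀ x, 0 ≤ W x) {u : L2 d}
    (hu : u = yukL m hm (mulL W u)) :
    0 ≤ (1 / 2 : ℝ) • (|u| - u) ∧
      (1 / 2 : ℝ) • (|u| - u) ≤ yukL m hm (mulL W ((1 / 2 : ℝ) • (|u| - u))) := by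
  have h1 : |u| ≤ yukL m hm (mulL W |u|) := by
    rw [← abs_mulL hW]
    conv_lhs => rw [hu]
    exact abs_yukL_le hm _
  have h2 : 0 ≤ |u| - u := sub_nonneg.2 (le_abs_self u)
  constructor
  · rw [← Lp.coeFn_nonneg] at h2 ⊢
    filter_upwards [h2, Lp.coeFn_smul (1 / 2 : ℝ) (|u| - u)] with x e1 e2
    rw [e2, Pi.smul_apply, smul_eq_mul]
    exact mul_nonneg (by norm_num) e1
  · have h3 : |u| - u ≤ yukL m hm (mulL W (|u| - u)) := by
      rw [map_sub, map_sub, ← hu]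
      exact sub_le_sub_right h1 u
    rw [map_smul, map_smul]
    rw [← Lp.coeFn_le] at h3 ⊢
    filter_upwards [h3, Lp.coeFn_smul (1 / 2 : ℝ) (|u| - u),
      Lp.coeFn_smul (1 / 2 : ℝ) (yukL m hm (mulL W (|u| - u)))] with x e1 e2 e3
    rw [e2, e3, Pi.smul_apply, Pi.smul_apply, smul_eq_mul, smul_eq_mul]
    exact mul_le_mul_of_nonneg_left e1 (by norm_num)

lemma nonneg_of_negPart_eq_zero {u : L2 d} (h : (1 / 2 : ℝ) • (|u| - u) = 0) : 0 ≤ u := by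
  rw [smul_eq_zero] at h
  have h1 := sub_eq_zero.1 (h.resolve_left (by norm_num))
  rw [← h1]
  exact abs_nonneg u

/-- The potential `M + E - V + (μ/c) |u|^{2σ}` of the linear equation satisfied by a solution `u` of
the nonlinear one, where `E = E₀ - μ`. -/
lemma exists_nlPot (V : Space d →ᵇ ℝ) {σ c μ β : ℝ} (hσ : 1 ≤ σ) (hc : 0 < c) (hμ : 0 < μ)
    (hμ1 : μ ≤ 1) {u : Space d → ℝ} (hu : Continuous u) (hβ : ∀ x, |u x| ≤ β) :
    ∃ W : Space d →ᵇ ℝ, (∀ x, W x = posPot V x - μ + μ * (c⁻¹ * |u x| ^ (2 * σ))) ∧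
      (∀ x, 0 ≤ W x) ∧ ‖W - posPot V‖ ≤ μ * (1 + c⁻¹ * β ^ (2 * σ)) := by
  have hcinv := inv_pos.2 hc
  have hβ0 : 0 ≤ β := (abs_nonneg _).trans (hβ 0)
  have hle : ∀ x, ‖-μ + μ * (c⁻¹ * |u x| ^ (2 * σ))‖ ≤ μ * (1 + c⁻¹ * β ^ (2 * σ)) := by
    intro x
    have h1 : |u x| ^ (2 * σ) ≤ β ^ (2 * σ) :=
      Real.rpow_le_rpow (abs_nonneg _) (hβ x) (by positivity)
    refine (norm_add_le _ _).trans ?_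
    rw [norm_neg, Real.norm_of_nonneg hμ.le, Real.norm_of_nonneg (by positivity), mul_add, mul_one]
    gcongr
  have hcont : Continuous fun x => -μ + μ * (c⁻¹ * |u x| ^ (2 * σ)) :=
    continuous_const.add (continuous_const.mul (continuous_const.mul
      (hu.abs.rpow_const fun x => Or.inr (by positivity))))
  let P : Space d →ᵇ ℝ := BoundedContinuousFunction.ofNormedAddCommGroup _ hcont _ hle
  refine ⟨posPot V + P, fun x => ?_, fun x => ?_, ?_⟩
  · change posPot V x + (-μ + μ * (c⁻¹ * |u x| ^ (2 * σ))) = _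
    ring
  · change 0 ≤ posPot V x + (-μ + μ * (c⁻¹ * |u x| ^ (2 * σ)))
    have h1 := one_le_posPot (V := V) x
    have h2 : 0 ≤ μ * (c⁻¹ * |u x| ^ (2 * σ)) := by positivity
    linarith
  · rw [add_sub_cancel_left]
    exact BoundedContinuousFunction.norm_ofNormedAddCommGroup_le hcont (by positivity) hle

section Solutions

variable {V : Space d →ᵇ ℝ} {ψ₀ : Space d → ℝ} {b : ℝ} {p : L2 d × (Fin d → L2 d)}

/-- The right-hand side of the equation of the correction, for a representative `u` of `ψ + R`
below the truncation height. -/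
lemma ae_rhs_eq {σ c : ℝ} (hσ : 1 ≤ σ) (hβ : 0 ≤ b + 1) {ψ R : L2 d} {u : Space d → ℝ}
    (hu : u =ᵐ[volume] (ψ + R : L2 d)) (hb : ∀ x, |u x| ≤ b + 1) :
    rhs σ (b + 1) c hσ hβ ψ R =ᵐ[volume] fun x => c⁻¹ * nl σ (u x) - u x := by
  filter_upwards [hu, nlL_coeFn hσ hβ (ψ + R),
    Lp.coeFn_sub (c⁻¹ • nlL σ (b + 1) hσ hβ (ψ + R)) (ψ + R),
    Lp.coeFn_smul c⁻¹ (nlL σ (b + 1) hσ hβ (ψ + R))] with x e1 e2 e3 e4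
  rw [rhs, e3, Pi.sub_apply, e4, Pi.smul_apply, e2, ← e1, clamp_of_abs_le (hb x), smul_eq_mul]

/-- The equation of the correction in terms of `ψ + R`. -/
lemma IsGround.isWeakSol_add (h : IsGround V ψ₀ b p) {f R : L2 d} {G : Fin d → L2 d} {μ : ℝ}
    (hR : IsWeakSol V (R, G) (μ • f + groundStateEnergy V • R)) :
    IsWeakSol V (p + (R, G)) (μ • f + groundStateEnergy V • (p + (R, G)).1) := by
  have := h.weak.add hR
  have e : groundStateEnergy V • p.1 + (μ • f + groundStateEnergy V • R) =
      μ • f + groundStateEnergy V • (p + (R, G)).1 := by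
    rw [Prod.fst_add, smul_add]; abel
  rwa [e] at this

/-- The correction has a continuous representative with the same bound. -/
lemma exists_continuous_correction (hE : groundStateEnergy V < 0) {σ c : ℝ} (hσ : 1 ≤ σ)
    (hβ : 0 ≤ b + 1) (hc : 0 < c) {ψ : L2 d} (hψ : ∀ᵐ x, |ψ x| ≤ b) {R : L2 d}
    {G : Fin d → L2 d} {μ s : ℝ} (hμ : 0 < μ) (hs : s ≤ 1) (hRb : ∀ᵐ x, |R x| ≤ s)
    (hR : IsWeakSol V (R, G) (μ • rhs σ (b + 1) c hσ hβ ψ R + groundStateEnergy V • R)) :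
    ∃ r : Space d → ℝ, Continuous r ∧ r =ᵐ[volume] R ∧ ∀ x, |r x| ≤ s := by
  have hNb := ae_abs_rhs_le hσ hβ hc hψ (hRb.mono fun x hx => hx.trans hs)
  have he := hR.eq_yukL_posPot (massConst_pos hE)
  dsimp only at he
  generalize rhs σ (b + 1) c hσ hβ ψ R = N at *
  have hFb : ∀ᵐ x, |(mulL (posPot V) R + μ • N : L2 d) x| ≤
      ‖posPot V‖ * s + μ * ((c⁻¹ * nlDeriv σ (b + 1) + 1) * (b + 1)) := by
    filter_upwards [ae_abs_mulL_le (posPot V) hRb, hNb, Lp.coeFn_add (mulL (posPot V) R) (μ • N),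
      Lp.coeFn_smul μ N] with x e1 e2 e3 e4
    rw [e3, Pi.add_apply, e4, Pi.smul_apply, smul_eq_mul]
    refine (abs_add_le _ _).trans ?_
    rw [abs_mul, abs_of_pos hμ]
    gcongr
  obtain ⟨r, hrc, hr⟩ := exists_continuous_yukL (massConst_pos hE) hFb
  rw [← he] at hr
  refine ⟨r, hrc, hr.symm, forall_abs_le_of_ae hrc ?_⟩
  filter_upwards [hr, hRb] with x e1 e2
  rwa [← e1]

/-- The `H¹` bound of the correction. -/
lemma norm_sq_add_le_of_correction {σ c : ℝ} (hσ : 1 ≤ σ) (hβ : 0 ≤ b + 1) (hc : 0 < c) {ψ : L2 d}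
    {R : L2 d} {G : Fin d → L2 d} {μ A n : ℝ} (hμ : 0 < μ) (hA : 0 ≤ A) (hA1 : A * μ ≤ 1)
    (hn : n = ‖rhs σ (b + 1) c hσ hβ ψ 0‖ + (c⁻¹ * nlDeriv σ (b + 1) + 1)) (hRn : ‖R‖ ≤ A * μ)
    (hR : IsWeakSol V (R, G) (μ • rhs σ (b + 1) c hσ hβ ψ R + groundStateEnergy V • R)) :
    ‖R‖ ^ 2 + ∑ i, ‖G i‖ ^ 2 ≤
      ((1 + ‖V‖) * A ^ 2 + (n + |groundStateEnergy V| * A) * A) * μ ^ 2 := by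
  have hL : 0 ≤ c⁻¹ * nlDeriv σ (b + 1) + 1 := by
    have := nlDeriv_nonneg hσ (b + 1)
    positivity
  have hNn : ‖rhs σ (b + 1) c hσ hβ ψ R‖ ≤ n := by
    have e1 := norm_rhs_sub_le hσ hβ (ψ := ψ) (b := b) hc R 0
    rw [sub_zero] at e1
    have e2 := norm_sub_norm_le (rhs σ (b + 1) c hσ hβ ψ R) (rhs σ (b + 1) c hσ hβ ψ 0)
    have e3 : (c⁻¹ * nlDeriv σ (b + 1) + 1) * ‖R‖ ≤ (c⁻¹ * nlDeriv σ (b + 1) + 1) * 1 :=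
      mul_le_mul_of_nonneg_left (hRn.trans hA1) hL
    rw [hn]; linarith
  have hn0 : 0 ≤ n := (norm_nonneg _).trans hNn
  have e1 := hR.norm_sq_add_le
  generalize rhs σ (b + 1) c hσ hβ ψ R = N at *
  have e2 : ‖μ • N + groundStateEnergy V • R‖ ≤ μ * (n + |groundStateEnergy V| * A) := by
    refine (norm_add_le _ _).trans ?_
    rw [norm_smul, norm_smul, Real.norm_of_nonneg hμ.le, Real.norm_eq_abs]
    calc μ * ‖N‖ + |groundStateEnergy V| * ‖R‖
        ≤ μ * n + |groundStateEnergy V| * (A * μ) := by gcongr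
      _ = _ := by ring
  refine e1.trans ?_
  dsimp only
  calc (1 + ‖V‖) * ‖R‖ ^ 2 + ‖μ • N + groundStateEnergy V • R‖ * ‖R‖
      ≤ (1 + ‖V‖) * (A * μ) ^ 2 + μ * (n + |groundStateEnergy V| * A) * (A * μ) := by gcongr
    _ = _ := by ring

/-- The function `u = ψ + R` solves the integral equation of the potential of `exists_nlPot`. -/
lemma IsGround.add_eq_yukL (h : IsGround V ψ₀ b p) (hE : groundStateEnergy V < 0) {σ c : ℝ}
    (hσ : 1 ≤ σ) (hβ : 0 ≤ b + 1) {R : L2 d} {G : Fin d → L2 d} {μ : ℝ} {u : Space d → ℝ}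
    (hu : u =ᵐ[volume] (p.1 + R : L2 d)) (hub : ∀ x, |u x| ≤ b + 1) {W : Space d →ᵇ ℝ}
    (hW : ∀ x, W x = posPot V x - μ + μ * (c⁻¹ * |u x| ^ (2 * σ)))
    (hR : IsWeakSol V (R, G) (μ • rhs σ (b + 1) c hσ hβ p.1 R + groundStateEnergy V • R)) :
    p.1 + R = yukL _ (massConst_pos hE) (mulL W (p.1 + R)) := by
  have hN := ae_rhs_eq (c := c) hσ hβ hu hub
  have he := (h.isWeakSol_add hR).eq_yukL_posPot (massConst_pos hE)
  rw [Prod.fst_add] at he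
  dsimp only at he
  generalize rhs σ (b + 1) c hσ hβ p.1 R = N at *
  refine he.trans (congrArg _ (Lp.ext ?_))
  filter_upwards [hu, hN, mulL_coeFn (posPot V) (p.1 + R), mulL_coeFn W (p.1 + R),
    Lp.coeFn_add (mulL (posPot V) (p.1 + R)) (μ • N), Lp.coeFn_smul μ N] with x e1 e2 e3 e4 e5 e6
  rw [e5, Pi.add_apply, e6, Pi.smul_apply, e2, e3, e4, ← e1, hW, nl, smul_eq_mul]
  ring

lemma IsGround.schrodingerEq_add (h : IsGround V ψ₀ b p) {σ c : ℝ}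
    (hσ : 1 ≤ σ) (hβ : 0 ≤ b + 1) {R : L2 d} {G : Fin d → L2 d} {μ : ℝ} {u : Space d → ℝ}
    (hu : u =ᵐ[volume] (p.1 + R : L2 d)) (hub : ∀ x, |u x| ≤ b + 1)
    (hR : IsWeakSol V (R, G) (μ • rhs σ (b + 1) c hσ hβ p.1 R + groundStateEnergy V • R)) :
    MemH1 u ∧ SchrodingerEq V u fun x =>
      μ * c⁻¹ * nl σ (u x) + (groundStateEnergy V - μ) * u x := by
  have hN := ae_rhs_eq (c := c) hσ hβ hu hub
  have hw := h.isWeakSol_add hR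
  refine ⟨memH1_of_sobolevGraph hw.1 hu, hw.schrodingerEq hu ?_⟩
  rw [Prod.fst_add]
  generalize rhs σ (b + 1) c hσ hβ p.1 R = N at *
  filter_upwards [hu, hN, Lp.coeFn_add (μ • N) (groundStateEnergy V • (p.1 + R)),
    Lp.coeFn_smul μ N, Lp.coeFn_smul (groundStateEnergy V) (p.1 + R)] with x e1 e2 e3 e4 e5
  rw [e3, Pi.add_apply, e4, e5, Pi.smul_apply, Pi.smul_apply, e2, ← e1, smul_eq_mul, smul_eq_mul]
  ring

/-- A nonzero solution `u` of the integral equation, close to `ψ₀`, is positive: its negative part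
vanishes. -/
lemma IsGround.pos_of_close (h : IsGround V ψ₀ b p) (hE : groundStateEnergy V < 0)
    {T : L2 d →L[ℝ] L2 d}
    (hT : ∀ g, ∃ G, IsWeakSol V (T g, G) (g - ⟪p.1, T g⟫_ℝ • p.1 + groundStateEnergy V • T g))
    {W : Space d →ᵇ ℝ} (hW : ∀ x, 0 ≤ W x) {s ε t : ℝ} (hs : ‖W - posPot V‖ ≤ s) (hε : 0 ≤ ε)
    (ht : ∫ x, {x | ψ₀ x ≤ t}.indicator (fun x => ψ₀ x ^ 2) x ≤ ε ^ 2)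
    (hsmall : (‖T‖ + 1) * (s + (‖W‖ * ε) ^ 2) < 1) {v : L2 d} {u : Space d → ℝ}
    (hu : Continuous u) (huv : u =ᵐ[volume] v) (hut : ∀ x, ψ₀ x - t ≤ u x)
    (hv : v = yukL _ (massConst_pos hE) (mulL W v)) (hne : v ≠ 0) (x : Space d) : 0 < u x := by
  have h0 : 0 ≤ v := by
    obtain ⟨g1, g2⟩ := negPart_le_yukL _ hW hv
    refine nonneg_of_negPart_eq_zero (h.eq_zero_of_le hE hT hW hs hε ht hsmall g1 g2 ?_)
    filter_upwards [huv, Lp.coeFn_smul (1 / 2 : ℝ) (|v| - v), Lp.coeFn_sub |v| v,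
      Lp.coeFn_abs v] with x e1 e2 e3 e4 hx
    have e5 : 0 ≤ u x := by linarith [hut x]
    rw [e2, Pi.smul_apply, e3, Pi.sub_apply, e4, ← e1, abs_of_nonneg e5, sub_self, smul_zero]
  obtain ⟨φ, hφc, hφ, hφe⟩ := exists_continuous_pos_of_eq_yukL _ hW hv h0 hne
  have huφ : u = φ := (Continuous.ae_eq_iff_eq volume hu hφc).1 (huv.trans hφe)
  rw [huφ]
  exact hφ x

/-- For each small `μ > 0` there is a continuous correction `R` of size `O(μ)`, in `H¹` and uniformly,
such that `ψ₀ + R` is positive and solves the equation normalized by `ρ^{2σ} = μ / c`. -/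
theorem IsGround.exists_solutions (h : IsGround V ψ₀ b p) (hV : MemLp V 2 volume)
    (hE : groundStateEnergy V < 0) {σ : ℝ} (hσ : 1 ≤ σ) :
    ∃ δ : ℝ, 0 < δ ∧ ∃ C : ℝ, ∀ μ : ℝ, 0 < μ → μ ≤ δ → ∃ R : Space d → ℝ,
      Continuous R ∧ (∀ x, 0 < ψ₀ x + R x) ∧ MemH1 R ∧ h1Norm R ≤ C * μ ∧
        (∀ x, |R x| ≤ C * μ) ∧ MemH1 (fun x => ψ₀ x + R x) ∧
          SchrodingerEq V (fun x => ψ₀ x + R x) fun x =>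
            μ * (∫ x, ψ₀ x ^ (2 * σ + 2))⁻¹ * nl σ (ψ₀ x + R x) +
              (groundStateEnergy V - μ) * (ψ₀ x + R x) := by
  have hb0 := h.bound_pos
  have hβ : 0 ≤ b + 1 := by linarith
  have hc := h.integral_rpow_pos hσ
  obtain ⟨T, hT, hTψ, τ, hτ, hTτ⟩ := h.exists_inverse hV hE
  obtain ⟨A, hA, δ₁, hδ₁, hbr⟩ := h.exists_branch hσ hβ hT hTψ hτ hTτ
  generalize (∫ x, ψ₀ x ^ (2 * σ + 2)) = c at hc hbr ⊢
  have hcinv := inv_pos.2 hc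
  -- `μ s₀` bounds the perturbation of the potential, and `w₀` bounds the potential itself
  obtain ⟨s₀, hs₀⟩ : ∃ s₀, s₀ = 1 + c⁻¹ * (b + 1) ^ (2 * σ) := ⟨_, rfl⟩
  have hs₀0 : 0 < s₀ := by rw [hs₀]; positivity
  obtain ⟨w₀, hw₀⟩ : ∃ w₀, w₀ = ‖posPot V‖ + s₀ := ⟨_, rfl⟩
  have hw₀0 : 0 < w₀ := by rw [hw₀]; positivity
  obtain ⟨ε, hε⟩ : ∃ ε, ε = 1 / (2 * (‖T‖ + 1) * w₀) := ⟨_, rfl⟩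
  have hT0 : 0 < ‖T‖ + 1 := by positivity
  have hε0 : 0 < ε := by rw [hε]; positivity
  have hεw : (‖T‖ + 1) * (w₀ * ε) ^ 2 ≤ 1 / 4 := by
    have e1 : w₀ * ε = 1 / (2 * (‖T‖ + 1)) := by rw [hε]; field_simp
    rw [e1, div_pow, one_pow, mul_one_div, div_le_div_iff₀ (by positivity) (by norm_num)]
    nlinarith [norm_nonneg T]
  obtain ⟨t, ht0, ht⟩ := h.exists_small (ε := ε ^ 2) (by positivity)
  -- the condition `μ Z ≤ 1` gives smallness of the perturbation, `A μ ≤ t` and `A μ ≤ 1 / 2`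
  obtain ⟨Z, hZ⟩ : ∃ Z, Z = 1 + 4 * ((‖T‖ + 1) * s₀) + A / t + 2 * A := ⟨_, rfl⟩
  have hZ0 : 0 < Z := by rw [hZ]; positivity
  obtain ⟨n, hn⟩ : ∃ n, n = ‖rhs σ (b + 1) c hσ hβ p.1 0‖ +
      (c⁻¹ * nlDeriv σ (b + 1) + 1) := ⟨_, rfl⟩
  have hn0 : 0 ≤ n := by
    have := nlDeriv_nonneg hσ (b + 1)
    rw [hn]; positivity
  obtain ⟨C₁, hC₁⟩ : ∃ C₁, C₁ = (1 + ‖V‖) * A ^ 2 + (n + |groundStateEnergy V| * A) * A :=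
    ⟨_, rfl⟩
  have hC₁0 : 0 ≤ C₁ := by rw [hC₁]; positivity
  refine ⟨min δ₁ Z⁻¹, lt_min hδ₁ (inv_pos.2 hZ0), √C₁ + A, fun μ hμ hμδ => ?_⟩
  obtain ⟨-, R, G, hRn, hRb, hRw⟩ := hbr μ hμ (hμδ.trans (min_le_left _ _))
  have hμZ : μ * Z ≤ 1 := by
    calc μ * Z ≤ Z⁻¹ * Z := by gcongr; exact hμδ.trans (min_le_right _ _)
      _ = 1 := inv_mul_cancel₀ hZ0.ne'
  have hsum : μ * Z = μ + 4 * ((‖T‖ + 1) * (μ * s₀)) + A * μ / t + 2 * (A * μ) := by rw [hZ]; ring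
  have p1 : 0 ≤ (‖T‖ + 1) * (μ * s₀) := by positivity
  have p2 : 0 ≤ A * μ / t := by positivity
  have p3 : 0 ≤ A * μ := by positivity
  have hμ1 : μ ≤ 1 := by linarith
  have hAt : A * μ ≤ t := by rw [← div_le_one ht0]; linarith
  have hA1 : A * μ ≤ 1 / 2 := by linarith
  obtain ⟨r, hrc, hRr, hrb⟩ := exists_continuous_correction hE hσ hβ hc h.ae_abs_le hμ
    (by linarith) hRb hRw
  have huc : Continuous fun x => ψ₀ x + r x := h.continuous.add hrc
  have hub : ∀ x, |ψ₀ x + r x| ≤ b + 1 := fun x => by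
    refine (abs_add_le _ _).trans ?_
    rw [abs_of_pos (h.pos x)]
    linarith [h.le x, hrb x]
  have huae : (fun x => ψ₀ x + r x) =ᵐ[volume] (p.1 + R : L2 d) := by
    filter_upwards [h.ae_eq, hRr, Lp.coeFn_add p.1 R] with x e1 e2 e3
    rw [e3, Pi.add_apply, ← e1, ← e2]
  obtain ⟨W, hWx, hW0, hWs⟩ := exists_nlPot V hσ hc hμ hμ1 huc hub
  rw [← hs₀] at hWs
  have hWn : ‖W‖ ≤ w₀ := by
    have e1 := norm_sub_norm_le W (posPot V)
    have e2 : μ * s₀ ≤ 1 * s₀ := by gcongr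
    rw [hw₀]; linarith
  have hsmall : (‖T‖ + 1) * (μ * s₀ + (‖W‖ * ε) ^ 2) < 1 := by
    have e1 : (‖T‖ + 1) * (‖W‖ * ε) ^ 2 ≤ (‖T‖ + 1) * (w₀ * ε) ^ 2 := by gcongr
    rw [mul_add]
    linarith
  have hune : p.1 + R ≠ 0 := by
    intro h0
    have e1 : ‖p.1‖ = ‖R‖ := by rw [eq_neg_of_add_eq_zero_left h0, norm_neg]
    rw [h.norm_eq] at e1
    linarith
  obtain ⟨hH1, hS⟩ := h.schrodingerEq_add hσ hβ huae hub hRw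
  refine ⟨r, hrc, h.pos_of_close hE hT hW0 hWs hε0.le ht hsmall huc huae (fun x => ?_)
    (h.add_eq_yukL hE hσ hβ huae hub hWx hRw) hune, memH1_of_sobolevGraph hRw.1 hRr, ?_,
    fun x => ?_, hH1, hS⟩
  · linarith [neg_le_of_abs_le (hrb x)]
  · rw [h1Norm_eq hRw.1 hRr]
    refine (Real.sqrt_le_sqrt (norm_sq_add_le_of_correction hσ hβ hc hμ hA (by linarith) hn hRn
      hRw)).trans ?_
    rw [← hC₁, Real.sqrt_mul hC₁0, Real.sqrt_sq hμ.le, add_mul]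
    linarith
  · refine (hrb x).trans ?_
    have : 0 ≤ √C₁ * μ := by positivity
    linarith

end Solutions

/-! ### Rapidly decreasing potentials and the amplitude -/

lemma SmoothRapidlyDecreasing.exists_bounded {V : Space d → ℝ} (hV : SmoothRapidlyDecreasing V) :
    ∃ W : Space d →ᵇ ℝ, ⇑W = V := by
  obtain ⟨C, hC⟩ := hV.2 0
  exact ⟨BoundedContinuousFunction.ofNormedAddCommGroup V hV.1.continuous C
    fun x => by simpa using hC x, rfl⟩

lemma SmoothRapidlyDecreasing.tendsto {V : Space d → ℝ} (hV : SmoothRapidlyDecreasing V) :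
    Tendsto V (cocompact (Space d)) (𝓝 0) := by
  obtain ⟨C, hC⟩ := hV.2 1
  have h1 : Tendsto (fun x : Space d => C / ‖x‖) (cocompact (Space d)) (𝓝 0) :=
    tendsto_const_nhds.div_atTop (tendsto_norm_cocompact_atTop (E := Space d))
  refine squeeze_zero_norm' ?_ h1
  filter_upwards [(tendsto_norm_cocompact_atTop (E := Space d)).eventually_gt_atTop 0] with x hx
  rw [le_div_iff₀ hx, Real.norm_eq_abs, mul_comm]
  simpa using hC x

lemma SmoothRapidlyDecreasing.memLp {V : Space d → ℝ} (hV : SmoothRapidlyDecreasing V) :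
    MemLp V 2 volume := by
  obtain ⟨C₀, hC₀⟩ := hV.2 0
  obtain ⟨C₁, hC₁⟩ := hV.2 (d + 1)
  rw [memLp_two_iff_integrable_sq hV.1.continuous.aestronglyMeasurable]
  have hI : Integrable (fun x : Space d => (1 + ‖x‖) ^ (-((d : ℝ) + 1))) :=
    integrable_one_add_norm (by simp)
  refine (hI.const_mul (C₀ * (2 ^ d * (C₀ + C₁)))).mono'
    (hV.1.continuous.pow 2).aestronglyMeasurable (ae_of_all _ fun x => ?_)
  have h0 : |V x| ≤ C₀ := by simpa using hC₀ x
  have h1 := hC₁ x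
  have hx : 0 < 1 + ‖x‖ := by positivity
  have h2 : (1 + ‖x‖) ^ (d + 1) ≤ 2 ^ d * (1 + ‖x‖ ^ (d + 1)) := by
    simpa using add_pow_le zero_le_one (norm_nonneg x) (d + 1)
  have h3 : |V x| * (1 + ‖x‖) ^ (d + 1) ≤ 2 ^ d * (C₀ + C₁) := by
    calc |V x| * (1 + ‖x‖) ^ (d + 1) ≤ |V x| * (2 ^ d * (1 + ‖x‖ ^ (d + 1))) := by gcongr
      _ = 2 ^ d * (|V x| + ‖x‖ ^ (d + 1) * |V x|) := by ring
      _ ≤ 2 ^ d * (C₀ + C₁) := by gcongr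
  have h4 : (1 + ‖x‖) ^ (-((d : ℝ) + 1)) = ((1 + ‖x‖) ^ (d + 1))⁻¹ := by
    rw [Real.rpow_neg hx.le, ← Real.rpow_natCast]; push_cast; rfl
  rw [Real.norm_of_nonneg (sq_nonneg _), h4, ← div_eq_mul_inv, le_div_iff₀ (by positivity)]
  calc V x ^ 2 * (1 + ‖x‖) ^ (d + 1) = |V x| * (|V x| * (1 + ‖x‖) ^ (d + 1)) := by
        rw [← sq_abs]; ring
    _ ≤ C₀ * (2 ^ d * (C₀ + C₁)) := by gcongr; exact (abs_nonneg _).trans h0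

lemma MemH1.const_mul {u : Space d → ℝ} (hu : MemH1 u) (t : ℝ) : MemH1 fun x => t * u x := by
  refine ⟨hu.1.const_mul t, fun i => ?_⟩
  obtain ⟨g, hg, hgw⟩ := hu.2 i
  refine ⟨fun x => t * g x, hg.const_mul t, ?_⟩
  simpa using hgw.clm_comp (t • ContinuousLinearMap.id ℝ ℝ)

lemma rho_nonneg {V ψ₀ : Space d → ℝ} {σ E : ℝ} (hc : 0 < ∫ x, ψ₀ x ^ (2 * σ + 2)) :
    0 ≤ rho V σ ψ₀ E := by
  unfold rho; positivity

lemma rho_rpow {V ψ₀ : Space d → ℝ} {σ E : ℝ} (hσ : 1 ≤ σ) (hc : 0 < ∫ x, ψ₀ x ^ (2 * σ + 2))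
    (hE : E < groundStateEnergy V) : rho V σ ψ₀ E ^ (2 * σ) =
      (groundStateEnergy V - E) * (∫ x, ψ₀ x ^ (2 * σ + 2))⁻¹ := by
  have hμ : 0 < groundStateEnergy V - E := sub_pos.2 hE
  have h1 : 1 / (2 * σ) * (2 * σ) = 1 := by field_simp
  rw [rho, abs_of_pos hμ, Real.mul_rpow (by positivity) (by positivity), ← Real.rpow_mul hμ.le,
    ← Real.rpow_mul hc.le, neg_mul, h1, Real.rpow_one, Real.rpow_neg_one]

/-- Rescaling a positive solution of the normalized equation to a bound state. -/
lemma isPositiveBoundState_mul {V : Space d → ℝ} (hV : Continuous V) {σ E ρ : ℝ} (hE : E < 0)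
    (hρ : 0 < ρ) {u : Space d → ℝ} (hc : Continuous u) (hpos : ∀ x, 0 < u x) (hu : MemH1 u)
    (h : SchrodingerEq V u fun x => ρ ^ (2 * σ) * nl σ (u x) + E * u x) :
    IsPositiveBoundState V σ E fun x => ρ * u x := by
  refine ⟨hE, by fun_prop, fun x => mul_pos hρ (hpos x), hu.const_mul ρ, ?_⟩
  have h1 := h.clm_comp hV (ρ • ContinuousLinearMap.id ℝ ℝ)
  have e : (fun x => |ρ * u x| ^ (2 * σ) * (ρ * u x) + E * (ρ * u x)) =
      fun x => (ρ • ContinuousLinearMap.id ℝ ℝ) (ρ ^ (2 * σ) * nl σ (u x) + E * u x) := by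
    funext x
    rw [abs_mul, abs_of_pos hρ, Real.mul_rpow hρ.le (abs_nonneg _), nl]
    simp
    ring
  rw [e]
  simpa using h1

end NLSBif

end

theorem mainTheorem6 (d : ℕ) (hd : 1 ≤ d) (V : NLSBif.Space d → ℝ)
    (hV : NLSBif.SmoothRapidlyDecreasing V)
    (hdisc : ∃ lam : ℝ, NLSBif.IsDiscreteEigenvalue V lam)
    (σ : ℝ) (hσ : 1 ≤ σ) :
    NLSBif.groundStateEnergy V < 0 ∧
    (∃ ψ₀ : NLSBif.Space d → ℝ, NLSBif.IsGroundState V ψ₀) ∧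
    ∀ ψ₀ : NLSBif.Space d → ℝ, NLSBif.IsGroundState V ψ₀ →
      Integrable (fun x => ψ₀ x ^ (2 * σ + 2)) volume ∧
      ∃ δ₀ : ℝ, 0 < δ₀ ∧ ∃ ψ R : ℝ → NLSBif.Space d → ℝ, ∃ C : ℝ,
        ∀ E ∈ Set.Ico (NLSBif.groundStateEnergy V - δ₀) (NLSBif.groundStateEnergy V),
          NLSBif.IsPositiveBoundState V σ E (ψ E) ∧
          (∀ x, ψ E x = NLSBif.rho V σ ψ₀ E * (ψ₀ x + R E x)) ∧
          NLSBif.MemH1 (R E) ∧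
          NLSBif.h1Norm (R E) ≤ C * NLSBif.rho V σ ψ₀ E ^ (2 * σ) ∧
          ∀ x, |R E x| ≤ C * NLSBif.rho V σ ψ₀ E ^ (2 * σ) := by
  obtain ⟨W, rfl⟩ := hV.exists_bounded
  obtain ⟨hE, hne⟩ := NLSBif.groundStateEnergy_neg hd W hV.tendsto hdisc
  refine ⟨hE, NLSBif.exists_isGroundState hV.memLp hE hne, fun ψ₀ hψ₀ => ?_⟩
  obtain ⟨b, p, h⟩ := hψ₀.exists_isGround hE
  obtain ⟨δ, hδ, C, hC⟩ := h.exists_solutions hV.memLp hE hσ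
  have hc := h.integral_rpow_pos hσ
  have hex : ∀ μ : ℝ, ∃ R : NLSBif.Space d → ℝ, 0 < μ → μ ≤ δ → _ := fun μ => by
    by_cases hμ : 0 < μ ∧ μ ≤ δ
    · exact (hC μ hμ.1 hμ.2).imp fun R hR _ _ => hR
    · exact ⟨0, fun h1 h2 => absurd ⟨h1, h2⟩ hμ⟩
  choose R hR using hex
  refine ⟨h.integrable_rpow hσ, δ, hδ,
    fun E x => NLSBif.rho W σ ψ₀ E * (ψ₀ x + R (NLSBif.groundStateEnergy W - E) x),
    fun E => R (NLSBif.groundStateEnergy W - E), C * ∫ x, ψ₀ x ^ (2 * σ + 2), fun E hEI => ?_⟩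
  obtain ⟨h1, h2, h3, h4, h5, h6, h7⟩ := hR (NLSBif.groundStateEnergy W - E) (sub_pos.2 hEI.2)
    (by linarith [hEI.1])
  have hρ := NLSBif.rho_rpow hσ hc hEI.2
  have hρC : (C * ∫ x, ψ₀ x ^ (2 * σ + 2)) * NLSBif.rho W σ ψ₀ E ^ (2 * σ) =
      C * (NLSBif.groundStateEnergy W - E) := by
    rw [hρ]
    linear_combination C * (NLSBif.groundStateEnergy W - E) * mul_inv_cancel₀ hc.ne'
  have hρ0 : 0 < NLSBif.rho W σ ψ₀ E := by
    refine (NLSBif.rho_nonneg hc).lt_of_ne fun h0 => ?_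
    rw [← h0, Real.zero_rpow (by positivity)] at hρ
    have : 0 < (NLSBif.groundStateEnergy W - E) * (∫ x, ψ₀ x ^ (2 * σ + 2))⁻¹ :=
      mul_pos (sub_pos.2 hEI.2) (inv_pos.2 hc)
    linarith
  rw [hρC]
  refine ⟨NLSBif.isPositiveBoundState_mul W.continuous (hEI.2.trans hE) hρ0
    (hψ₀.continuous.add h1) h2 h6 ?_, fun x => rfl, h3, h4, h5⟩
  rw [hρ]
  simpa using h7
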